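/- There are a program $P$ for the read-only word-RAM and constants $c, C$ such that the following holds for every graph $G$ (finite, simple, undirected) with vertex set $\{0,\dots,n-1\}$, every $k \ge 0$, every $a$, and every word size $w$ with $c\log n \le w \le a\log n$ and $k<2^w$. Started on the instance $(G,k)$ of Feedback Vertex Set, $P$ halts after at most $C\,n^4 k\log k$ steps, uses at most $C a\,k^2\log n$ bits of working memory, and either returns a set $X$ of at most $3k^2$ vertices that is a feedback vertex set of $G$ (that is, $G-X$ is a forest), or answers that $(G,k)$ is a no-instance, in which case $G$ indeed has no feedback vertex set of at most $k$ vertices. In short: there is an $O(n^4k\log k)$-time, $O(k^2\log n)$-bit algorithm that either returns a feedback vertex set of at most $3k^2$ vertices or correctly reports a no-instance. Here the read-only word-RAM has a read-only input memory and a read-write working memory, both with constant-time random access, and executes arithmetic operations ($+,-,\cdot,/,\bmod$), bit shifts, comparisons and memory accesses on words of $w$ bits in one step each. The input consists of $n$, $k$ and the adjacency arrays of $G$, with the neighbours of each vertex in increasing order. The space in bits is $w$ times the number of registers and of cells of the working memory up to the last one accessed; the returned set $X$ is stored in the working memory. In the bounds, $\log x$ stands for $\lfloor\log_2(x+2)\rfloor$,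 the factor $n^4$ for $(n+1)^4$, and the factors $k$ and $k^2$ of the time and space bounds for $k+1$ and $(k+1)^2$, so that the bounds do not vanish for $n,k\le 1$. -/

import Mathlib

/-! Feedback vertex sets, and the read-only word-RAM with unit-cost instructions. -/

namespace ROWordRAM

/-- A set `F` of vertices is a feedback vertex set of `G` if `G - F` is a forest. -/
def IsFeedbackVertexSet {V : Type*} (G : SimpleGraph V) (F : Set V) : Prop :=
  (G.induce Fᶜ).IsAcyclic

/-- `(G, k)` is a yes-instance: there is a feedback vertex set with at most `k` vertices. -/
def IsYesInstance {V : Type*} (G : SimpleGraph V) (k : ℕ) : Prop :=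
  ∃ F : Finset V, F.card ≤ k ∧ IsFeedbackVertexSet G (F : Set V)

/-- Arithmetic and bit-shift operations on words. -/
inductive Op
  | add | sub | mul | div | mod | shl | shr

/-- The value of an operation on words of `w` bits. Addition, subtraction, multiplication and
left shift are taken modulo `2 ^ w`. -/
def Op.eval (w : ℕ) : Op → ℕ → ℕ → ℕ
  | .add, x, y => (x + y) % 2 ^ w
  | .sub, x, y => (x + (2 ^ w - y)) % 2 ^ w
  | .mul, x, y => (x * y) % 2 ^ w
  | .div, x, y => x / y
  | .mod, x, y => x % y
  | .shl, x, y => (x * 2 ^ y) % 2 ^ w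
  | .shr, x, y => x / 2 ^ y

/-- Comparisons of words. -/
inductive Cmp
  | lt | le | eq | ne

/-- The meaning of a comparison. -/
def Cmp.holds : Cmp → ℕ → ℕ → Prop
  | .lt, x, y => x < y
  | .le, x, y => x ≤ y
  | .eq, x, y => x = y
  | .ne, x, y => x ≠ y

/-- Programs. All arguments except the literal of `const` are indices of registers. There is an
instruction that reads the input memory, but none that writes to it. -/
inductive Prog
  /-- do nothing -/
  | skip
  /-- put a literal into register `r` -/
  | const (r c : ℕ)
  /-- put the result of an operation on registers `x`, `y` into register `r` -/
  | op (o : Op) (r x y : ℕ)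
  /-- put into `r` the word of the input memory at the address in register `x` -/
  | read (r x : ℕ)
  /-- put into `r` the word of the working memory at the address in register `x` -/
  | load (r x : ℕ)
  /-- write register `y` to the working memory at the address in register `x` -/
  | store (x y : ℕ)
  /-- sequential composition -/
  | seq (p q : Prog)
  /-- branch on a comparison of registers `x`, `y` -/
  | ite (b : Cmp) (x y : ℕ) (p q : Prog)
  /-- repeat `p` as long as the comparison of registers `x`, `y` holds -/
  | loop (b : Cmp) (x y : ℕ) (p : Prog)

/-- Number of registers of a program: one more than the largest index of a register in it. -/
def Prog.numRegs : Prog → ℕ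
  | .skip => 0
  | .const r _ => r + 1
  | .op _ r x y => max r (max x y) + 1
  | .read r x => max r x + 1
  | .load r x => max r x + 1
  | .store x y => max x y + 1
  | .seq p q => max p.numRegs q.numRegs
  | .ite _ x y p q => max (max x y + 1) (max p.numRegs q.numRegs)
  | .loop _ x y p => max (max x y + 1) p.numRegs

/-- Registers, working memory, and the high-water mark `top` of the working memory: every cell
that has been accessed so far has an address smaller than `top`. -/
structure State where
  reg : ℕ → ℕ
  mem : ℕ → ℕ
  top : ℕ

/-- The state with all registers and all cells zero, and no cell accessed. -/
def State.init : State := ⟨fun _ => 0, fun _ => 0, 0⟩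

/-- Write `v` to register `r`. -/
def State.setReg (s : State) (r v : ℕ) : State :=
  { s with reg := Function.update s.reg r v }

/-- Record an access to the cell with address `a`. -/
def State.touch (s : State) (a : ℕ) : State :=
  { s with top := max s.top (a + 1) }

/-- Write `v` to the cell with address `a`. -/
def State.setMem (s : State) (a v : ℕ) : State :=
  { s with mem := Function.update s.mem a v }

/-- `Exec w inp p s s' t`: with word size `w` and contents `inp` of the read-only input memory, the
program `p` started in `s` halts in `s'` after exactly `t` steps. Every instruction and every
evaluation of a comparison is one step. -/
inductive Exec (w : ℕ) (inp : List ℕ) : Prog → State → State → ℕ → Prop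
  | skip (s : State) : Exec w inp .skip s s 1
  | const (s : State) (r c : ℕ) :
      Exec w inp (.const r c) s (s.setReg r (c % 2 ^ w)) 1
  | op (s : State) (o : Op) (r x y : ℕ) :
      Exec w inp (.op o r x y) s (s.setReg r (o.eval w (s.reg x) (s.reg y))) 1
  | read (s : State) (r x : ℕ) :
      Exec w inp (.read r x) s (s.setReg r (inp.getD (s.reg x) 0 % 2 ^ w)) 1
  | load (s : State) (r x : ℕ) :
      Exec w inp (.load r x) s ((s.touch (s.reg x)).setReg r (s.mem (s.reg x))) 1
  | store (s : State) (x y : ℕ) :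
      Exec w inp (.store x y) s ((s.touch (s.reg x)).setMem (s.reg x) (s.reg y)) 1
  | seq {p q : Prog} {s s₁ s₂ : State} {t₁ t₂ : ℕ} :
      Exec w inp p s s₁ t₁ → Exec w inp q s₁ s₂ t₂ → Exec w inp (.seq p q) s s₂ (t₁ + t₂)
  | iteTrue {b : Cmp} {x y : ℕ} {p q : Prog} {s s₁ : State} {t : ℕ} :
      b.holds (s.reg x) (s.reg y) → Exec w inp p s s₁ t →
        Exec w inp (.ite b x y p q) s s₁ (t + 1)
  | iteFalse {b : Cmp} {x y : ℕ} {p q : Prog} {s s₁ : State} {t : ℕ} :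
      ¬ b.holds (s.reg x) (s.reg y) → Exec w inp q s s₁ t →
        Exec w inp (.ite b x y p q) s s₁ (t + 1)
  | loopTrue {b : Cmp} {x y : ℕ} {p : Prog} {s s₁ s₂ : State} {t₁ t₂ : ℕ} :
      b.holds (s.reg x) (s.reg y) → Exec w inp p s s₁ t₁ →
        Exec w inp (.loop b x y p) s₁ s₂ t₂ → Exec w inp (.loop b x y p) s s₂ (t₁ + t₂ + 1)
  | loopFalse {b : Cmp} {x y : ℕ} {p : Prog} {s : State} :
      ¬ b.holds (s.reg x) (s.reg y) → Exec w inp (.loop b x y p) s s 1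

/-- Space in bits of a run of `p` that ends in `s`: the registers and the used part of the working
memory, with `w` bits each. -/
def spaceBits (w : ℕ) (p : Prog) (s : State) : ℕ := (p.numRegs + s.top) * w

open Classical in
/-- The neighbours of `v` in increasing order. -/
noncomputable def neighborList {n : ℕ} (G : SimpleGraph (Fin n)) (v : Fin n) : List (Fin n) :=
  (List.finRange n).filter (fun u => G.Adj v u)

/-- Adjacency-array representation of the instance `(G, k)`: the words `n` and `k`, then `n + 1`
words of which the `i`-th (`i = 0, …, n`) is the address at which the neighbours of vertex `i` begin
(and those of vertex `i - 1` have ended), then the neighbours of `0`, of `1`, …, of `n - 1`. -/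
noncomputable def encode {n : ℕ} (G : SimpleGraph (Fin n)) (k : ℕ) : List ℕ :=
  [n, k] ++
    (List.range (n + 1)).map
      (fun i => n + 3 + (((List.finRange n).take i).flatMap (neighborList G)).length) ++
    ((List.finRange n).flatMap (neighborList G)).map (fun u => (u : ℕ))

/-- The program has answered "no-instance": register `0` holds `0`. -/
def AnswersNo (s : State) : Prop := s.reg 0 = 0

/-- The program has returned `X`: register `0` holds `1`, and the cells `0, …, ℓ - 1` of the working
memory, where `ℓ` is the content of register `1`, list the vertices in `X`. -/
def Returns {n : ℕ} (s : State) (X : Finset (Fin n)) : Prop :=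
  s.reg 0 = 1 ∧ (Finset.range (s.reg 1)).image s.mem = X.map Fin.valEmbedding

/-- Binary logarithm, at least `1`. -/
def lg (x : ℕ) : ℕ := Nat.log 2 (x + 2)

end ROWordRAM

/-!
The algorithm keeps a set `X` of at most `3 k²` vertices and, in each of at most `k` rounds, adds to
it the `3 k` vertices of largest degree in the `2`-core of `G - X`. A round lowers the least size of
a feedback vertex set of `G - X`: let `F` be one of at most `k` vertices. If `F` contains a selected
vertex, this vertex is no longer needed. Otherwise some selected vertex `v` has degree two in the
core, since selected vertices of degree at least three would contribute more to the excess degree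
`∑ (d(x) - 2)` than deleting `F` can destroy. Then all vertices of the core that are not selected
have degree two, and the vertices of `F` in the component of `v` are no longer needed. Hence a
nonempty core after `k` rounds proves that there is no solution, and so do more than `(k + 1) n`
edges. If `n ≤ 3 k²`, all vertices may be returned.

For `n` much larger than `k²`, neither the core nor a search of `G - X` can be stored. Core degrees
are instead computed by contour walks, which leave each vertex by the edge that follows, in its
adjacency array, the one by which it has been entered. The part of `G - X` behind the dart `(v, u)`
is a tree hanging at `v` exactly if the walk starting with it, up to its first arrival at `v`,
returns to every vertex from the neighbour to which it has last left. This condition is tested for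
one vertex `y` at a time, with a new walk for each `y`, so that a single neighbour has to be
remembered.
-/

namespace ROWordRAM

open Finset Relation

section Forest

variable {V : Type*} {G : SimpleGraph V}

open Classical in
/-- The neighbours of `v` in the vertex set `S`, which need not contain `v`. -/
noncomputable def neighborsIn (G : SimpleGraph V) (S : Finset V) (v : V) : Finset V :=
  {u ∈ S | G.Adj v u}

theorem mem_neighborsIn {S : Finset V} {v u : V} : u ∈ neighborsIn G S v ↔ u ∈ S ∧ G.Adj v u := by
  classical exact mem_filter

theorem neighborsIn_subset (S : Finset V) (v : V) : neighborsIn G S v ⊆ S :=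
  fun _ hu => (mem_neighborsIn.1 hu).1

theorem neighborsIn_mono {S T : Finset V} (h : S ⊆ T) (v : V) :
    neighborsIn G S v ⊆ neighborsIn G T v :=
  fun _ hu => mem_neighborsIn.2 ((mem_neighborsIn.1 hu).imp_left fun hS => h hS)

/-- The degree of `v` into the vertex set `S`. For `v ∈ S` it is the degree of `v` in the subgraph
induced by `S`. -/
noncomputable def degIn (G : SimpleGraph V) (S : Finset V) (v : V) : ℕ := #(neighborsIn G S v)

theorem degIn_mono {S T : Finset V} (h : S ⊆ T) (v : V) : degIn G S v ≤ degIn G T v :=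
  card_le_card (neighborsIn_mono h v)

theorem degIn_le_card (S : Finset V) (v : V) : degIn G S v ≤ #S :=
  card_le_card (neighborsIn_subset S v)

theorem degIn_singleton_self (v : V) : degIn G {v} v = 0 := by
  simp only [degIn, neighborsIn, filter_singleton, SimpleGraph.irrefl, if_false, card_empty]

theorem exists_adj_ne_of_two_le_degIn {S : Finset V} {v : V} (h : 2 ≤ degIn G S v) (u : V) :
    ∃ x ∈ S, G.Adj v x ∧ x ≠ u := by
  obtain ⟨x, hx, hxu⟩ := exists_mem_ne h u
  rw [mem_neighborsIn] at hx
  exact ⟨x, hx.1, hx.2, hxu⟩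

theorem mem_of_degIn_le {S K : Finset V} {x y : V} (hSK : S ⊆ K)
    (hx : degIn G K x ≤ degIn G S x) (hy : y ∈ K) (hxy : G.Adj x y) : y ∈ S := by
  have heq : neighborsIn G S x = neighborsIn G K x :=
    eq_of_subset_of_card_le (neighborsIn_mono hSK x) hx
  exact (mem_neighborsIn.1 (heq ▸ mem_neighborsIn.2 ⟨hy, hxy⟩)).1

theorem sum_degIn_comm (S T : Finset V) : ∑ v ∈ S, degIn G T v = ∑ v ∈ T, degIn G S v := by
  classical
  have := sum_card_bipartiteAbove_eq_sum_card_bipartiteBelow (s := S) (t := T) G.Adj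
  simpa only [bipartiteAbove, bipartiteBelow, degIn, neighborsIn, G.adj_comm] using this

/-- The graph induced by `W` is a forest, expressed by degrees: every nonempty subset of `W` has a
vertex with at most one neighbour in that subset. By `isForestOn_iff_isAcyclic` this is acyclicity
of the induced graph. -/
def IsForestOn (G : SimpleGraph V) (W : Finset V) : Prop :=
  ∀ S ⊆ W, S.Nonempty → ∃ v ∈ S, degIn G S v ≤ 1

theorem isForestOn_empty : IsForestOn G ∅ :=
  fun _ hS hne => absurd (subset_empty.1 hS) hne.ne_empty

theorem IsForestOn.mono {W W' : Finset V} (h : IsForestOn G W) (hW : W' ⊆ W) : IsForestOn G W' :=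
  fun S hS => h S (hS.trans hW)

theorem exists_degIn_le_one_of_isAcyclic {S : Finset V} (hS : S.Nonempty)
    (h : (G.induce (S : Set V)).IsAcyclic) : ∃ v ∈ S, degIn G S v ≤ 1 := by
  have : Nonempty (S : Set V) := hS.coe_sort
  obtain ⟨u, v, p, hp, hmax⟩ :=
    SimpleGraph.Walk.exists_isPath_forall_isPath_length_le_length (G.induce (S : Set V))
  -- All neighbours of an end of a longest path are on the path, hence equal to its second vertex.
  have hsnd : ∀ w (hw : w ∈ S), G.Adj u w → (⟨w, hw⟩ : (S : Set V)) = p.snd := by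
    intro w hw huw
    have huw' : (G.induce (S : Set V)).Adj u ⟨w, hw⟩ := huw
    refine h.eq_snd_of_adj_start hp huw' ?_
    by_contra hnot
    have hlen := hmax _ _ _ (hp.cons (h := huw'.symm) hnot)
    rw [SimpleGraph.Walk.length_cons] at hlen
    omega
  refine ⟨u, u.2, card_le_one.2 fun a ha b hb => ?_⟩
  rw [mem_neighborsIn] at ha hb
  exact congrArg Subtype.val ((hsnd a ha.1 ha.2).trans (hsnd b hb.1 hb.2).symm)

theorem exists_two_neighbors_of_isCycle {u v : V} {p : G.Walk u u} (hp : p.IsCycle)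
    (hv : v ∈ p.support) :
    ∃ a ∈ p.support, ∃ b ∈ p.support, a ≠ b ∧ G.Adj v a ∧ G.Adj v b := by
  obtain ⟨a, b, hab, heq⟩ := Set.ncard_eq_two.1 (hp.ncard_neighborSet_toSubgraph_eq_two hv)
  have hmem : ∀ x ∈ p.toSubgraph.neighborSet v, x ∈ p.support ∧ G.Adj v x := fun x hx =>
    ⟨p.mem_verts_toSubgraph.1 (p.toSubgraph.edge_vert hx.symm), hx.adj_sub⟩
  obtain ⟨ha, hva⟩ := hmem a (heq ▸ Set.mem_insert a _)
  obtain ⟨hb, hvb⟩ := hmem b (heq ▸ Set.mem_insert_of_mem a rfl)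
  exact ⟨a, ha, b, hb, hab, hva, hvb⟩

theorem isForestOn_iff_isAcyclic {W : Finset V} :
    IsForestOn G W ↔ (G.induce (W : Set V)).IsAcyclic := by
  constructor
  · intro h u p hp
    classical
    let S : Finset V := (p.support.map Subtype.val).toFinset
    have hmem : ∀ {x}, x ∈ S ↔ ∃ y ∈ p.support, y.1 = x := by
      simp only [S, List.mem_toFinset, List.mem_map, implies_true]
    have hSW : S ⊆ W := by
      intro x hx
      obtain ⟨y, -, rfl⟩ := hmem.1 hx
      exact y.2
    obtain ⟨v, hv, hdeg⟩ := h S hSW ⟨u, hmem.2 ⟨u, p.start_mem_support, rfl⟩⟩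
    obtain ⟨w, hw, rfl⟩ := hmem.1 hv
    obtain ⟨a, ha, b, hb, hab, hwa, hwb⟩ := exists_two_neighbors_of_isCycle hp hw
    exact hab (Subtype.ext (card_le_one.1 hdeg a (mem_neighborsIn.2 ⟨hmem.2 ⟨a, ha, rfl⟩, hwa⟩)
      b (mem_neighborsIn.2 ⟨hmem.2 ⟨b, hb, rfl⟩, hwb⟩)))
  · intro h S hS hne
    exact exists_degIn_le_one_of_isAcyclic hne (h.embedding (G.induceHomOfLE (coe_subset.2 hS)))

variable [DecidableEq V]

theorem degIn_union {S T : Finset V} (h : Disjoint S T) (v : V) :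
    degIn G (S ∪ T) v = degIn G S v + degIn G T v := by
  have hunion : neighborsIn G (S ∪ T) v = neighborsIn G S v ∪ neighborsIn G T v := by
    classical exact filter_union _ S T
  rw [degIn, hunion, card_union_of_disjoint
    (h.mono (neighborsIn_subset S v) (neighborsIn_subset T v))]
  rfl

theorem sum_degIn_union {S T : Finset V} (h : Disjoint S T) :
    ∑ v ∈ S ∪ T, degIn G (S ∪ T) v =
      ∑ v ∈ S, degIn G S v + 2 * ∑ v ∈ T, degIn G S v + ∑ v ∈ T, degIn G T v := by
  simp only [sum_union h, degIn_union h, sum_add_distrib]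
  rw [sum_degIn_comm S T]
  ring

theorem sum_degIn_eq_sum_erase {S : Finset V} {v : V} (hv : v ∈ S) :
    ∑ x ∈ S, degIn G S x = ∑ x ∈ S.erase v, degIn G (S.erase v) x + 2 * degIn G S v := by
  have hdis : Disjoint (S.erase v) {v} := disjoint_singleton_right.2 (notMem_erase v S)
  have hunion : S.erase v ∪ {v} = S := by rw [union_comm, ← insert_eq, insert_erase hv]
  have hsum := sum_degIn_union (G := G) hdis
  have hdeg := degIn_union (G := G) hdis v
  rw [hunion] at hsum hdeg
  rw [hsum, hdeg, sum_singleton, sum_singleton, degIn_singleton_self, add_zero, add_zero]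

omit [DecidableEq V] in
theorem IsForestOn.sum_degIn_le {W : Finset V} (h : IsForestOn G W) (hne : W.Nonempty) :
    ∑ v ∈ W, degIn G W v + 2 ≤ 2 * #W := by
  classical
  induction W using Finset.strongInduction with
  | H W ih =>
    obtain ⟨v, hv, hdeg⟩ := h W subset_rfl hne
    have hsum := sum_degIn_eq_sum_erase (G := G) hv
    have hcard := card_erase_add_one hv
    rcases (W.erase v).eq_empty_or_nonempty with hempty | hne'
    · have hW : W = {v} := (erase_eq_empty_iff W v).1 hempty |>.resolve_left hne.ne_empty
      subst hW
      rw [sum_singleton, degIn_singleton_self, card_singleton]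
    · have := ih _ (erase_ssubset hv) (h.mono (erase_subset v W)) hne'
      omega

theorem IsForestOn.exists_mem_of_two_le_degIn {W F S : Finset V} (h : IsForestOn G (W \ F))
    (hS : S ⊆ W) (hne : S.Nonempty) (h2 : ∀ v ∈ S, 2 ≤ degIn G S v) : ∃ f ∈ F, f ∈ S := by
  by_contra! hdis
  obtain ⟨v, hv, hdeg⟩ := h S (fun x hx => mem_sdiff.2 ⟨hS hx, fun hF => hdis x hF hx⟩) hne
  have := h2 v hv
  omega

theorem sum_degIn_add_sum_degIn_sdiff (U F : Finset V) :
    ∑ v ∈ U, degIn G U v + ∑ v ∈ U ∩ F, degIn G (U ∩ F) v =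
      ∑ v ∈ U \ F, degIn G (U \ F) v + 2 * ∑ v ∈ U ∩ F, degIn G U v := by
  have hdis : Disjoint (U \ F) (U ∩ F) := disjoint_sdiff_inter U F
  have hsum := sum_degIn_union (G := G) hdis
  have hdeg := degIn_union (G := G) hdis
  rw [sdiff_union_inter] at hsum hdeg
  simp only [hsum, sum_congr rfl fun v _ => hdeg v, sum_add_distrib]
  ring

theorem sum_degIn_le_of_isForestOn_sdiff {U F : Finset V} (h : IsForestOn G (U \ F)) :
    ∑ v ∈ U, degIn G U v ≤ 2 * ((#F + 1) * #U) := by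
  have hsplit := sum_degIn_add_sum_degIn_sdiff (G := G) U F
  have hF : ∑ v ∈ U ∩ F, degIn G U v ≤ #F * #U :=
    (sum_le_card_nsmul _ _ _ fun v _ => degIn_le_card U v).trans
      (Nat.mul_le_mul_right _ (card_le_card inter_subset_right))
  have hforest : ∑ v ∈ U \ F, degIn G (U \ F) v ≤ 2 * #U := by
    rcases (U \ F).eq_empty_or_nonempty with hempty | hne
    · rw [hempty, sum_empty]
      exact Nat.zero_le _
    · have := h.sum_degIn_le hne
      have := card_le_card (sdiff_subset (s := U) (t := F))
      omega
  rw [add_mul]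
  omega

theorem sum_degIn_sdiff_add_two_le {K F : Finset V} (h : IsForestOn G (K \ F))
    (hne : (K \ F).Nonempty) :
    ∑ v ∈ K \ F, degIn G K v + 2 ≤ 2 * #(K \ F) + ∑ v ∈ K ∩ F, degIn G K v := by
  have hsplit := sum_degIn_add_sum_degIn_sdiff (G := G) K F
  have hforest := h.sum_degIn_le hne
  have hparts := sum_inter_add_sum_sdiff K F (degIn G K)
  omega

theorem sdiff_ssubset_of_mem {α : Type*} [DecidableEq α] {S T : Finset α} {x : α} (hS : x ∈ S)
    (hT : x ∈ T) : S \ T ⊂ S :=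
  Finset.ssubset_iff_subset_ne.2 ⟨sdiff_subset, fun h => (mem_sdiff.1 (h ▸ hS)).2 hT⟩

end Forest

section Component

variable {V : Type*} {G : SimpleGraph V}

open Classical in
/-- The vertices of `K` that can be reached from `v` inside `K`. -/
noncomputable def component (G : SimpleGraph V) (K : Finset V) (v : V) : Finset V :=
  {x ∈ K | ReflTransGen (fun a b => G.Adj a b ∧ b ∈ K) v x}

theorem mem_component {K : Finset V} {v x : V} :
    x ∈ component G K v ↔ x ∈ K ∧ ReflTransGen (fun a b => G.Adj a b ∧ b ∈ K) v x := by
  classical exact mem_filter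

theorem component_subset (K : Finset V) (v : V) : component G K v ⊆ K :=
  fun _ hx => (mem_component.1 hx).1

theorem degIn_component {K : Finset V} {v x : V} (hx : x ∈ component G K v) :
    degIn G (component G K v) x = degIn G K x := by
  refine (degIn_mono (component_subset K v) x).antisymm (card_le_card fun y hy => ?_)
  obtain ⟨hyK, hxy⟩ := mem_neighborsIn.1 hy
  exact mem_neighborsIn.2
    ⟨mem_component.2 ⟨hyK, (mem_component.1 hx).2.tail ⟨hxy, hyK⟩⟩, hxy⟩

theorem notMem_of_mem_component {K S : Finset V} {v x : V} (hvK : v ∈ K) (hvS : v ∉ S)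
    (hS : ∀ a ∈ S, ∀ b ∈ K, G.Adj a b → b ∈ S) (hx : x ∈ component G K v) : x ∉ S := by
  suffices x ∈ K ∧ x ∉ S from this.2
  obtain ⟨-, hreach⟩ := mem_component.1 hx
  clear hx
  induction hreach with
  | refl => exact ⟨hvK, hvS⟩
  | tail _ hbc ih => exact ⟨hbc.2, fun hc => ih.2 (hS _ hc _ ih.1 hbc.1.symm)⟩

end Component

section Reduction

variable {V : Type*} [DecidableEq V] {G : SimpleGraph V}

/-- `T` consists of the `m` elements of `S` with the largest values of `f`, or of all elements of
`S` if these are fewer than `m`. -/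
structure IsTopSelection {α : Type*} (f : α → ℕ) (m : ℕ) (S T : Finset α) : Prop where
  subset : T ⊆ S
  card_le : #T ≤ m
  eq_or_card_eq : T = S ∨ #T = m
  le_of_notMem : ∀ x ∈ S, x ∉ T → ∀ y ∈ T, f x ≤ f y

theorem not_disjoint_of_three_le_degIn {K F T : Finset V} {k : ℕ}
    (hK : ∀ v ∈ K, 2 ≤ degIn G K v) (hF : #F ≤ k) (h : IsForestOn G (K \ F))
    (hT : T ⊆ K) (hne : T.Nonempty) (hcard : #T = 3 * k)
    (htop : ∀ x ∈ K, x ∉ T → ∀ v ∈ T, degIn G K x ≤ degIn G K v)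
    (h3 : ∀ v ∈ T, 3 ≤ degIn G K v) : ¬ Disjoint F T := by
  intro hdis
  obtain ⟨b, hb, hmin⟩ := exists_min_image T (degIn G K) hne
  have hTF : T ⊆ K \ F := fun v hv => mem_sdiff.2 ⟨hT hv, disjoint_right.1 hdis hv⟩
  -- With `d` the degree of `b`, the vertices of `T` have excess degree at least `3 k (d - 2) ≥ k d`
  -- in total, more than the vertices of `F`, of degree at most `d`, can destroy.
  have hexcess := sum_degIn_sdiff_add_two_le h (hne.mono hTF)
  rw [← sum_sdiff hTF] at hexcess
  have hsumT : #T * degIn G K b ≤ ∑ v ∈ T, degIn G K v := card_nsmul_le_sum T _ _ hmin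
  have hsumRest : #((K \ F) \ T) * 2 ≤ ∑ v ∈ (K \ F) \ T, degIn G K v :=
    card_nsmul_le_sum _ _ _ fun v hv => hK v (sdiff_subset (sdiff_subset hv))
  have hsumF : ∑ v ∈ K ∩ F, degIn G K v ≤ #(K ∩ F) * degIn G K b :=
    sum_le_card_nsmul _ _ _ fun v hv =>
      htop v (mem_inter.1 hv).1 (disjoint_left.1 hdis (mem_inter.1 hv).2) b hb
  have hcardF : #(K ∩ F) * degIn G K b ≤ k * degIn G K b :=
    Nat.mul_le_mul_right _ ((card_le_card inter_subset_right).trans hF)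
  have hcardT := card_sdiff_add_card_eq_card hTF
  rw [hcard] at hsumT hcardT
  have h3k : 3 * k ≤ k * degIn G K b := by nlinarith [h3 b hb]
  linarith

theorem IsForestOn.exists_ssubset_of_degIn_eq_two {W K F T : Finset V} {v : V}
    (h : IsForestOn G (W \ F)) (hKW : K ⊆ W) (hK : ∀ x ∈ K, 2 ≤ degIn G K x)
    (hmax : ∀ S ⊆ W, (∀ x ∈ S, 2 ≤ degIn G S x) → S ⊆ K) (hT : T ⊆ K) (hv : v ∈ T)
    (h2 : ∀ x ∈ K, x ∉ T → degIn G K x = 2) :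
    ∃ F' ⊂ F, IsForestOn G ((W \ T) \ F') := by
  -- The cycles of `W \ T` are whole components of `K`. None of them is the component of `v`, so
  -- that `F` need not contain vertices of the latter any more.
  obtain ⟨f, hfF, hfv⟩ := h.exists_mem_of_two_le_degIn ((component_subset K v).trans hKW)
    ⟨v, mem_component.2 ⟨hT hv, .refl⟩⟩
    fun x hx => (degIn_component hx).symm ▸ hK x (component_subset K v hx)
  refine ⟨F \ component G K v, sdiff_ssubset_of_mem hfF hfv, fun S hS hne => ?_⟩
  by_contra! hdeg
  have hSW : S ⊆ W := fun x hx => sdiff_subset (sdiff_subset (hS hx))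
  have hST : ∀ x ∈ S, x ∉ T := fun x hx => (mem_sdiff.1 (sdiff_subset (hS hx))).2
  have hSK : S ⊆ K := hmax S hSW hdeg
  have hclosed : ∀ a ∈ S, ∀ b ∈ K, G.Adj a b → b ∈ S := fun a ha b hb =>
    mem_of_degIn_le hSK ((h2 a (hSK ha) (hST a ha)).trans_le (hdeg a ha)) hb
  obtain ⟨g, hgF, hgS⟩ := h.exists_mem_of_two_le_degIn hSW hne hdeg
  refine (mem_sdiff.1 (hS hgS)).2 (mem_sdiff.2 ⟨hgF, fun hgv => ?_⟩)
  exact notMem_of_mem_component (hT hv) (fun hvS => hST v hvS hv) hclosed hgv hgS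

/-- `K` is the largest subset of `W` that induces a subgraph of minimum degree at least two. It is
what remains of `W` if vertices of degree at most one are removed as long as there are any. -/
structure IsTwoCore (G : SimpleGraph V) (W K : Finset V) : Prop where
  subset : K ⊆ W
  two_le_degIn : ∀ v ∈ K, 2 ≤ degIn G K v
  subset_of_two_le_degIn : ∀ S ⊆ W, (∀ v ∈ S, 2 ≤ degIn G S v) → S ⊆ K

namespace IsTwoCore

variable {W K : Finset V}

theorem isForestOn_sdiff (h : IsTwoCore G W K) : IsForestOn G (W \ K) := by
  intro S hS ⟨v, hv⟩
  by_contra! hdeg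
  have hvK := h.subset_of_two_le_degIn S (hS.trans sdiff_subset) hdeg hv
  exact (mem_sdiff.1 (hS hv)).2 hvK

omit [DecidableEq V] in
theorem isForestOn_iff_eq_empty (h : IsTwoCore G W K) : IsForestOn G W ↔ K = ∅ := by
  classical
  constructor
  · intro hW
    by_contra hne
    obtain ⟨v, hv, hdeg⟩ := hW K h.subset (nonempty_iff_ne_empty.2 hne)
    have := h.two_le_degIn v hv
    omega
  · rintro rfl
    exact sdiff_empty (s := W) ▸ h.isForestOn_sdiff

theorem exists_smaller_feedback (h : IsTwoCore G W K) {F T : Finset V} {k : ℕ} (hF : #F ≤ k)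
    (hforest : IsForestOn G (W \ F)) (hne : K.Nonempty)
    (hT : IsTopSelection (degIn G K) (3 * k) K T) :
    ∃ F' : Finset V, #F' < #F ∧ IsForestOn G ((W \ T) \ F') := by
  obtain ⟨f, hfF, -⟩ := hforest.exists_mem_of_two_le_degIn h.subset hne h.two_le_degIn
  have hFpos : 0 < #F := card_pos.2 ⟨f, hfF⟩
  rcases hT.eq_or_card_eq with rfl | hcard
  · exact ⟨∅, by rwa [card_empty], h.isForestOn_sdiff.mono sdiff_subset⟩
  have hTne : T.Nonempty := card_pos.1 (by omega)
  by_cases h3 : ∀ v ∈ T, 3 ≤ degIn G K v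
  · obtain ⟨x, hxF, hxT⟩ := not_disjoint_iff.1 <| not_disjoint_of_three_le_degIn h.two_le_degIn hF
      (hforest.mono (sdiff_subset_sdiff h.subset subset_rfl)) hT.subset hTne hcard
      hT.le_of_notMem h3
    refine ⟨F \ T, card_lt_card (sdiff_ssubset_of_mem hxF hxT), hforest.mono fun y hy => ?_⟩
    simp only [mem_sdiff] at hy ⊢
    tauto
  · push Not at h3
    obtain ⟨v, hv, hlt⟩ := h3
    have h2 : ∀ x ∈ K, x ∉ T → degIn G K x = 2 := fun x hx hxT => by
      have := hT.le_of_notMem x hx hxT v hv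
      have := h.two_le_degIn x hx
      omega
    obtain ⟨F', hF', hforest'⟩ := hforest.exists_ssubset_of_degIn_eq_two h.subset
      h.two_le_degIn h.subset_of_two_le_degIn hT.subset hv h2
    exact ⟨F', card_lt_card hF', hforest'⟩

end IsTwoCore

end Reduction

section Core

variable {V : Type*} (G : SimpleGraph V) (W : Finset V)

/-- In the graph induced by `W`, what hangs at `u`, as seen from its neighbour `v`, is a tree. -/
inductive Dangling : V → V → Prop
  | intro (v u : V) : (∀ w ∈ W, G.Adj u w → w ≠ v → Dangling u w) → Dangling v u

open Classical in
/-- The number of neighbours of `v` in `W` at which no tree is dangling. On the `2`-core this is the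
degree within the `2`-core, and unlike that degree it can be computed without storing the core. -/
noncomputable def coreDeg (v : V) : ℕ := #{u ∈ W | G.Adj v u ∧ ¬ Dangling G W v u}

open Classical in
/-- The `2`-core of the graph induced by `W`, characterised through trees that are not dangling. -/
noncomputable def core : Finset V := {v ∈ W | 2 ≤ coreDeg G W v}

variable {G W}

theorem mem_core {v : V} : v ∈ core G W ↔ v ∈ W ∧ 2 ≤ coreDeg G W v := by
  simp only [core, mem_filter]

theorem core_subset : core G W ⊆ W := fun _ hv => (mem_core.1 hv).1

theorem not_dangling_of_mem {S : Finset V} (hS : S ⊆ W) (hdeg : ∀ v ∈ S, 2 ≤ degIn G S v) {v u : V}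
    (hu : u ∈ S) : ¬ Dangling G W v u := by
  intro h
  induction h with
  | intro v u _ ih =>
    obtain ⟨w, hw, huw, hwv⟩ := exists_adj_ne_of_two_le_degIn (hdeg u hu) v
    exact ih w (hS hw) huw hwv hw

theorem subset_core {S : Finset V} (hS : S ⊆ W) (hdeg : ∀ v ∈ S, 2 ≤ degIn G S v) :
    S ⊆ core G W := by
  classical
  refine fun v hv => mem_core.2 ⟨hS hv, (hdeg v hv).trans (card_le_card fun u hu => ?_)⟩
  rw [mem_neighborsIn] at hu
  exact mem_filter.2 ⟨hS hu.1, hu.2, not_dangling_of_mem hS hdeg hu.1⟩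

theorem exists_not_dangling {v u : V} (h : ¬ Dangling G W v u) :
    ∃ w ∈ W, G.Adj u w ∧ w ≠ v ∧ ¬ Dangling G W u w := by
  by_contra! hdangling
  exact h (.intro v u hdangling)

theorem exists_not_dangling_of_mem_core {v : V} (hv : v ∈ core G W) (u : V) :
    ∃ w ∈ W, G.Adj v w ∧ w ≠ u ∧ ¬ Dangling G W v w := by
  classical
  obtain ⟨w, hw, hwu⟩ := exists_mem_ne (mem_core.1 hv).2 u
  obtain ⟨hwW, hvw, hdangling⟩ := mem_filter.1 hw
  exact ⟨w, hwW, hvw, hwu, hdangling⟩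

theorem not_dangling_of_mem_core {v u : V} (hu : u ∈ core G W) : ¬ Dangling G W v u := by
  rintro ⟨_, _, h⟩
  obtain ⟨w, hw, huw, hwv, hdangling⟩ := exists_not_dangling_of_mem_core hu v
  exact hdangling (h w hw huw hwv)

theorem mem_core_of_not_dangling {v u : V} (hv : v ∈ core G W) (hu : u ∈ W) (hvu : G.Adj v u)
    (h : ¬ Dangling G W v u) : u ∈ core G W := by
  classical
  obtain ⟨w, hw, huw, hwv, hdangling⟩ := exists_not_dangling h
  exact mem_core.2 ⟨hu, one_lt_card.2 ⟨w, mem_filter.2 ⟨hw, huw, hdangling⟩, v,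
    mem_filter.2 ⟨core_subset hv, hvu.symm, not_dangling_of_mem_core hv⟩, hwv⟩⟩

theorem coreDeg_eq_degIn_core {v : V} (hv : v ∈ core G W) :
    coreDeg G W v = degIn G (core G W) v := by
  classical
  refine congrArg card (ext fun u => ?_)
  rw [mem_neighborsIn, mem_filter]
  exact ⟨fun ⟨hu, hvu, h⟩ => ⟨mem_core_of_not_dangling hv hu hvu h, hvu⟩,
    fun ⟨hu, hvu⟩ => ⟨core_subset hu, hvu, not_dangling_of_mem_core hu⟩⟩

theorem isTwoCore_core : IsTwoCore G W (core G W) where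
  subset := core_subset
  two_le_degIn _ hv := coreDeg_eq_degIn_core hv ▸ (mem_core.1 hv).2
  subset_of_two_le_degIn _ := subset_core

end Core

section Reachability

variable {V : Type*} {G : SimpleGraph V} {W : Finset V}

/-- A step of a walk in the graph induced by `W` that does not enter `a`. -/
def StepAvoiding (G : SimpleGraph V) (W : Finset V) (a x y : V) : Prop :=
  G.Adj x y ∧ y ∈ W ∧ y ≠ a

theorem exists_step_avoiding_start {R : V → V → Prop} {u s : V} (h : ReflTransGen R u s)
    (hs : s ≠ u) : ∃ w, R u w ∧ ReflTransGen (fun x y => R x y ∧ y ≠ u) w s := by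
  induction h with
  | refl => exact absurd rfl hs
  | @tail b c hub hbc ih =>
    obtain rfl | hb := eq_or_ne b u
    · exact ⟨c, hbc, .refl⟩
    · obtain ⟨w, hw, hwb⟩ := ih hb
      exact ⟨w, hw, hwb.tail ⟨hbc, hs⟩⟩

theorem exists_stepAvoiding_of_ne {a b c : V} (h : ReflTransGen (StepAvoiding G W a) b c)
    (hne : c ≠ b) : ∃ d, StepAvoiding G W a b d ∧ ReflTransGen (StepAvoiding G W b) d c := by
  obtain ⟨d, hbd, hdc⟩ := exists_step_avoiding_start h hne
  exact ⟨d, hbd, ReflTransGen.mono (fun _ _ hxy => ⟨hxy.1.1, hxy.1.2.1, hxy.2⟩) _ _ hdc⟩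

theorem reflTransGen_stepAvoiding_symm {a x y : V} (hx : x ∈ W) (hxa : x ≠ a)
    (h : ReflTransGen (StepAvoiding G W a) x y) : ReflTransGen (StepAvoiding G W a) y x := by
  induction h with
  | refl => exact .refl
  | @tail b c hxb hbc ih =>
    have hb : b ∈ W ∧ b ≠ a := by
      rcases hxb.cases_tail with rfl | ⟨_, _, hstep⟩
      · exact ⟨hx, hxa⟩
      · exact hstep.2
    exact .head ⟨hbc.1.symm, hb⟩ ih

theorem Dangling.eq_of_reach {a b : V} (h : Dangling G W a b) :
    ∀ {c : V}, G.Adj a b → a ∈ W → b ∈ W → ReflTransGen (StepAvoiding G W a) b c →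
      G.Adj c a → c = b := by
  induction h with
  | intro a b _ ih =>
    intro c hab ha hb hbc hca
    by_contra hne
    obtain ⟨d, ⟨hbd, hd, hda⟩, hdc⟩ := exists_stepAvoiding_of_ne hbc hne
    exact hda (ih d hd hbd hda hbd hb hd (hdc.tail ⟨hca, ha, hab.ne⟩) hab).symm

theorem Dangling.exists_of_reach {v u : V} (h : Dangling G W v u) :
    ∀ {y : V}, ReflTransGen (StepAvoiding G W v) u y →
      ∃ p, ∀ w ∈ W, G.Adj y w → w ≠ p → Dangling G W y w := by
  induction h with
  | intro v u hvu ih =>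
    intro y huy
    obtain rfl | hyu := eq_or_ne y u
    · exact ⟨v, hvu⟩
    · obtain ⟨d, ⟨hud, hd, hdv⟩, hdy⟩ := exists_stepAvoiding_of_ne huy hyu
      exact ih d hd hud hdv hdy

end Reachability

section Rotation

variable {V : Type*} {G : SimpleGraph V}

/-- A cyclic order of the neighbours of each vertex: `rot x z` follows `z` around `x`. -/
structure IsRotation (G : SimpleGraph V) (rot : V → V → V) : Prop where
  adj : ∀ {x z}, G.Adj x z → G.Adj x (rot x z)
  inj : ∀ {x z z'}, G.Adj x z → G.Adj x z' → rot x z = rot x z' → z = z'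
  trans : ∀ {x z z'}, G.Adj x z → G.Adj x z' → ∃ i, (rot x)^[i] z = z'

theorem IsRotation.exists_iterate_eq {rot : V → V → V} (hrot : IsRotation G rot) {u v w : V}
    (huv : G.Adj u v) (huw : G.Adj u w) :
    ∃ m, (rot u)^[m] (rot u v) = w ∧ ∀ i < m, (rot u)^[i] (rot u v) ≠ v := by
  classical
  have hex := hrot.trans (hrot.adj huv) huw
  refine ⟨Nat.find hex, Nat.find_spec hex, fun i hi hv => ?_⟩
  refine Nat.find_min hex (m := Nat.find hex - (i + 1)) (by omega) ?_
  calc (rot u)^[Nat.find hex - (i + 1)] (rot u v)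
      = (rot u)^[Nat.find hex - (i + 1)] ((rot u)^[i + 1] (rot u v)) := by
        rw [Function.iterate_succ_apply' (rot u) i, hv]
    _ = w := by
        rw [← Function.iterate_add_apply, Nat.sub_add_cancel hi]
        exact Nat.find_spec hex

end Rotation

section Contour

variable {V : Type*} [DecidableEq V] {G : SimpleGraph V} {W : Finset V} {rot : V → V → V}
  {d : V × V}

/-- The next dart of a contour walk in the graph induced by `W`. A dart to a vertex outside of `W`
is passed over. -/
def dartNext (W : Finset V) (rot : V → V → V) (d : V × V) : V × V :=
  if d.2 ∈ W then (d.2, rot d.2 d.1) else (d.1, rot d.1 d.2)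

/-- The contour walk that starts with the dart `d`. -/
def contour (W : Finset V) (rot : V → V → V) (d : V × V) (t : ℕ) : V × V :=
  (dartNext W rot)^[t] d

theorem contour_succ (t : ℕ) :
    contour W rot d (t + 1) = dartNext W rot (contour W rot d t) :=
  Function.iterate_succ_apply' _ _ _

theorem contour_succ_of_mem {t : ℕ} (h : (contour W rot d t).2 ∈ W) :
    contour W rot d (t + 1) =
      ((contour W rot d t).2, rot (contour W rot d t).2 (contour W rot d t).1) := by
  rw [contour_succ, dartNext, if_pos h]

theorem contour_succ_of_notMem {t : ℕ} (h : (contour W rot d t).2 ∉ W) :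
    contour W rot d (t + 1) =
      ((contour W rot d t).1, rot (contour W rot d t).1 (contour W rot d t).2) := by
  rw [contour_succ, dartNext, if_neg h]

theorem IsRotation.adj_dartNext (hrot : IsRotation G rot) (h : G.Adj d.1 d.2) (hW : d.1 ∈ W) :
    G.Adj (dartNext W rot d).1 (dartNext W rot d).2 ∧ (dartNext W rot d).1 ∈ W := by
  rw [dartNext]
  split_ifs with hmem
  · exact ⟨hrot.adj h.symm, hmem⟩
  · exact ⟨hrot.adj h, hW⟩

theorem contour_adj (hrot : IsRotation G rot) (hd : G.Adj d.1 d.2) (hW : d.1 ∈ W) (t : ℕ) :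
    G.Adj (contour W rot d t).1 (contour W rot d t).2 ∧ (contour W rot d t).1 ∈ W := by
  induction t with
  | zero => exact ⟨hd, hW⟩
  | succ t ih =>
    rw [contour_succ]
    exact hrot.adj_dartNext ih.1 ih.2

/-- Between the times `s` and `l`, the contour walk leaves a vertex and returns to it for the first
time: its dart at time `s` leaves the vertex, its dart at time `l` enters it. -/
structure IsExcursion (W : Finset V) (rot : V → V → V) (d : V × V) (s l : ℕ) : Prop where
  lt : s < l
  exit_mem : (contour W rot d s).2 ∈ W
  return_eq : (contour W rot d l).2 = (contour W rot d s).1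
  ne_of_mem : ∀ t ∈ Set.Ioc s l, (contour W rot d t).1 ≠ (contour W rot d s).1

theorem reflTransGen_contour (hrot : IsRotation G rot) (hd : G.Adj d.1 d.2) (hW : d.1 ∈ W) {i j : ℕ}
    (hij : i < j) (hi : (contour W rot d i).2 ∈ W)
    (hne : ∀ t ∈ Set.Ioc i j, (contour W rot d t).1 ≠ (contour W rot d i).1) :
    ReflTransGen (StepAvoiding G W (contour W rot d i).1) (contour W rot d i).2
      (contour W rot d j).1 := by
  induction j, hij using Nat.le_induction with
  | base => rw [contour_succ_of_mem hi]
  | succ j hj ih =>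
    have hreach := ih fun t ht => hne t ⟨ht.1, ht.2.trans j.le_succ⟩
    have hne' := hne (j + 1) ⟨by omega, le_rfl⟩
    by_cases hmem : (contour W rot d j).2 ∈ W
    · rw [contour_succ_of_mem hmem] at hne' ⊢
      exact hreach.tail ⟨(contour_adj hrot hd hW j).1, hmem, hne'⟩
    · rwa [contour_succ_of_notMem hmem]

theorem Dangling.fst_eq_snd_of_isExcursion (hrot : IsRotation G rot) {v u : V} (hvu : G.Adj v u)
    (hv : v ∈ W) (hu : u ∈ W) (h : Dangling G W v u) {T : ℕ}
    (hT : ∀ t ∈ Set.Ioc 0 T, (contour W rot (v, u) t).1 ≠ v) {i j : ℕ}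
    (hij : IsExcursion W rot (v, u) i j) (hjT : j ≤ T) :
    (contour W rot (v, u) j).1 = (contour W rot (v, u) i).2 := by
  have hadj := contour_adj (d := (v, u)) hrot hvu hv
  have hreach := reflTransGen_contour (d := (v, u)) hrot hvu hv hij.lt hij.exit_mem hij.ne_of_mem
  obtain ⟨hyz, hy⟩ := hadj i
  obtain ⟨hxy, hx⟩ := hadj j
  have hz := hij.exit_mem
  rw [hij.return_eq] at hxy
  generalize contour W rot (v, u) j = dj at *
  have hdangling : Dangling G W (contour W rot (v, u) i).1 (contour W rot (v, u) i).2 ∨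
      dj.1 = (contour W rot (v, u) i).2 ∨ Dangling G W (contour W rot (v, u) i).1 dj.1 := by
    obtain rfl | hi := i.eq_zero_or_pos
    · exact .inl h
    obtain ⟨p, hp⟩ := h.exists_of_reach (reflTransGen_contour (d := (v, u)) hrot hvu hv hi hu
      fun t ht => hT t ⟨ht.1, by have := ht.2; have := hij.lt; omega⟩)
    by_cases hzp : (contour W rot (v, u) i).2 = p
    · exact .inr (or_iff_not_imp_left.2 fun hne => hp _ hx hxy.symm (hzp ▸ hne))
    · exact .inl (hp _ hz hyz hzp)
  rcases hdangling with hd | heq | hd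
  · exact hd.eq_of_reach hyz hy hz hreach hxy
  · exact heq
  · exact (hd.eq_of_reach hxy.symm hy hx
      (reflTransGen_stepAvoiding_symm hz hyz.ne' hreach) hyz.symm).symm

theorem exists_isExcursion (hrot : IsRotation G rot) (hd : G.Adj d.1 d.2) (hW : d.1 ∈ W) {s l : ℕ}
    (hsl : s < l) (hs : (contour W rot d s).2 ∈ W)
    (hl : (contour W rot d l).1 = (contour W rot d s).1) : ∃ j < l, IsExcursion W rot d s j := by
  classical
  have hex : ∃ t, s < t ∧ (contour W rot d t).1 = (contour W rot d s).1 := ⟨l, hsl, hl⟩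
  obtain ⟨hlt, hfirst⟩ := Nat.find_spec hex
  have hmin : ∀ t, s < t → t < Nat.find hex → (contour W rot d t).1 ≠ (contour W rot d s).1 :=
    fun t hst ht heq => Nat.find_min hex ht ⟨hst, heq⟩
  have hle : Nat.find hex ≤ l := Nat.find_min' hex ⟨hsl, hl⟩
  generalize Nat.find hex = r at *
  obtain ⟨j, rfl⟩ : ∃ j, r = j + 1 := ⟨r - 1, by omega⟩
  have hsj : s ≠ j := by
    rintro rfl
    rw [contour_succ_of_mem hs] at hfirst
    exact (contour_adj hrot hd hW s).1.ne' hfirst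
  refine ⟨j, by omega, by omega, hs, ?_, fun t ht => hmin t ht.1 (Nat.lt_succ_of_le ht.2)⟩
  by_cases hmem : (contour W rot d j).2 ∈ W
  · rwa [contour_succ_of_mem hmem] at hfirst
  · rw [contour_succ_of_notMem hmem] at hfirst
    exact absurd hfirst (hmin j (by omega) j.lt_succ_self)

theorem IsExcursion.contour_succ_of_fst_eq {s l : ℕ} (h : IsExcursion W rot d s l)
    (hW : (contour W rot d s).1 ∈ W) (heq : (contour W rot d l).1 = (contour W rot d s).2) :
    contour W rot d (l + 1) =
      ((contour W rot d s).1, rot (contour W rot d s).1 (contour W rot d s).2) := by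
  rw [contour_succ_of_mem (h.return_eq ▸ hW), h.return_eq, heq]

theorem IsExcursion.exists_contour_eq (hrot : IsRotation G rot) (hd : G.Adj d.1 d.2) (hW : d.1 ∈ W)
    {s l : ℕ} (hsl : IsExcursion W rot d s l)
    (hmatched : ∀ i j, IsExcursion W rot d i j → j ≤ l →
      (contour W rot d j).1 = (contour W rot d i).2)
    {u v : V} (hs : contour W rot d s = (v, u)) {i : ℕ}
    (hi : ∀ i' < i, (rot u)^[i'] (rot u v) ≠ v) :
    ∃ t ∈ Set.Ioc s l, contour W rot d t = (u, (rot u)^[i] (rot u v)) := by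
  have hx := hmatched s l hsl le_rfl
  obtain ⟨hlt, hmem, hret, -⟩ := hsl
  simp only [hs] at hx hmem hret
  induction i with
  | zero =>
    refine ⟨s + 1, ⟨s.lt_succ_self, hlt⟩, ?_⟩
    rw [contour_succ_of_mem (by rwa [hs]), hs]
    rfl
  | succ i ih =>
    obtain ⟨t, ⟨hst, htl⟩, ht⟩ := ih fun i' hi' => hi i' (by omega)
    have htl : t < l := htl.lt_of_ne fun h =>
      hi i i.lt_succ_self (by simpa only [← h, ht] using hret)
    rw [Function.iterate_succ_apply']
    by_cases hwW : (rot u)^[i] (rot u v) ∈ W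
    -- The excursion to this neighbour returns from it, so the next dart at `u` is its successor.
    · obtain ⟨j, hjl, hj⟩ :=
        exists_isExcursion (s := t) hrot hd hW htl (by rwa [ht]) (by rw [hx, ht])
      have hnext := hj.contour_succ_of_fst_eq (by rwa [ht]) (hmatched t j hj hjl.le)
      rw [ht] at hnext
      exact ⟨j + 1, ⟨by have := hj.lt; omega, hjl⟩, hnext⟩
    · refine ⟨t + 1, ⟨by omega, htl⟩, ?_⟩
      rw [contour_succ_of_notMem (by rwa [ht]), ht]

theorem IsExcursion.exists_subexcursion (hrot : IsRotation G rot) (hd : G.Adj d.1 d.2)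
    (hW : d.1 ∈ W) {s l : ℕ} (hsl : IsExcursion W rot d s l)
    (hmatched : ∀ i j, IsExcursion W rot d i j → j ≤ l →
      (contour W rot d j).1 = (contour W rot d i).2)
    {u v w : V} (hs : contour W rot d s = (v, u)) (hw : w ∈ W) (huw : G.Adj u w) (hwv : w ≠ v) :
    ∃ s' l', s < s' ∧ l' < l ∧ IsExcursion W rot d s' l' ∧ contour W rot d s' = (u, w) := by
  have hvu := (contour_adj hrot hd hW s).1
  rw [hs] at hvu
  obtain ⟨m, rfl, hm⟩ := hrot.exists_iterate_eq hvu.symm huw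
  obtain ⟨t, ⟨hst, htl⟩, ht⟩ := hsl.exists_contour_eq hrot hd hW hmatched hs hm
  have htl : t < l := htl.lt_of_ne fun h =>
    hwv (by simpa only [← h, ht, hs] using hsl.return_eq)
  obtain ⟨j, hjl, hj⟩ := exists_isExcursion (s := t) hrot hd hW htl (by rwa [ht])
    (by rw [hmatched s l hsl le_rfl, hs, ht])
  exact ⟨t, j, hst, hjl, hj, ht⟩

theorem IsExcursion.dangling (hrot : IsRotation G rot) (hd : G.Adj d.1 d.2) (hW : d.1 ∈ W)
    {s l : ℕ} (hsl : IsExcursion W rot d s l)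
    (hmatched : ∀ i j, IsExcursion W rot d i j → j ≤ l →
      (contour W rot d j).1 = (contour W rot d i).2) :
    Dangling G W (contour W rot d s).1 (contour W rot d s).2 := by
  induction hN : l - s using Nat.strong_induction_on generalizing s l with
  | _ N ih =>
    refine .intro _ _ fun w hw huw hwv => ?_
    obtain ⟨s', l', hs', hl', hsl', heq⟩ :=
      hsl.exists_subexcursion hrot hd hW hmatched rfl hw huw hwv
    have := ih (l' - s') (by have := hsl'.lt; omega) hsl'
      (fun i j hij hj => hmatched i j hij (by omega)) rfl
    rwa [heq] at this

/-- The vertex to which the contour walk has left `y` for the last time before time `t`. -/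
def lastExit (W : Finset V) (rot : V → V → V) (d : V × V) (y : V) : ℕ → Option V
  | 0 => none
  | t + 1 =>
    if (contour W rot d t).2 ∈ W ∧ (contour W rot d t).1 = y then some (contour W rot d t).2
    else lastExit W rot d y t

/-- At time `t`, the contour walk returns to `y`, but not from the vertex to which it has left. Only
a single vertex has to be remembered to detect this, which makes the algorithm space-efficient. -/
def Mismatch (W : Finset V) (rot : V → V → V) (d : V × V) (y : V) (t : ℕ) : Prop :=
  (contour W rot d t).2 ∈ W ∧ (contour W rot d t).2 = y ∧
    ∃ z, lastExit W rot d y t = some z ∧ z ≠ (contour W rot d t).1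

theorem lastExit_eq_some_iff {y z : V} {t : ℕ} :
    lastExit W rot d y t = some z ↔ ∃ i < t, contour W rot d i = (y, z) ∧ z ∈ W ∧
      ∀ j, i < j → j < t → ¬ ((contour W rot d j).2 ∈ W ∧ (contour W rot d j).1 = y) := by
  induction t with
  | zero => simp only [lastExit, reduceCtorEq, Nat.not_lt_zero, false_and, exists_false]
  | succ t ih =>
    rw [lastExit]
    split_ifs with hexit
    · constructor
      · intro hz
        have hz := Option.some.inj hz
        exact ⟨t, t.lt_succ_self, Prod.ext hexit.2 hz, hz ▸ hexit.1, fun j _ _ => by omega⟩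
      · rintro ⟨i, hi, heq, -, hlast⟩
        obtain rfl | hit := Nat.lt_succ_iff_lt_or_eq.1 hi |>.symm
        · rw [heq]
        · exact absurd hexit (hlast t hit t.lt_succ_self)
    · rw [ih]
      constructor
      · rintro ⟨i, hi, heq, hz, hlast⟩
        refine ⟨i, by omega, heq, hz, fun j hij hj => ?_⟩
        obtain hjt | rfl := Nat.lt_succ_iff_lt_or_eq.1 hj
        · exact hlast j hij hjt
        · exact hexit
      · rintro ⟨i, hi, heq, hz, hlast⟩
        obtain hit | rfl := Nat.lt_succ_iff_lt_or_eq.1 hi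
        · exact ⟨i, hit, heq, hz, fun j hij hj => hlast j hij (by omega)⟩
        · exact absurd ⟨by rwa [heq], by rw [heq]⟩ hexit

theorem fst_contour_eq_of_forall_not_exit {y : V} {s l : ℕ} (hsl : s ≤ l)
    (hs : (contour W rot d s).1 = y)
    (hexit : ∀ j, s ≤ j → j < l → ¬ ((contour W rot d j).2 ∈ W ∧ (contour W rot d j).1 = y)) :
    (contour W rot d l).1 = y := by
  induction l, hsl using Nat.le_induction with
  | base => exact hs
  | succ l hl ih =>
    have hy := ih fun j hsj hj => hexit j hsj (by omega)
    rw [contour_succ_of_notMem fun hmem => hexit l hl l.lt_succ_self ⟨hmem, hy⟩]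
    exact hy

theorem mismatch_iff (hrot : IsRotation G rot) (hd : G.Adj d.1 d.2) (hW : d.1 ∈ W) {y : V} {t : ℕ} :
    Mismatch W rot d y t ↔ ∃ s, IsExcursion W rot d s t ∧ (contour W rot d s).1 = y ∧
      (contour W rot d t).1 ≠ (contour W rot d s).2 := by
  constructor
  · rintro ⟨-, rfl, z, hz, hne⟩
    obtain ⟨s, hst, hs, hzW, hlast⟩ := lastExit_eq_some_iff.1 hz
    refine ⟨s, ⟨hst, by rwa [hs], by rw [hs], fun i hi heq => ?_⟩, by rw [hs],
      by rw [hs]; exact hne.symm⟩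
    rw [hs] at heq
    exact (contour_adj hrot hd hW t).1.ne (fst_contour_eq_of_forall_not_exit hi.2 heq
      fun j hij hj => hlast j (hi.1.trans_le hij) hj)
  · rintro ⟨s, hexc, rfl, hne⟩
    refine ⟨hexc.return_eq ▸ (contour_adj hrot hd hW s).2, hexc.return_eq, _,
      lastExit_eq_some_iff.2 ⟨s, hexc.lt, rfl, hexc.exit_mem, fun j hsj hjt hj => ?_⟩, hne.symm⟩
    exact hexc.ne_of_mem j ⟨hsj, hjt.le⟩ hj.2

/-- Dart `T` is the first dart of the contour walk around `d` that ends in the vertex `d.1`. -/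
structure IsFirstArrival (W : Finset V) (rot : V → V → V) (d : V × V) (T : ℕ) : Prop where
  ne : ∀ t < T, (contour W rot d t).2 ≠ d.1
  eq : (contour W rot d T).2 = d.1

theorem fst_contour_ne (hvu : G.Adj d.1 d.2) (hu : d.2 ∈ W) {T : ℕ}
    (hT : ∀ t < T, (contour W rot d t).2 ≠ d.1) :
    ∀ t ∈ Set.Ioc 0 T, (contour W rot d t).1 ≠ d.1 := by
  rintro t ⟨ht0, htT⟩
  induction t, ht0 using Nat.le_induction with
  | base =>
    rw [contour_succ_of_mem (by exact hu)]
    exact hvu.ne'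
  | succ t _ ih =>
    by_cases hmem : (contour W rot d t).2 ∈ W
    · rw [contour_succ_of_mem hmem]
      exact hT t (by omega)
    · rw [contour_succ_of_notMem hmem]
      exact ih (by omega)

theorem dangling_iff_forall_not_mismatch (hrot : IsRotation G rot) {v u : V} (hvu : G.Adj v u)
    (hv : v ∈ W) (hu : u ∈ W) {T : ℕ} (hT : IsFirstArrival W rot (v, u) T) :
    Dangling G W v u ↔ ∀ y, ∀ t ≤ T, ¬ Mismatch W rot (v, u) y t := by
  have hne := fst_contour_ne (d := (v, u)) hvu hu hT.ne
  simp only [mismatch_iff (d := (v, u)) hrot hvu hv]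
  constructor
  · rintro h y t ht ⟨s, hexc, -, hmismatch⟩
    exact hmismatch (h.fst_eq_snd_of_isExcursion hrot hvu hv hu hne hexc ht)
  · intro h
    have hT0 : 0 < T := Nat.pos_of_ne_zero <| by
      rintro rfl
      exact hvu.ne' hT.eq
    exact IsExcursion.dangling (d := (v, u)) (s := 0) hrot hvu hv ⟨hT0, hu, hT.eq, hne⟩
      fun i j hij hj => not_not.1 fun hmismatch => h _ j hj ⟨i, hij, rfl, hmismatch⟩

theorem IsRotation.injOn_dartNext (hrot : IsRotation G rot) :
    Set.InjOn (dartNext W rot) {d | G.Adj d.1 d.2 ∧ d.1 ∈ W} := by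
  rintro ⟨x, z⟩ ⟨hd : G.Adj x z, hW : x ∈ W⟩ ⟨x', z'⟩ ⟨hd' : G.Adj x' z', hW' : x' ∈ W⟩ h
  simp only [dartNext] at h
  split_ifs at h with hz hz' hz' <;> obtain ⟨rfl, hrot_eq⟩ := Prod.mk.inj h
  · rw [hrot.inj hd.symm hd'.symm hrot_eq]
  · exact absurd (hrot.inj hd.symm hd' hrot_eq ▸ hW) hz'
  · exact absurd (hrot.inj hd hd'.symm hrot_eq ▸ hW') hz
  · rw [hrot.inj hd hd' hrot_eq]

theorem exists_iterate_eq_self {α : Type*} {f : α → α} {D : Finset α}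
    (hmaps : Set.MapsTo f D D) (hinj : Set.InjOn f D) {x : α} (hx : x ∈ D) :
    ∃ r, 0 < r ∧ r ≤ #D ∧ f^[r] x = x := by
  have hg : Function.Injective hmaps.restrict := hmaps.restrict_inj.2 hinj
  refine ⟨Function.minimalPeriod hmaps.restrict ⟨x, hx⟩,
    Function.minimalPeriod_pos_of_mem_periodicPts (hg.mem_periodicPts _), ?_, ?_⟩
  · exact (Function.minimalPeriod_le_card (f := hmaps.restrict) (x := ⟨x, hx⟩)).trans_eq
      (Fintype.card_coe D)
  · have := congrArg Subtype.val
      (Function.iterate_minimalPeriod (f := hmaps.restrict) (x := ⟨x, hx⟩))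
    rwa [hmaps.iterate_restrict] at this

theorem exists_isFirstArrival (hrot : IsRotation G rot) {v u : V} (hvu : G.Adj v u) (hv : v ∈ W)
    (hu : u ∈ W) (D : Finset (V × V)) (hD : ∀ x z, x ∈ W → G.Adj x z → (x, z) ∈ D) :
    ∃ T < #D, IsFirstArrival W rot (v, u) T := by
  classical
  let E : Finset (V × V) := {d ∈ D | G.Adj d.1 d.2 ∧ d.1 ∈ W}
  have hmemE : ∀ d, d ∈ E ↔ G.Adj d.1 d.2 ∧ d.1 ∈ W := fun d =>
    mem_filter.trans ⟨And.right, fun h => ⟨hD _ _ h.2 h.1, h⟩⟩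
  obtain ⟨r, hr0, hrE, hr⟩ := exists_iterate_eq_self (D := E) (f := dartNext W rot)
    (fun d hd => by
      rw [mem_coe, hmemE] at *
      exact hrot.adj_dartNext hd.1 hd.2)
    (hrot.injOn_dartNext.mono fun d hd => (hmemE d).1 hd) ((hmemE (v, u)).2 ⟨hvu, hv⟩)
  obtain ⟨j, hjr, hj⟩ := exists_isExcursion (d := (v, u)) (s := 0) hrot hvu hv hr0 hu
    (congrArg Prod.fst hr)
  have hex : ∃ t, (contour W rot (v, u) t).2 = v := ⟨j, hj.return_eq⟩
  refine ⟨Nat.find hex, ?_, fun _ ht => Nat.find_min hex ht, Nat.find_spec hex⟩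
  calc Nat.find hex ≤ j := Nat.find_min' hex hj.return_eq
    _ < r := hjr
    _ ≤ #E := hrE
    _ ≤ #D := card_le_card (filter_subset _ _)

end Contour

section Run

infixr:65 " ⨟ " => Prog.seq

/-- Started in `s`, the program `p` halts within `b` steps in a state that satisfies `Q`. -/
def Run (w : ℕ) (inp : List ℕ) (p : Prog) (s : State) (b : ℕ) (Q : State → Prop) : Prop :=
  ∃ s' t, Exec w inp p s s' t ∧ t ≤ b ∧ Q s'

variable {w : ℕ} {inp : List ℕ} {p q : Prog} {s : State} {b b₁ b₂ : ℕ} {Q Q' : State → Prop}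

@[simp] theorem State.reg_setReg (s : State) (r v x : ℕ) :
    (s.setReg r v).reg x = if x = r then v else s.reg x := by
  simp only [State.setReg, Function.update_apply]

@[simp] theorem State.mem_setReg (s : State) (r v : ℕ) : (s.setReg r v).mem = s.mem := rfl

@[simp] theorem State.top_setReg (s : State) (r v : ℕ) : (s.setReg r v).top = s.top := rfl

@[simp] theorem State.reg_setMem (s : State) (a v : ℕ) : (s.setMem a v).reg = s.reg := rfl

@[simp] theorem State.top_setMem (s : State) (a v : ℕ) : (s.setMem a v).top = s.top := rfl

@[simp] theorem State.mem_setMem (s : State) (a v : ℕ) :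
    (s.setMem a v).mem = Function.update s.mem a v := rfl

theorem State.touch_of_lt {s : State} {a : ℕ} (h : a < s.top) : s.touch a = s := by
  simp only [State.touch, Nat.max_eq_left (Nat.succ_le_of_lt h)]

theorem Run.mono (h : Run w inp p s b Q) (hb : b ≤ b₁) (hQ : ∀ s', Q s' → Q' s') :
    Run w inp p s b₁ Q' := by
  obtain ⟨s', t, hexec, ht, hs'⟩ := h
  exact ⟨s', t, hexec, ht.trans hb, hQ s' hs'⟩

theorem Run.of_le (h : Run w inp p s b Q) (hb : b ≤ b₁) : Run w inp p s b₁ Q :=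
  h.mono hb fun _ => id

theorem Run.imp (h : Run w inp p s b Q) (hQ : ∀ s', Q s' → Q' s') : Run w inp p s b Q' :=
  h.mono le_rfl hQ

theorem Run.seq (h : Run w inp p s b₁ fun s₁ => Run w inp q s₁ b₂ Q) :
    Run w inp (p ⨟ q) s (b₁ + b₂) Q := by
  obtain ⟨s₁, t₁, hp, ht₁, s₂, t₂, hq, ht₂, hs₂⟩ := h
  exact ⟨s₂, t₁ + t₂, .seq hp hq, Nat.add_le_add ht₁ ht₂, hs₂⟩

theorem Run.bind (h : Run w inp p s b₁ Q') (h' : ∀ s₁, Q' s₁ → Run w inp q s₁ b₂ Q) :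
    Run w inp (p ⨟ q) s (b₁ + b₂) Q :=
  .seq (h.imp h')

theorem Run.skip (h : Q s) : Run w inp .skip s 1 Q := ⟨s, 1, .skip s, le_rfl, h⟩

theorem Run.const {r c : ℕ} (hc : c < 2 ^ w) (h : Q (s.setReg r c)) :
    Run w inp (.const r c) s 1 Q :=
  ⟨_, 1, .const s r c, le_rfl, by rwa [Nat.mod_eq_of_lt hc]⟩

theorem Run.op {o : Op} {r x y v : ℕ} (hv : o.eval w (s.reg x) (s.reg y) = v)
    (h : Q (s.setReg r v)) : Run w inp (.op o r x y) s 1 Q :=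
  ⟨_, 1, .op s o r x y, le_rfl, by rwa [hv]⟩

theorem Run.add {r x y a c : ℕ} (hx : s.reg x = a) (hy : s.reg y = c) (hw : a + c < 2 ^ w)
    (h : Q (s.setReg r (a + c))) : Run w inp (.op .add r x y) s 1 Q :=
  .op (by rw [hx, hy]; exact Nat.mod_eq_of_lt hw) h

theorem Run.mul {r x y a c : ℕ} (hx : s.reg x = a) (hy : s.reg y = c) (hw : a * c < 2 ^ w)
    (h : Q (s.setReg r (a * c))) : Run w inp (.op .mul r x y) s 1 Q :=
  .op (by rw [hx, hy]; exact Nat.mod_eq_of_lt hw) h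

theorem Run.sub {r x y a c : ℕ} (hx : s.reg x = a) (hy : s.reg y = c) (hca : c ≤ a)
    (hw : a < 2 ^ w) (h : Q (s.setReg r (a - c))) : Run w inp (.op .sub r x y) s 1 Q := by
  refine .op ?_ h
  calc Op.sub.eval w (s.reg x) (s.reg y) = (a + (2 ^ w - c)) % 2 ^ w := by rw [hx, hy]; rfl
    _ = (a - c + 2 ^ w) % 2 ^ w := congrArg (· % 2 ^ w) (by omega)
    _ = a - c := by rw [Nat.add_mod_right, Nat.mod_eq_of_lt (by omega)]

theorem Run.mod {r x y a c : ℕ} (hx : s.reg x = a) (hy : s.reg y = c)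
    (h : Q (s.setReg r (a % c))) : Run w inp (.op .mod r x y) s 1 Q :=
  .op (by rw [hx, hy]; rfl) h

theorem Run.shr {r x y a c : ℕ} (hx : s.reg x = a) (hy : s.reg y = c)
    (h : Q (s.setReg r (a / 2 ^ c))) : Run w inp (.op .shr r x y) s 1 Q :=
  .op (by rw [hx, hy]; rfl) h

theorem Run.read {r x a v : ℕ} (hx : s.reg x = a) (hv : inp.getD a 0 = v) (hw : v < 2 ^ w)
    (h : Q (s.setReg r v)) : Run w inp (.read r x) s 1 Q :=
  ⟨_, 1, .read s r x, le_rfl, by rwa [hx, hv, Nat.mod_eq_of_lt hw]⟩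

theorem Run.load {r x a v : ℕ} (hx : s.reg x = a) (hv : s.mem a = v) (ha : a < s.top)
    (h : Q (s.setReg r v)) : Run w inp (.load r x) s 1 Q :=
  ⟨_, 1, .load s r x, le_rfl, by rwa [hx, hv, State.touch_of_lt ha]⟩

theorem Run.store {x y a v : ℕ} (hx : s.reg x = a) (hy : s.reg y = v) (ha : a < s.top)
    (h : Q (s.setMem a v)) : Run w inp (.store x y) s 1 Q :=
  ⟨_, 1, .store s x y, le_rfl, by rwa [hx, hy, State.touch_of_lt ha]⟩

theorem Run.ite {c : Cmp} {x y : ℕ} (htrue : c.holds (s.reg x) (s.reg y) → Run w inp p s b Q)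
    (hfalse : ¬ c.holds (s.reg x) (s.reg y) → Run w inp q s b Q) :
    Run w inp (.ite c x y p q) s (b + 1) Q := by
  by_cases hc : c.holds (s.reg x) (s.reg y)
  · obtain ⟨s', t, hexec, ht, hs'⟩ := htrue hc
    exact ⟨s', t + 1, .iteTrue hc hexec, by omega, hs'⟩
  · obtain ⟨s', t, hexec, ht, hs'⟩ := hfalse hc
    exact ⟨s', t + 1, .iteFalse hc hexec, by omega, hs'⟩

theorem Run.loop {c : Cmp} {x y : ℕ} {I : ℕ → State → Prop} (b : ℕ)
    (hstep : ∀ fuel s, I fuel s → c.holds (s.reg x) (s.reg y) →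
      ∃ fuel', fuel = fuel' + 1 ∧ Run w inp p s b (I fuel'))
    (hend : ∀ fuel s, I fuel s → ¬ c.holds (s.reg x) (s.reg y) → Q s) {fuel : ℕ}
    (hI : I fuel s) : Run w inp (.loop c x y p) s (fuel * (b + 1) + 1) Q := by
  induction fuel generalizing s with
  | zero =>
    refine ⟨s, 1, .loopFalse fun hc => ?_, by omega, hend 0 s hI fun hc => ?_⟩ <;>
    · obtain ⟨_, hfuel, -⟩ := hstep 0 s hI hc
      omega
  | succ fuel ih =>
    by_cases hc : c.holds (s.reg x) (s.reg y)
    · obtain ⟨fuel', hfuel, s₁, t₁, hp, ht₁, hs₁⟩ := hstep _ s hI hc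
      obtain rfl : fuel = fuel' := by omega
      obtain ⟨s₂, t₂, hloop, ht₂, hs₂⟩ := ih hs₁
      exact ⟨s₂, t₁ + t₂ + 1, .loopTrue hc hp hloop, by rw [Nat.add_mul]; omega, hs₂⟩
    · exact ⟨s, 1, .loopFalse hc, by omega, hend _ s hI hc⟩

theorem Run.loop_range {c : Cmp} {x y : ℕ} {I : ℕ → State → Prop} (b : ℕ → ℕ) (N : ℕ)
    (hstep : ∀ i s, i < N → I i s → c.holds (s.reg x) (s.reg y) ∧ Run w inp p s (b i) (I (i + 1)))
    (hend : ∀ s, I N s → ¬ c.holds (s.reg x) (s.reg y) ∧ Q s) {i : ℕ} (hi : i ≤ N) (hI : I i s) :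
    Run w inp (.loop c x y p) s (∑ j ∈ Ico i N, (b j + 1) + 1) Q := by
  induction hi using Nat.decreasingInduction generalizing s with
  | self => exact ⟨s, 1, .loopFalse (hend s hI).1, Nat.le_add_left _ _, (hend s hI).2⟩
  | of_succ i hi ih =>
    obtain ⟨hc, s₁, t₁, hp, ht₁, hs₁⟩ := hstep i s hi hI
    obtain ⟨s₂, t₂, hloop, ht₂, hs₂⟩ := ih hs₁
    refine ⟨s₂, t₁ + t₂ + 1, .loopTrue hc hp hloop, ?_, hs₂⟩
    rw [sum_eq_sum_Ico_succ_bot hi]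
    omega

theorem Run.loop_range_const {c : Cmp} {x y : ℕ} {I : ℕ → State → Prop} (b N : ℕ)
    (hstep : ∀ i s, i < N → I i s → c.holds (s.reg x) (s.reg y) ∧ Run w inp p s b (I (i + 1)))
    (hend : ∀ s, I N s → ¬ c.holds (s.reg x) (s.reg y) ∧ Q s) (hI : I 0 s) :
    Run w inp (.loop c x y p) s (N * (b + 1) + 1) Q :=
  (Run.loop_range (fun _ => b) N hstep hend N.zero_le hI).of_le
    (by rw [sum_const, Nat.card_Ico, Nat.sub_zero, smul_eq_mul])

/-- The states agree up to registers with index at least `m`. -/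
structure Frame (m : ℕ) (s s' : State) : Prop where
  mem : s'.mem = s.mem
  top : s'.top = s.top
  reg : ∀ r < m, s'.reg r = s.reg r

theorem Frame.refl (m : ℕ) (s : State) : Frame m s s := ⟨rfl, rfl, fun _ _ => rfl⟩

theorem Frame.trans {m : ℕ} {s₁ s₂ s₃ : State} (h : Frame m s₁ s₂) (h' : Frame m s₂ s₃) :
    Frame m s₁ s₃ :=
  ⟨h'.mem.trans h.mem, h'.top.trans h.top, fun r hr => (h'.reg r hr).trans (h.reg r hr)⟩

theorem Frame.mono {m m' : ℕ} {s s' : State} (h : Frame m s s') (hm : m' ≤ m := by decide) :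
    Frame m' s s' :=
  ⟨h.mem, h.top, fun r hr => h.reg r (hr.trans_le hm)⟩

theorem Frame.setReg {m r v : ℕ} {s s' : State} (h : Frame m s s') (hr : m ≤ r := by decide) :
    Frame m s (s'.setReg r v) :=
  ⟨h.mem, h.top, fun x hx => by rw [State.reg_setReg, if_neg (by omega), h.reg x hx]⟩

theorem Frame.reg_eq {m r v : ℕ} {s s' : State} (h : Frame m s s') (hv : s.reg r = v)
    (hr : r < m := by decide) : s'.reg r = v :=
  (h.reg r hr).trans hv

end Run

/-! The registers, in the order of the call hierarchy: a subroutine overwrites only registers with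
larger indices than those on whose contents its callers rely (see `Frame`). -/

namespace Reg

@[simp] abbrev answer : ℕ := 0
@[simp] abbrev size : ℕ := 1
@[simp] abbrev zero : ℕ := 2
@[simp] abbrev one : ℕ := 3
@[simp] abbrev order : ℕ := 4
@[simp] abbrev two : ℕ := 5
@[simp] abbrev param : ℕ := 6
@[simp] abbrev capacity : ℕ := 7
@[simp] abbrev base : ℕ := 8
@[simp] abbrev budget : ℕ := 9
@[simp] abbrev running : ℕ := 10
@[simp] abbrev length : ℕ := 11
@[simp] abbrev vertex : ℕ := 12
@[simp] abbrev dart : ℕ := 13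
@[simp] abbrev dartEnd : ℕ := 14
@[simp] abbrev degree : ℕ := 15
@[simp] abbrev probe : ℕ := 16
@[simp] abbrev mismatch : ℕ := 17
@[simp] abbrev walking : ℕ := 18
@[simp] abbrev exit : ℕ := 19
@[simp] abbrev tail : ℕ := 20
@[simp] abbrev position : ℕ := 21
@[simp] abbrev pointer : ℕ := 22
@[simp] abbrev pointerEnd : ℕ := 23
@[simp] abbrev item : ℕ := 24
@[simp] abbrev found : ℕ := 25
@[simp] abbrev query : ℕ := 26
@[simp] abbrev low : ℕ := 27
@[simp] abbrev high : ℕ := 28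
@[simp] abbrev middle : ℕ := 29
@[simp] abbrev word : ℕ := 30
@[simp] abbrev key : ℕ := 31
@[simp] abbrev address : ℕ := 32

end Reg

section Subroutines

variable {w : ℕ} {inp : List ℕ} {s : State}

/-- Copy register `x` to register `r`. There is no instruction for this; dividing by one, provided
that `Reg.one` holds `1`, is a substitute that cannot overflow. -/
def Prog.move (r x : ℕ) : Prog := .op .div r x Reg.one

theorem Run.move {Q : State → Prop} {r x a : ℕ} (hx : s.reg x = a) (hone : s.reg Reg.one = 1)
    (h : Q (s.setReg r a)) : Run w inp (.move r x) s 1 Q :=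
  .op (by rw [hx, hone]; exact Nat.div_one a) h

/-- In the increasing sequence `f lo, …, f (hi - 1)`, the first term that is not smaller than `x`
has an index between `l` and `r`, where the index is `hi` if there is no such term. -/
structure Brackets (f : ℕ → ℕ) (lo hi x l r : ℕ) : Prop where
  lo_le : lo ≤ l
  le : l ≤ r
  le_hi : r ≤ hi
  lt_of_lt : ∀ i, lo ≤ i → i < l → f i < x
  le_of_le : ∀ i, r ≤ i → i < hi → x ≤ f i

theorem Brackets.of_lt {f : ℕ → ℕ} {lo hi x l r m : ℕ} (h : Brackets f lo hi x l r)
    (hf : MonotoneOn f (Set.Ico lo hi)) (hlm : l ≤ m) (hmr : m < r) (hx : f m < x) :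
    Brackets f lo hi x (m + 1) r where
  lo_le := by have := h.lo_le; omega
  le := hmr
  le_hi := h.le_hi
  lt_of_lt _ hi him := (hf ⟨hi, by have := h.le_hi; omega⟩
    ⟨h.lo_le.trans hlm, hmr.trans_le h.le_hi⟩ (Nat.le_of_lt_succ him)).trans_lt hx
  le_of_le := h.le_of_le

theorem Brackets.of_le {f : ℕ → ℕ} {lo hi x l r m : ℕ} (h : Brackets f lo hi x l r)
    (hf : MonotoneOn f (Set.Ico lo hi)) (hlm : l ≤ m) (hmr : m < r) (hx : x ≤ f m) :
    Brackets f lo hi x l m where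
  lo_le := h.lo_le
  le := hlm
  le_hi := hmr.le.trans h.le_hi
  lt_of_lt := h.lt_of_lt
  le_of_le _ hmi hi := hx.trans (hf ⟨h.lo_le.trans hlm, hmr.trans_le h.le_hi⟩
    ⟨(h.lo_le.trans hlm).trans hmi, hi⟩ hmi)

theorem Brackets.mem_image_iff {f : ℕ → ℕ} {lo hi x i : ℕ} (h : Brackets f lo hi x i i)
    (hf : MonotoneOn f (Set.Ico lo hi)) : x ∈ f '' Set.Ico lo hi ↔ i < hi ∧ f i = x := by
  refine ⟨?_, fun ⟨hi, hx⟩ => ⟨i, ⟨h.lo_le, hi⟩, hx⟩⟩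
  rintro ⟨j, ⟨hlo, hhi⟩, rfl⟩
  have hij : i ≤ j := not_lt.1 fun hji => (h.lt_of_lt j hlo hji).ne rfl
  have hi := hij.trans_lt hhi
  exact ⟨hi, (hf ⟨h.lo_le, hi⟩ ⟨hlo, hhi⟩ hij).antisymm (h.le_of_le i le_rfl hi)⟩

/-- Binary search: in the increasing sequence of the words at the addresses from `Reg.low` up to,
but not including `Reg.high`, find the first one that is not smaller than `Reg.key`, and put its
address into `Reg.low`. The instruction `fetch` is `Prog.read` or `Prog.load`. -/
def lowerBound (fetch : ℕ → ℕ → Prog) : Prog :=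
  .loop .lt Reg.low Reg.high (
    .op .add Reg.middle Reg.low Reg.high ⨟ .op .shr Reg.middle Reg.middle Reg.one ⨟
    fetch Reg.word Reg.middle ⨟
    .ite .lt Reg.word Reg.key (.op .add Reg.low Reg.middle Reg.one) (.move Reg.high Reg.middle))

/-- The invariant of `lowerBound`, started in `s`, when at most `N` iterations are left. -/
structure LowerBoundState (f : ℕ → ℕ) (lo hi x : ℕ) (s : State) (N : ℕ) (s' : State) : Prop where
  frame : Frame Reg.low s s'
  key : s'.reg Reg.key = x
  brackets : Brackets f lo hi x (s'.reg Reg.low) (s'.reg Reg.high)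
  lt_two_pow : s'.reg Reg.high - s'.reg Reg.low < 2 ^ N

/-- The instruction `fetch`, if not preceded by changes of registers smaller than `Reg.low`, puts
`f a` into a register when given the address `a`, for `a` between `lo` and `hi`. -/
def Fetches (w : ℕ) (inp : List ℕ) (fetch : ℕ → ℕ → Prog) (f : ℕ → ℕ) (lo hi : ℕ) (s : State) :
    Prop :=
  ∀ ⦃s₁ : State⦄ ⦃r x a : ℕ⦄ ⦃Q : State → Prop⦄, Frame Reg.low s s₁ → s₁.reg x = a → lo ≤ a →
    a < hi → Q (s₁.setReg r (f a)) → Run w inp (fetch r x) s₁ 1 Q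

theorem LowerBoundState.step {fetch : ℕ → ℕ → Prog} {f : ℕ → ℕ} {lo hi x N : ℕ}
    (hone : s.reg Reg.one = 1) (hw : 2 * hi < 2 ^ w) (hf : MonotoneOn f (Set.Ico lo hi))
    (hfetch : Fetches w inp fetch f lo hi s) {s' : State}
    (h : LowerBoundState f lo hi x s (N + 1) s') (hlt : s'.reg Reg.low < s'.reg Reg.high) :
    Run w inp (.op .add Reg.middle Reg.low Reg.high ⨟ .op .shr Reg.middle Reg.middle Reg.one ⨟
      fetch Reg.word Reg.middle ⨟ .ite .lt Reg.word Reg.key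
        (.op .add Reg.low Reg.middle Reg.one) (.move Reg.high Reg.middle)) s' 5
      (LowerBoundState f lo hi x s N) := by
  obtain ⟨hF, hkey, hB, hN⟩ := h
  have hone' := hF.reg_eq hone
  have hlo := hB.lo_le
  have hhi := hB.le_hi
  rw [pow_succ] at hN
  generalize hl : s'.reg Reg.low = l at *
  generalize hr : s'.reg Reg.high = r at *
  refine .seq (b₂ := 4) (.add hl hr (by omega) ?_)
  refine .seq (b₂ := 3) (.shr (a := l + r) (c := 1) (by simp) (by simp [hone']) ?_)
  rw [pow_one]
  generalize hm : (l + r) / 2 = m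
  have hlm : l ≤ m := by omega
  have hmr : m < r := by omega
  refine .seq (b₂ := 2) (hfetch (a := m) hF.setReg.setReg (by simp) (by omega) (by omega) ?_)
  refine .ite (fun hc => ?_) (fun hc => ?_) <;>
    simp only [Cmp.holds, State.reg_setReg, reduceIte, if_neg (by decide : Reg.key ≠ Reg.word),
      if_neg (by decide : Reg.key ≠ Reg.middle), hkey, not_lt] at hc
  · refine .add (a := m) (c := 1) (by simp) (by simp [hone']) (by omega) ?_
    exact ⟨hF.setReg.setReg.setReg.setReg, by simp [hkey],
      by simpa [hr] using hB.of_lt hf hlm hmr hc, by simp [hr]; omega⟩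
  · refine .move (a := m) (by simp) (by simp [hone']) ?_
    exact ⟨hF.setReg.setReg.setReg.setReg, by simp [hkey],
      by simpa [hl] using hB.of_le hf hlm hmr hc, by simp [hl]; omega⟩

theorem lowerBound_run {fetch : ℕ → ℕ → Prog} {f : ℕ → ℕ} {lo hi x N : ℕ}
    (hone : s.reg Reg.one = 1) (hlow : s.reg Reg.low = lo) (hhigh : s.reg Reg.high = hi)
    (hkey : s.reg Reg.key = x) (hle : lo ≤ hi) (hw : 2 * hi < 2 ^ w) (hN : hi - lo < 2 ^ N)
    (hf : MonotoneOn f (Set.Ico lo hi)) (hfetch : Fetches w inp fetch f lo hi s) :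
    Run w inp (lowerBound fetch) s (N * 6 + 1) fun s' =>
      Frame Reg.low s s' ∧ Brackets f lo hi x (s'.reg Reg.low) (s'.reg Reg.low) := by
  refine Run.loop (I := LowerBoundState f lo hi x s) 5 (fun fuel s' h hlt => ?_)
    (fun _ s' h hlt => ?_) ⟨.refl _ _, hkey, ?_, by rwa [hlow, hhigh]⟩
  · cases fuel with
    | zero =>
      have := h.lt_two_pow
      simp only [Cmp.holds] at hlt
      omega
    | succ fuel => exact ⟨fuel, rfl, h.step hone hw hf hfetch hlt⟩
  · have heq : s'.reg Reg.high = s'.reg Reg.low := h.brackets.le.antisymm' (not_lt.1 hlt)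
    exact ⟨h.frame, heq ▸ h.brackets⟩
  · rw [hlow, hhigh]
    exact ⟨le_rfl, hle, le_rfl, fun i _ _ => by omega, fun i _ _ => by omega⟩

end Subroutines

section Representation

/-- The address at which the neighbours of vertex `i` begin. -/
def off (inp : List ℕ) (i : ℕ) : ℕ := inp.getD (i + 2) 0

/-- The addresses of the adjacency array of vertex `v`. -/
def positions (inp : List ℕ) (v : ℕ) : Finset ℕ := Ico (off inp v) (off inp (v + 1))

/-- The word list `inp` starts with `n` and contains the adjacency arrays of the graph `G`, all of
whose edges are between vertices in `{0, …, n - 1}`. -/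
structure Represents (inp : List ℕ) (n : ℕ) (G : SimpleGraph ℕ) : Prop where
  head : inp.getD 0 0 = n
  off_zero : off inp 0 = n + 3
  off_le_succ : ∀ i < n, off inp i ≤ off inp (i + 1)
  adj_iff : ∀ v < n, ∀ u, G.Adj v u ↔ ∃ p ∈ positions inp v, inp.getD p 0 = u
  strictMonoOn : ∀ v < n, StrictMonoOn (fun p => inp.getD p 0) (positions inp v)
  lt_of_adj : ∀ v u, G.Adj v u → v < n

/-- The position cyclically after position `p` in the adjacency array of `x`. -/
def nextPos (inp : List ℕ) (x p : ℕ) : ℕ := if p + 1 = off inp (x + 1) then off inp x else p + 1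

/-- The neighbour cyclically after `z` in the adjacency array of `x`. -/
noncomputable def nextNbr (inp : List ℕ) (x z : ℕ) : ℕ :=
  inp.getD (nextPos inp x (Function.invFunOn (fun p => inp.getD p 0) (positions inp x) z)) 0

variable {inp : List ℕ} {n v p q : ℕ} {G : SimpleGraph ℕ}

theorem mem_positions : p ∈ positions inp v ↔ off inp v ≤ p ∧ p < off inp (v + 1) := mem_Ico

theorem nextPos_mem_positions (hp : p ∈ positions inp v) : nextPos inp v p ∈ positions inp v := by
  rw [mem_positions] at *
  unfold nextPos
  split_ifs <;> omega

theorem nextPos_injOn : Set.InjOn (nextPos inp v) (positions inp v) := by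
  intro p hp q hq h
  rw [mem_coe, mem_positions] at hp hq
  unfold nextPos at h
  split_ifs at h <;> omega

theorem iterate_nextPos_of_le (hpq : p ≤ q) (hq : q < off inp (v + 1)) :
    (nextPos inp v)^[q - p] p = q := by
  induction q, hpq using Nat.le_induction with
  | base => simp
  | succ q hpq ih =>
    rw [Nat.succ_sub hpq, Function.iterate_succ_apply', ih (by omega), nextPos,
      if_neg (by omega)]

theorem exists_iterate_nextPos (hp : p ∈ positions inp v) (hq : q ∈ positions inp v) :
    ∃ i, (nextPos inp v)^[i] p = q := by
  rw [mem_positions] at hp hq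
  have hlast : (nextPos inp v)^[off inp (v + 1) - 1 - p] p = off inp (v + 1) - 1 :=
    iterate_nextPos_of_le (by omega) (by omega)
  refine ⟨(q - off inp v) + ((off inp (v + 1) - 1 - p) + 1), ?_⟩
  rw [Function.iterate_add_apply, Function.iterate_succ_apply', hlast, nextPos, if_pos (by omega)]
  exact iterate_nextPos_of_le hq.1 hq.2

namespace Represents

theorem nextNbr_eq (h : Represents inp n G) (hv : v < n) (hp : p ∈ positions inp v) :
    nextNbr inp v (inp.getD p 0) = inp.getD (nextPos inp v p) 0 := by
  rw [nextNbr, (h.strictMonoOn v hv).injOn.leftInvOn_invFunOn hp]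

theorem iterate_nextNbr_eq (h : Represents inp n G) (hv : v < n) (hp : p ∈ positions inp v)
    (i : ℕ) : (nextNbr inp v)^[i] (inp.getD p 0) = inp.getD ((nextPos inp v)^[i] p) 0 := by
  induction i generalizing p with
  | zero => rfl
  | succ i ih =>
    rw [Function.iterate_succ_apply, Function.iterate_succ_apply, h.nextNbr_eq hv hp,
      ih (nextPos_mem_positions hp)]

theorem lt_right (h : Represents inp n G) {u : ℕ} (hvu : G.Adj v u) : u < n :=
  h.lt_of_adj u v hvu.symm

theorem adj_getD (h : Represents inp n G) (hv : v < n) (hp : p ∈ positions inp v) :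
    G.Adj v (inp.getD p 0) :=
  (h.adj_iff v hv _).2 ⟨p, hp, rfl⟩

theorem exists_position (h : Represents inp n G) {u : ℕ} (hvu : G.Adj v u) :
    v < n ∧ ∃ p ∈ positions inp v, inp.getD p 0 = u :=
  have hv := h.lt_of_adj v u hvu
  ⟨hv, (h.adj_iff v hv u).1 hvu⟩

theorem isRotation (h : Represents inp n G) : IsRotation G (nextNbr inp) where
  adj hxz := by
    obtain ⟨hx, p, hp, rfl⟩ := h.exists_position hxz
    rw [h.nextNbr_eq hx hp]
    exact h.adj_getD hx (nextPos_mem_positions hp)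
  inj hz hz' he := by
    obtain ⟨hx, p, hp, rfl⟩ := h.exists_position hz
    obtain ⟨-, q, hq, rfl⟩ := h.exists_position hz'
    rw [h.nextNbr_eq hx hp, h.nextNbr_eq hx hq] at he
    rw [nextPos_injOn hp hq ((h.strictMonoOn _ hx).injOn (nextPos_mem_positions hp)
      (nextPos_mem_positions hq) he)]
  trans hz hz' := by
    obtain ⟨hx, p, hp, rfl⟩ := h.exists_position hz
    obtain ⟨-, q, hq, rfl⟩ := h.exists_position hz'
    obtain ⟨i, rfl⟩ := exists_iterate_nextPos hp hq
    exact ⟨i, h.iterate_nextNbr_eq hx hp i⟩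

theorem off_mono (h : Represents inp n G) {i j : ℕ} (hij : i ≤ j) (hj : j ≤ n) :
    off inp i ≤ off inp j := by
  induction j, hij using Nat.le_induction with
  | base => exact le_rfl
  | succ j _ ih => exact (ih (by omega)).trans (h.off_le_succ j (by omega))

theorem off_add_sum_card_positions (h : Represents inp n G) {m : ℕ} (hm : m ≤ n) :
    off inp 0 + ∑ v ∈ range m, #(positions inp v) = off inp m := by
  induction m with
  | zero => simp
  | succ m ih =>
    have := h.off_le_succ m hm
    rw [sum_range_succ, ← add_assoc, ih (by omega), positions, Nat.card_Ico]
    omega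

theorem image_positions (h : Represents inp n G) (hv : v < n) :
    (positions inp v).image (fun p => inp.getD p 0) = neighborsIn G (range n) v := by
  ext u
  rw [mem_image, ← h.adj_iff v hv, mem_neighborsIn, mem_range]
  exact ⟨fun hvu => ⟨h.lt_right hvu, hvu⟩, And.right⟩

theorem card_positions (h : Represents inp n G) (hv : v < n) :
    #(positions inp v) = degIn G (range n) v := by
  rw [degIn, ← h.image_positions hv, card_image_of_injOn (h.strictMonoOn v hv).injOn]

theorem card_positions_le (h : Represents inp n G) (hv : v < n) : #(positions inp v) ≤ n :=
  (h.card_positions hv).trans_le ((degIn_le_card ..).trans (card_range n).le)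

theorem off_le (h : Represents inp n G) {i : ℕ} (hi : i ≤ n) : off inp i ≤ n + 3 + n * n := by
  have hsum : ∑ v ∈ range n, #(positions inp v) ≤ n * n :=
    (sum_le_card_nsmul _ _ n fun v hv => h.card_positions_le (mem_range.1 hv)).trans (by simp)
  have := h.off_mono hi le_rfl
  have := h.off_add_sum_card_positions le_rfl
  have := h.off_zero
  omega

theorem exists_darts (h : Represents inp n G) :
    ∃ D : Finset (ℕ × ℕ), #D ≤ off inp n - off inp 0 ∧ ∀ x z, G.Adj x z → (x, z) ∈ D := by
  refine ⟨(range n).biUnion fun x => (positions inp x).image fun p => (x, inp.getD p 0), ?_, ?_⟩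
  · rw [← h.off_add_sum_card_positions le_rfl, Nat.add_sub_cancel_left]
    exact card_biUnion_le.trans (sum_le_sum fun x _ => card_image_le)
  · intro x z hxz
    obtain ⟨hx, p, hp, rfl⟩ := h.exists_position hxz
    exact mem_biUnion.2 ⟨x, mem_range.2 hx, mem_image_of_mem _ hp⟩

end Represents

end Representation

section Member

/-- The registers for `0`, `1`, `2` and `n` hold these numbers, and the first `Reg.size` cells of
the working memory list the set `X` of vertices in increasing order. -/
structure Ready (n : ℕ) (X : Finset ℕ) (s : State) : Prop where
  size : s.reg Reg.size = #X
  zero : s.reg Reg.zero = 0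
  one : s.reg Reg.one = 1
  order : s.reg Reg.order = n
  two : s.reg Reg.two = 2
  card_le_top : #X ≤ s.top
  strictMonoOn : StrictMonoOn s.mem (Set.Ico 0 #X)
  image_mem : (range #X).image s.mem = X
  subset : X ⊆ range n

variable {w n N x : ℕ} {inp : List ℕ} {X : Finset ℕ} {s : State}

theorem Ready.frame {m : ℕ} {s' : State} (h : Ready n X s) (hF : Frame m s s')
    (hm : Reg.two < m := by decide) : Ready n X s' :=
  have hF' := hF.mono hm
  { size := hF'.reg_eq h.size
    zero := hF'.reg_eq h.zero
    one := hF'.reg_eq h.one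
    order := hF'.reg_eq h.order
    two := hF'.reg_eq h.two
    card_le_top := hF.top ▸ h.card_le_top
    strictMonoOn := hF.mem ▸ h.strictMonoOn
    image_mem := hF.mem ▸ h.image_mem
    subset := h.subset }

theorem Ready.card_le (h : Ready n X s) : #X ≤ n := by
  simpa only [card_range] using card_le_card h.subset

theorem Ready.mem_iff (h : Ready n X s) : x ∈ X ↔ x ∈ s.mem '' Set.Ico 0 #X := by
  conv_lhs => rw [← h.image_mem]
  simp

/-- Put into `Reg.low` the number of elements of the stored set that are smaller than
`Reg.query`. -/
def locate : Prog :=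
  .move Reg.key Reg.query ⨟ .move Reg.low Reg.zero ⨟ .move Reg.high Reg.size ⨟ lowerBound .load

theorem locate_run (h : Ready n X s) (hx : s.reg Reg.query = x) (hN : n < 2 ^ N)
    (hw : 2 * n < 2 ^ w) :
    Run w inp locate s (N * 6 + 4) fun s' =>
      Frame Reg.low s s' ∧ Brackets s.mem 0 #X x (s'.reg Reg.low) (s'.reg Reg.low) := by
  have hcard := h.card_le
  refine Run.of_le (b := 1 + (1 + (1 + (N * 6 + 1)))) ?_ (by omega)
  refine .seq (.move hx h.one ?_)
  refine .seq (.move (a := 0) (by simp [h.zero]) (by simp [h.one]) ?_)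
  refine .seq (.move (a := #X) (by simp [h.size]) (by simp [h.one]) ?_)
  have hF := (((Frame.refl Reg.low s).setReg (r := Reg.key) (v := x)).setReg (r := Reg.low)
    (v := 0)).setReg (r := Reg.high) (v := #X)
  refine (lowerBound_run (f := s.mem) (lo := 0) (hi := #X) (x := x) (N := N)
    (by simp [h.one]) (by simp) (by simp) (by simp) (Nat.zero_le _) (by omega) (by omega)
    h.strictMonoOn.monotoneOn ?_).imp fun s' ⟨hF', hB⟩ => ⟨hF.trans hF', hB⟩
  intro s₁ r a b Q hF₁ ha _ haX hQ
  have hF₁ := hF.trans hF₁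
  exact .load ha (by rw [hF₁.mem]) (hF₁.top ▸ haX.trans_le h.card_le_top) hQ

/-- Put `1` into `Reg.found` if `Reg.query` is in the stored set, and `0` otherwise. -/
def member : Prog :=
  locate ⨟ .const Reg.found 0 ⨟
  .ite .lt Reg.low Reg.size
    (.load Reg.word Reg.low ⨟ .ite .eq Reg.word Reg.query (.const Reg.found 1) .skip) .skip

theorem member_run (h : Ready n X s) (hx : s.reg Reg.query = x) (hN : n < 2 ^ N)
    (hw : 2 * n + 1 < 2 ^ w) :
    Run w inp member s (N * 6 + 9) fun s' =>
      Frame Reg.found s s' ∧ s'.reg Reg.query = x ∧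
        s'.reg Reg.found = if x ∈ X then 1 else 0 := by
  refine Run.of_le (b := (N * 6 + 4) + (1 + ((1 + (1 + 1)) + 1))) ?_ (by omega)
  refine .bind (locate_run h hx hN (by omega)) fun s₁ ⟨hF, hB⟩ => ?_
  have hmem := h.mem_iff.trans (hB.mem_image_iff h.strictMonoOn.monotoneOn)
  have hquery := hF.reg_eq hx
  generalize hi : s₁.reg Reg.low = i at *
  refine .seq (.const (by omega) ?_)
  have hF' := (hF.mono (m' := Reg.found)).setReg (r := Reg.found) (v := 0)
  refine .ite (fun hc => ?_) (fun hc => ?_) <;>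
    simp only [Cmp.holds, State.reg_setReg, Reg.low, Reg.size, Reg.found] at hc
  · have hiX : i < #X := by simpa [hi, hF.reg_eq h.size] using hc
    refine .seq (.load (a := i) (v := s.mem i) (by simp [hi]) (by rw [hF'.mem])
      (hF'.top ▸ hiX.trans_le h.card_le_top) ?_)
    refine .ite (fun hc' => .const (by omega) ?_) (fun hc' => .skip ?_)
    · have : x ∈ X := hmem.2 ⟨hiX, by simpa [Cmp.holds, hquery] using hc'⟩
      exact ⟨hF'.setReg.setReg, by simp [hquery], by simp [this]⟩
    · have : x ∉ X := fun hxX => hc' (by simpa [Cmp.holds, hquery] using (hmem.1 hxX).2)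
      exact ⟨hF'.setReg, by simp [hquery], by simp [this]⟩
  · have : x ∉ X := fun hxX => hc (by simpa [hi, hF.reg_eq h.size] using (hmem.1 hxX).1)
    exact (Run.skip ⟨hF', by simp [hquery], by simp [this]⟩).of_le (by omega)

end Member

section Walk

/-- The input represents `G`, words of `w` bits suffice for twice an address and for the numbers
that occur as counts, and `N` is a bound on the number of iterations of a binary search. -/
structure Setting (w : ℕ) (inp : List ℕ) (n N : ℕ) (G : SimpleGraph ℕ) : Prop where
  represents : Represents inp n G
  mul_le_two_pow : 4 * ((n + 3) * (n + 3)) ≤ 2 ^ w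
  lt_two_pow : n < 2 ^ N

variable {w n N y T b t x z : ℕ} {inp : List ℕ} {G : SimpleGraph ℕ} {X : Finset ℕ} {s : State}
  {d : ℕ × ℕ}

theorem Setting.off_lt (h : Setting w inp n N G) {i : ℕ} (hi : i ≤ n) :
    2 * off inp i + 2 < 2 ^ w := by
  have := h.represents.off_le hi
  have := h.mul_le_two_pow
  nlinarith

theorem Setting.linear_lt (h : Setting w inp n N G) : 8 * n + 16 < 2 ^ w := by
  have := h.mul_le_two_pow
  nlinarith

/-- Put into `lo` and `hi` the limits of the adjacency array of the vertex in register `v`. -/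
def readRange (lo hi v : ℕ) : Prog :=
  .op .add Reg.address v Reg.two ⨟ .read lo Reg.address ⨟
  .op .add Reg.address Reg.address Reg.one ⨟ .read hi Reg.address

theorem readRange_run (h : Setting w inp n N G) (hr : Ready n X s) {lo hi v : ℕ}
    (hv : s.reg v = x) (hx : x < n) (hlo : Reg.two < lo := by decide)
    (hlohi : lo < hi := by decide) (hhi : hi < Reg.address := by decide) :
    Run w inp (readRange lo hi v) s 4 fun s' =>
      Frame lo s s' ∧ s'.reg lo = off inp x ∧ s'.reg hi = off inp (x + 1) := by
  have hlin := h.linear_lt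
  have hoff := h.off_lt (i := x) hx.le
  have hoff' := h.off_lt (i := x + 1) hx
  have hone : Reg.one ≠ lo := ((by decide : Reg.one < Reg.two).trans hlo).ne
  have haddress : lo < Reg.address := hlohi.trans hhi
  refine .seq (b₂ := 3) (.add hv hr.two (by omega) ?_)
  refine .seq (b₂ := 2) (.read (a := x + 2) (v := off inp x) (by simp) rfl (by omega) ?_)
  refine .seq (b₂ := 1) (.add (a := x + 2) (c := 1) (by simp [haddress.ne'])
    (by simp [hone, hr.one]) (by omega) ?_)
  refine .read (a := x + 1 + 2) (v := off inp (x + 1)) (by simp) rfl (by omega) ?_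
  exact ⟨((((Frame.refl lo s).setReg haddress.le).setReg le_rfl).setReg haddress.le).setReg
    hlohi.le, by simp [hlohi.ne, haddress.ne], by simp⟩

/-- `Reg.tail` holds the first vertex of the dart `d`, and `Reg.position` holds the position of the
second one in the adjacency array of the first one. -/
structure OnDart (inp : List ℕ) (d : ℕ × ℕ) (s : State) : Prop where
  tail : s.reg Reg.tail = d.1
  mem : s.reg Reg.position ∈ positions inp d.1
  target : inp.getD (s.reg Reg.position) 0 = d.2

theorem OnDart.congr {s' : State} (h : OnDart inp d s)
    (htail : s'.reg Reg.tail = s.reg Reg.tail)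
    (hposition : s'.reg Reg.position = s.reg Reg.position) : OnDart inp d s' :=
  ⟨htail ▸ h.tail, hposition ▸ h.mem, hposition ▸ h.target⟩

theorem OnDart.frame {m : ℕ} {s' : State} (h : OnDart inp d s) (hF : Frame m s s')
    (hm : Reg.position < m := by decide) : OnDart inp d s' :=
  have hF' := hF.mono hm
  h.congr (hF'.reg_eq rfl) (hF'.reg_eq rfl)

/-- Replace the current dart by the one cyclically after it at the same vertex. -/
def advance : Prog :=
  readRange Reg.low Reg.high Reg.tail ⨟ .op .add Reg.position Reg.position Reg.one ⨟
  .ite .eq Reg.position Reg.high (.move Reg.position Reg.low) .skip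

theorem advance_run (h : Setting w inp n N G) (hr : Ready n X s) (hd : OnDart inp d s)
    (hlt : d.1 < n) :
    Run w inp advance s 7 fun s' =>
      Frame Reg.tail s s' ∧ OnDart inp (d.1, nextNbr inp d.1 d.2) s' := by
  obtain ⟨htail, hmem, htarget⟩ := hd
  have hmem' := mem_positions.1 hmem
  have hoff := h.off_lt (i := d.1 + 1) hlt
  refine .bind (b₂ := 3) (readRange_run h hr htail hlt) fun s₁ ⟨hF₁, hlow, hhigh⟩ => ?_
  have hr₁ := hr.frame hF₁
  have htail₁ := hF₁.reg_eq htail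
  have hposition₁ := hF₁.reg_eq (r := Reg.position) rfl
  have hF := hF₁.mono (m' := Reg.tail)
  generalize s.reg Reg.position = p at *
  refine .seq (b₂ := 2) (.add (a := p) (c := 1) hposition₁ hr₁.one (by omega) ?_)
  rw [← htarget, h.represents.nextNbr_eq hlt hmem]
  have hnext := nextPos_mem_positions hmem
  have hF' := (hF.setReg (r := Reg.position) (v := p + 1))
  refine .ite (fun hc => ?_) (fun hc => .skip ?_)
  · have hc' : p + 1 = off inp (d.1 + 1) := by simpa [Cmp.holds, hhigh] using hc
    refine .move (a := off inp d.1) (by simp [hlow]) (by simp [hr₁.one]) ?_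
    rw [nextPos, if_pos hc'] at hnext ⊢
    exact ⟨hF'.setReg, by simp [htail₁], by simpa using hnext, by simp⟩
  · have hc' : p + 1 ≠ off inp (d.1 + 1) := by simpa [Cmp.holds, hhigh] using hc
    rw [nextPos, if_neg hc'] at hnext ⊢
    exact ⟨hF', by simp [htail₁], by simpa using hnext, by simp⟩

/-- Replace the current dart, which leads to the vertex in `Reg.query`, by the reverse dart. -/
def reverse : Prog :=
  readRange Reg.low Reg.high Reg.query ⨟ .move Reg.key Reg.tail ⨟ lowerBound .read ⨟
  .move Reg.position Reg.low ⨟ .move Reg.tail Reg.query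

theorem reverse_run (h : Setting w inp n N G) (hr : Ready n X s) (htail : s.reg Reg.tail = x)
    (hquery : s.reg Reg.query = z) (hxz : G.Adj x z) :
    Run w inp reverse s (N * 6 + 8) fun s' => Frame Reg.tail s s' ∧ OnDart inp (z, x) s' := by
  have hz := h.represents.lt_right hxz
  have hmono := (h.represents.strictMonoOn z hz).monotoneOn
  have hx : x ∈ (fun p => inp.getD p 0) '' (positions inp z) :=
    (h.represents.adj_iff z hz x).1 hxz.symm
  have hcard := h.represents.card_positions_le hz
  rw [positions, coe_Ico] at hx hmono
  rw [positions, Nat.card_Ico] at hcard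
  have hoff := h.off_lt (i := z + 1) hz
  have hN := h.lt_two_pow
  have hlin := h.linear_lt
  refine Run.of_le (b := 4 + (1 + ((N * 6 + 1) + (1 + 1)))) ?_ (by omega)
  refine .bind (readRange_run h hr hquery hz) fun s₁ ⟨hF₁, hlow, hhigh⟩ => ?_
  have hr₁ := hr.frame hF₁
  refine .seq (.move (hF₁.reg_eq htail) hr₁.one ?_)
  have hF₁' := hF₁.setReg (r := Reg.key) (v := x)
  refine .bind (lowerBound_run (x := x) (N := N) (f := fun p => inp.getD p 0) (by simp [hr₁.one])
    (by simp [hlow]) (by simp [hhigh]) (by simp) (h.represents.off_le_succ z hz) (by omega)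
    (by omega) hmono fun s₂ r y a Q _ ha hlo hhi hQ => ?_) fun s₂ ⟨hF₂, hB⟩ => ?_
  · have := h.represents.lt_right (h.represents.adj_getD hz (mem_positions.2 ⟨hlo, hhi⟩))
    exact .read ha rfl (by omega) hQ
  · obtain ⟨hlt, htarget⟩ := (hB.mem_image_iff hmono).1 hx
    have hF := (hF₁'.trans hF₂).mono (m' := Reg.position)
    have hr₂ := hr.frame hF
    refine .seq (.move rfl hr₂.one (.move (a := z) ?_ (by simp [hr₂.one]) ?_))
    · simpa using (hF₁'.trans hF₂).reg_eq hquery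
    · exact ⟨hF.mono.setReg.setReg,
        by simp, by simpa using mem_positions.2 ⟨hB.lo_le, hlt⟩, by simpa using htarget⟩

/-- Record that the walk goes from the vertex in `Reg.tail` to the one in `Reg.query`: detect a
mismatch at `Reg.probe`, update the last exit from `Reg.probe`, and stop at `Reg.vertex`. The
number of vertices in `Reg.exit` stands for no exit. -/
def record : Prog :=
  .ite .eq Reg.query Reg.probe (.ite .ne Reg.exit Reg.order
    (.ite .ne Reg.exit Reg.tail (.const Reg.mismatch 1) .skip) .skip) .skip ⨟
  .ite .eq Reg.tail Reg.probe (.move Reg.exit Reg.query) .skip ⨟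
  .ite .eq Reg.query Reg.vertex (.move Reg.walking Reg.zero) .skip

/-- The state in which `record` halts. -/
def State.record (n : ℕ) (s : State) : State :=
  ((s.setReg Reg.mismatch (if s.reg Reg.query = s.reg Reg.probe ∧ s.reg Reg.exit ≠ n ∧
    s.reg Reg.exit ≠ s.reg Reg.tail then 1 else s.reg Reg.mismatch)).setReg
    Reg.exit (if s.reg Reg.tail = s.reg Reg.probe then s.reg Reg.query else s.reg Reg.exit)).setReg
    Reg.walking (if s.reg Reg.query = s.reg Reg.vertex then 0 else s.reg Reg.walking)

theorem State.frame_record : Frame Reg.mismatch s (s.record n) :=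
  (Frame.refl _ s).setReg.setReg.setReg

theorem State.setReg_self (s : State) (r : ℕ) : s.setReg r (s.reg r) = s := by
  rw [State.setReg, Function.update_eq_self]

theorem record_run (hw : 1 < 2 ^ w) (hr : Ready n X s) :
    Run w inp record s 8 fun s' => s' = s.record n := by
  have horder := hr.order
  refine Run.of_le (b := 4 + (2 + 2)) ?_ (by omega)
  refine .bind (Q' := fun s' => s' = s.setReg Reg.mismatch (if s.reg Reg.query = s.reg Reg.probe ∧
    s.reg Reg.exit ≠ n ∧ s.reg Reg.exit ≠ s.reg Reg.tail then 1 else s.reg Reg.mismatch)) ?_ ?_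
  · have hself := s.setReg_self Reg.mismatch
    refine .ite (fun hc => .ite (fun hc' => .ite (fun hc'' => .const hw ?_)
      (fun hc'' => .skip ?_)) (fun hc' => (Run.skip ?_).of_le (by omega)))
      (fun hc => (Run.skip ?_).of_le (by omega)) <;> simp_all [Cmp.holds]
  rintro s₁ hs₁
  refine .bind (Q' := fun s' => s' = s₁.setReg Reg.exit
    (if s.reg Reg.tail = s.reg Reg.probe then s.reg Reg.query else s.reg Reg.exit)) ?_ ?_
  · have hself := s₁.setReg_self Reg.exit
    refine .ite (fun hc => .move rfl ?_ ?_) (fun hc => .skip ?_) <;>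
      simp_all [Cmp.holds, hr.one]
  rintro s₂ hs₂
  have hself := s₂.setReg_self Reg.walking
  refine .ite (fun hc => .move rfl ?_ ?_) (fun hc => .skip ?_) <;>
    simp_all [Cmp.holds, hr.one, hr.zero, State.record]

/-- The registers for the last exit from `y`, for whether there has been a mismatch at `y`, and for
whether the walk continues, after `t` steps of the contour walk from the dart `d`. The walk stops
after `T + 1` steps, and `Reg.mismatch` contained `b` at the beginning. -/
structure Recorded (n : ℕ) (W : Finset ℕ) (rot : ℕ → ℕ → ℕ) (d : ℕ × ℕ) (y T b t : ℕ) (s : State) :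
    Prop where
  exit : s.reg Reg.exit = (lastExit W rot d y t).getD n
  mismatch : s.reg Reg.mismatch = 0 ↔ b = 0 ∧ ∀ t' < t, ¬ Mismatch W rot d y t'
  walking : s.reg Reg.walking = if t = T + 1 then 0 else 1

namespace Recorded

variable {W : Finset ℕ} {rot : ℕ → ℕ → ℕ}

theorem frame {m : ℕ} {s' : State} (h : Recorded n W rot d y T b t s) (hF : Frame m s s')
    (hm : Reg.exit < m := by decide) : Recorded n W rot d y T b t s' :=
  have hF' := hF.mono hm
  ⟨hF'.reg_eq h.exit, by rw [hF'.reg_eq rfl, h.mismatch], hF'.reg_eq h.walking⟩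

theorem succ_of_notMem (h : Recorded n W rot d y T b t s) (hT : IsFirstArrival W rot d T)
    (hd : d.1 ∈ W) (ht : t ≤ T) (hz : (contour W rot d t).2 ∉ W) :
    Recorded n W rot d y T b (t + 1) s where
  exit := by rw [h.exit, lastExit, if_neg fun hc => hz hc.1]
  mismatch := by
    have : ¬ Mismatch W rot d y t := fun hm => hz hm.1
    rw [h.mismatch, Nat.forall_lt_succ_right, and_iff_left this]
  walking := by
    have htT : t ≠ T := by
      rintro rfl
      exact hz (hT.eq ▸ hd)
    rw [h.walking, if_neg (by omega), if_neg (by omega)]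

theorem mismatch_iff (h : Recorded n W rot d y T b t s) (hn : n ∉ W)
    (hz : (contour W rot d t).2 ∈ W) :
    Mismatch W rot d y t ↔ (contour W rot d t).2 = y ∧ s.reg Reg.exit ≠ n ∧
      s.reg Reg.exit ≠ (contour W rot d t).1 := by
  rw [Mismatch, h.exit]
  cases hlast : lastExit W rot d y t with
  | none => simp
  | some l =>
    obtain ⟨i, -, -, hl, -⟩ := lastExit_eq_some_iff.1 hlast
    have hln : l ≠ n := fun hln => hn (hln ▸ hl)
    simp [hz, hln]

theorem record (h : Recorded n W rot d y T b t s) (hT : IsFirstArrival W rot d T) (hn : n ∉ W)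
    (ht : t ≤ T) (hz : (contour W rot d t).2 ∈ W) (htail : s.reg Reg.tail = (contour W rot d t).1)
    (hquery : s.reg Reg.query = (contour W rot d t).2) (hprobe : s.reg Reg.probe = y)
    (hvertex : s.reg Reg.vertex = d.1) : Recorded n W rot d y T b (t + 1) (s.record n) where
  exit := by
    have hexit : (s.record n).reg Reg.exit =
      if s.reg Reg.tail = s.reg Reg.probe then s.reg Reg.query else s.reg Reg.exit := by
      simp [State.record]
    rw [hexit, lastExit, htail, hprobe, hquery, h.exit]
    by_cases hy : (contour W rot d t).1 = y <;> simp [hy, hz]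
  mismatch := by
    have hmismatch : (s.record n).reg Reg.mismatch = if s.reg Reg.query = s.reg Reg.probe ∧
        s.reg Reg.exit ≠ n ∧ s.reg Reg.exit ≠ s.reg Reg.tail then 1 else s.reg Reg.mismatch := by
      simp [State.record]
    have hiff : Mismatch W rot d y t ↔ s.reg Reg.query = s.reg Reg.probe ∧ s.reg Reg.exit ≠ n ∧
        s.reg Reg.exit ≠ s.reg Reg.tail := by
      rw [htail, hprobe, hquery]
      exact h.mismatch_iff hn hz
    rw [Nat.forall_lt_succ_right (p := fun t' => ¬ Mismatch W rot d y t'), ← and_assoc,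
      ← h.mismatch, hiff, hmismatch]
    split_ifs with hc <;> simp [hc]
  walking := by
    have hwalking : (s.record n).reg Reg.walking =
      if s.reg Reg.query = s.reg Reg.vertex then 0 else s.reg Reg.walking := by
      simp [State.record]
    rw [hwalking, hquery, hvertex, h.walking]
    rcases ht.lt_or_eq with ht | rfl
    · rw [if_neg (hT.ne t ht), if_neg (by omega), if_neg (by omega)]
    · rw [if_pos hT.eq, if_pos rfl]

end Recorded

/-- Make a step of the contour walk, and record it if it is along an edge of the remaining graph. -/
def walkStep : Prog :=
  .read Reg.query Reg.position ⨟ member ⨟ .ite .eq Reg.found Reg.zero (record ⨟ reverse) .skip ⨟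
  advance

/-- The invariant of `walk`, started in `s` with the dart `d` and the probe `y`, after `t` steps. -/
structure WalkState (inp : List ℕ) (n : ℕ) (X : Finset ℕ) (d : ℕ × ℕ) (y T : ℕ) (s : State) (t : ℕ)
    (s' : State) : Prop where
  frame : Frame Reg.mismatch s s'
  onDart : OnDart inp (contour (range n \ X) (nextNbr inp) d t) s'
  recorded : Recorded n (range n \ X) (nextNbr inp) d y T (s.reg Reg.mismatch) t s'

theorem record_reverse_run (h : Setting w inp n N G) (hr : Ready n X s) {s' : State}
    (hs' : WalkState inp n X d y T s t s') (hd : G.Adj d.1 d.2) (hdW : d.1 ∈ range n \ X)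
    (hT : IsFirstArrival (range n \ X) (nextNbr inp) d T) (hvertex : s.reg Reg.vertex = d.1)
    (hprobe : s.reg Reg.probe = y) (ht : t ≤ T)
    (hquery : s'.reg Reg.query = (contour (range n \ X) (nextNbr inp) d t).2)
    (hz : (contour (range n \ X) (nextNbr inp) d t).2 ∈ range n \ X) :
    Run w inp (record ⨟ reverse) s' (N * 6 + 16) fun s' => Frame Reg.mismatch s s' ∧
      OnDart inp (contour (range n \ X) (nextNbr inp) d t).swap s' ∧
      Recorded n (range n \ X) (nextNbr inp) d y T (s.reg Reg.mismatch) (t + 1) s' := by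
  obtain ⟨hF, hon, hrec⟩ := hs'
  have hlin := h.linear_lt
  obtain ⟨hadj, -⟩ := contour_adj h.represents.isRotation hd hdW t
  have hrec' := hrec.record hT (by simp) ht hz hon.tail hquery (hF.reg_eq hprobe)
    (hF.reg_eq hvertex)
  have hr' := hr.frame hF
  refine Run.of_le (b := 8 + (N * 6 + 8)) (.bind (record_run (by omega) hr') ?_) (by omega)
  rintro _ rfl
  have hF' := s'.frame_record (n := n)
  refine (reverse_run h (hr'.frame hF') ?_ ?_ hadj).imp fun s₁ ⟨hF₁, hon₁⟩ =>
    ⟨(hF.trans hF').trans hF₁.mono, hon₁, hrec'.frame hF₁⟩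
  · simpa [State.record] using hon.tail
  · simpa [State.record] using hquery

theorem walkStep_run (h : Setting w inp n N G) (hr : Ready n X s) {s' : State}
    (hs' : WalkState inp n X d y T s t s') (hd : G.Adj d.1 d.2) (hdW : d.1 ∈ range n \ X)
    (hT : IsFirstArrival (range n \ X) (nextNbr inp) d T) (hvertex : s.reg Reg.vertex = d.1)
    (hprobe : s.reg Reg.probe = y) (ht : t ≤ T) :
    Run w inp walkStep s' (N * 12 + 34) (WalkState inp n X d y T s (t + 1)) := by
  have ⟨hF, hon, hrec⟩ := hs'
  have hlin := h.linear_lt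
  obtain ⟨hadj, -⟩ := contour_adj h.represents.isRotation hd hdW t
  have hxn := h.represents.lt_of_adj _ _ hadj
  have hzn := h.represents.lt_right hadj
  refine Run.of_le (b := 1 + ((N * 6 + 9) + ((N * 6 + 16 + 1) + 7))) ?_ (by omega)
  refine .seq (.read rfl hon.target (by omega) ?_)
  have hFq := (Frame.refl Reg.query s').setReg (r := Reg.query)
    (v := (contour (range n \ X) (nextNbr inp) d t).2)
  refine .bind (member_run (x := (contour (range n \ X) (nextNbr inp) d t).2)
    (hr.frame (hF.trans hFq.mono)) (by simp) h.lt_two_pow (by omega))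
    fun s₁ ⟨hF₁, hquery, hfound⟩ => ?_
  have hF₁ := hFq.mono.trans hF₁
  have hs₁ : WalkState inp n X d y T s t s₁ :=
    ⟨hF.trans hF₁.mono, hon.frame hF₁, hrec.frame hF₁⟩
  have hzero := (hr.frame hs₁.frame).zero
  refine .bind (Q' := fun s' => Frame Reg.mismatch s s' ∧
    Recorded n (range n \ X) (nextNbr inp) d y T (s.reg Reg.mismatch) (t + 1) s' ∧
    ∃ e, OnDart inp e s' ∧ e.1 < n ∧
      contour (range n \ X) (nextNbr inp) d (t + 1) = (e.1, nextNbr inp e.1 e.2))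
    (.ite (fun hc => ?_) (fun hc => ?_)) fun s₂ ⟨hF₂, hrec₂, e, hon₂, hen, he⟩ => ?_
  · have hz : (contour (range n \ X) (nextNbr inp) d t).2 ∈ range n \ X := by
      simpa [Cmp.holds, hfound, hzero, hzn] using hc
    refine (record_reverse_run h hr hs₁ hd hdW hT hvertex hprobe ht hquery hz).imp
      fun s₂ ⟨hF₂, hon₂, hrec₂⟩ => ⟨hF₂, hrec₂, _, hon₂, hzn, contour_succ_of_mem hz⟩
  · have hz : (contour (range n \ X) (nextNbr inp) d t).2 ∉ range n \ X := by
      simpa [Cmp.holds, hfound, hzero, hzn] using hc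
    exact (Run.skip ⟨hs₁.frame, hs₁.recorded.succ_of_notMem hT hdW ht hz, _, hs₁.onDart, hxn,
      contour_succ_of_notMem hz⟩).of_le (by omega)
  · refine (advance_run h (hr.frame hF₂) hon₂ hen).imp fun s₃ ⟨hF₃, hon₃⟩ =>
      ⟨hF₂.trans hF₃.mono, he ▸ hon₃, hrec₂.frame hF₃⟩

/-- Walk around the contour, from the dart at the position in `Reg.dart` of the vertex in
`Reg.vertex` until this vertex is reached again. Put `1` into `Reg.mismatch` if there is a mismatch
at the vertex in `Reg.probe`. -/
def walk : Prog :=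
  .move Reg.tail Reg.vertex ⨟ .move Reg.position Reg.dart ⨟ .move Reg.exit Reg.order ⨟
  .move Reg.walking Reg.one ⨟ .loop .ne Reg.walking Reg.zero walkStep

/-- `Reg.vertex` holds the first vertex of the dart `d`, and `Reg.dart` the position of the second
one in the adjacency array of the first one. -/
structure AtDart (inp : List ℕ) (d : ℕ × ℕ) (s : State) : Prop where
  vertex : s.reg Reg.vertex = d.1
  mem : s.reg Reg.dart ∈ positions inp d.1
  target : inp.getD (s.reg Reg.dart) 0 = d.2

theorem AtDart.frame {m : ℕ} {s' : State} (h : AtDart inp d s) (hF : Frame m s s')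
    (hm : Reg.dart < m := by decide) : AtDart inp d s' :=
  have hdart := (hF.mono hm).reg_eq (r := Reg.dart) rfl
  ⟨(hF.mono hm).reg_eq h.vertex, hdart ▸ h.mem, hdart ▸ h.target⟩

theorem walk_run (h : Setting w inp n N G) (hr : Ready n X s) (hat : AtDart inp d s)
    (hdW : d.1 ∈ range n \ X) (hT : IsFirstArrival (range n \ X) (nextNbr inp) d T) :
    Run w inp walk s ((T + 1) * (N * 12 + 35) + 5) fun s' => Frame Reg.mismatch s s' ∧
      (s'.reg Reg.mismatch = 0 ↔ s.reg Reg.mismatch = 0 ∧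
        ∀ t < T + 1, ¬ Mismatch (range n \ X) (nextNbr inp) d (s.reg Reg.probe) t) := by
  obtain ⟨hvertex, hmem, htarget⟩ := hat
  have hd : G.Adj d.1 d.2 := htarget ▸ h.represents.adj_getD (by simp_all) hmem
  refine Run.of_le (b := 1 + (1 + (1 + (1 + ((T + 1) * (N * 12 + 34 + 1) + 1)))))
    ?_ (le_of_eq (by ring))
  refine .seq (.move hvertex hr.one ?_)
  refine .seq (.move (a := s.reg Reg.dart) (by simp) (by simp [hr.one]) ?_)
  refine .seq (.move (a := n) (by simp [hr.order]) (by simp [hr.one]) ?_)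
  refine .seq (.move (a := 1) (by simp [hr.one]) (by simp [hr.one]) ?_)
  refine Run.loop_range_const (I := WalkState inp n X d (s.reg Reg.probe) T s) _ _
    (fun t s₁ ht hs => ⟨?_, walkStep_run h hr hs hd hdW hT hvertex rfl (by omega)⟩)
    (fun s₁ hs => ⟨?_, hs.frame, hs.recorded.mismatch⟩)
    ⟨(Frame.refl _ s).setReg.setReg.setReg.setReg, ⟨by simp [contour], by simpa [contour],
      by simpa [contour]⟩, ⟨by simp [lastExit], by simp, by simp⟩⟩
  · simp [Cmp.holds, hs.recorded.walking, (hr.frame hs.frame).zero, ht.ne]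
  · simp [Cmp.holds, hs.recorded.walking, (hr.frame hs.frame).zero]

end Walk

section Degree

variable {w n N v : ℕ} {inp : List ℕ} {G : SimpleGraph ℕ} {X W : Finset ℕ} {s : State} {d : ℕ × ℕ}

/-- Put `0` into `Reg.mismatch` if the dart at the position in `Reg.dart` of the vertex in
`Reg.vertex` leads to a dangling tree, and `1` otherwise. -/
def checkDangling : Prog :=
  .move Reg.probe Reg.zero ⨟ .move Reg.mismatch Reg.zero ⨟
  .loop .lt Reg.probe Reg.order (walk ⨟ .op .add Reg.probe Reg.probe Reg.one)

theorem checkDangling_run (h : Setting w inp n N G) (hr : Ready n X s) (hat : AtDart inp d s)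
    (hv : d.1 ∈ range n \ X) (hu : d.2 ∈ range n \ X) :
    Run w inp checkDangling s (n * ((off inp n - off inp 0) * (N * 12 + 35) + 7) + 3) fun s' =>
      Frame Reg.probe s s' ∧
        (s'.reg Reg.mismatch = 0 ↔ Dangling G (range n \ X) d.1 d.2) := by
  have hlin := h.linear_lt
  have hd : G.Adj d.1 d.2 := hat.target ▸ h.represents.adj_getD (by simp_all) hat.mem
  obtain ⟨D, hDcard, hD⟩ := h.represents.exists_darts
  obtain ⟨T, hTD, hT⟩ := exists_isFirstArrival h.represents.isRotation hd hv hu D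
    fun x z _ hxz => hD x z hxz
  have hcost : (T + 1) * (N * 12 + 35) + 5 ≤
      (off inp n - off inp 0) * (N * 12 + 35) + 5 := by gcongr; omega
  refine Run.of_le (b := 1 + (1 + (n * (((off inp n - off inp 0) * (N * 12 + 35) + 5 + 1) + 1)
    + 1))) ?_ (le_of_eq (by ring))
  refine .seq (.move hr.zero hr.one ?_)
  refine .seq (.move (a := 0) (by simp [hr.zero]) (by simp [hr.one]) ?_)
  refine Run.loop_range_const (I := fun y s' => Frame Reg.probe s s' ∧ s'.reg Reg.probe = y ∧
    (s'.reg Reg.mismatch = 0 ↔ ∀ y' < y, ∀ t < T + 1,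
      ¬ Mismatch (range n \ X) (nextNbr inp) d y' t)) _ _ ?_ ?_
    ⟨(Frame.refl _ s).setReg.setReg, by simp, by simp⟩
  · rintro y s₁ hy ⟨hF₁, hprobe, hmismatch⟩
    have hr₁ := hr.frame hF₁
    refine ⟨by simpa [Cmp.holds, hprobe, hr₁.order], ?_⟩
    refine .bind (b₂ := 1) ((walk_run h hr₁ (hat.frame hF₁) hv hT).of_le hcost)
      fun s₂ ⟨hF₂, hmismatch₂⟩ => ?_
    refine .add (a := y) (c := 1) (hF₂.reg_eq hprobe) (hr₁.frame hF₂).one (by omega) ?_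
    refine ⟨(hF₁.trans hF₂.mono).setReg, by simp, ?_⟩
    rw [hprobe, hmismatch, ← Nat.forall_lt_succ_right] at hmismatch₂
    simpa using hmismatch₂
  · rintro s₁ ⟨hF₁, hprobe, hmismatch⟩
    refine ⟨by simp [Cmp.holds, hprobe, (hr.frame hF₁).order], hF₁, ?_⟩
    rw [hmismatch, dangling_iff_forall_not_mismatch h.represents.isRotation hd hv hu hT]
    refine ⟨fun hall y t ht hm => hall y ?_ t (Nat.lt_succ_of_le ht) hm,
      fun hall y _ t ht => hall y t (Nat.le_of_lt_succ ht)⟩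
    exact mem_range.1 (mem_sdiff.1 (hm.2.1 ▸ hm.1)).1

open Classical in
/-- The positions before `p` in the adjacency array of `v` whose darts lead to vertices of `W`, but
not to dangling trees. -/
noncomputable def corePositions (inp : List ℕ) (G : SimpleGraph ℕ) (W : Finset ℕ) (v p : ℕ) :
    Finset ℕ :=
  {q ∈ Ico (off inp v) p | inp.getD q 0 ∈ W ∧ ¬ Dangling G W v (inp.getD q 0)}

theorem card_corePositions_off_succ (h : Represents inp n G) (hv : v < n) :
    #(corePositions inp G W v (off inp (v + 1))) = coreDeg G W v := by
  classical
  have hinj : Set.InjOn (fun p => inp.getD p 0)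
      (corePositions inp G W v (off inp (v + 1)) : Finset ℕ) :=
    (h.strictMonoOn v hv).injOn.mono (filter_subset ..)
  rw [coreDeg, ← card_image_of_injOn hinj, corePositions, ← positions]
  congr 1
  ext u
  simp only [mem_image, mem_filter, h.adj_iff v hv]
  constructor
  · rintro ⟨p, ⟨hp, hpW, hdangling⟩, rfl⟩
    exact ⟨hpW, ⟨p, hp, rfl⟩, hdangling⟩
  · rintro ⟨hpW, ⟨p, hp, rfl⟩, hdangling⟩
    exact ⟨p, ⟨hp, hpW, hdangling⟩, rfl⟩

theorem card_corePositions_le (h : Represents inp n G) (hv : v < n) {p : ℕ}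
    (hp : p ≤ off inp (v + 1)) : #(corePositions inp G W v p) ≤ n := by
  classical
  exact (card_filter_le ..).trans
    ((card_le_card (Ico_subset_Ico_right hp)).trans (h.card_positions_le hv))

theorem coreDeg_le (h : Represents inp n G) (hv : v < n) : coreDeg G W v ≤ n :=
  card_corePositions_off_succ h hv ▸ card_corePositions_le h hv le_rfl

open Classical in
theorem card_corePositions_succ {p : ℕ} (hp : off inp v ≤ p) :
    #(corePositions inp G W v (p + 1)) = #(corePositions inp G W v p) +
      if inp.getD p 0 ∈ W ∧ ¬ Dangling G W v (inp.getD p 0) then 1 else 0 := by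
  rw [corePositions, corePositions, Nat.Ico_succ_right_eq_insert_Ico hp, filter_insert]
  split_ifs
  · rw [card_insert_of_notMem (by simp)]
  · rfl

/-- Count the dart at the position in `Reg.dart`, unless it leads to a dangling tree. -/
def countDart : Prog :=
  .read Reg.query Reg.dart ⨟ member ⨟
  .ite .eq Reg.found Reg.zero
    (checkDangling ⨟ .ite .ne Reg.mismatch Reg.zero (.op .add Reg.degree Reg.degree Reg.one) .skip)
    .skip

/-- Put into `Reg.degree` the degree of the vertex in `Reg.vertex` in the core. -/
def countCore : Prog :=
  readRange Reg.dart Reg.dartEnd Reg.vertex ⨟ .move Reg.degree Reg.zero ⨟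
  .loop .lt Reg.dart Reg.dartEnd (countDart ⨟ .op .add Reg.dart Reg.dart Reg.one)

theorem countDart_run (h : Setting w inp n N G) (hr : Ready n X s) (hat : AtDart inp d s)
    (hv : d.1 ∈ range n \ X)
    (hdegree : s.reg Reg.degree = #(corePositions inp G (range n \ X) d.1 (s.reg Reg.dart))) :
    Run w inp countDart s (n * ((off inp n - off inp 0) * (N * 12 + 35) + 7) + (N * 6 + 16))
      fun s' => Frame Reg.degree s s' ∧ s'.reg Reg.degree =
        #(corePositions inp G (range n \ X) d.1 (s.reg Reg.dart + 1)) := by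
  obtain ⟨hlo, hhi⟩ := mem_positions.1 hat.mem
  have hvn : d.1 < n := by simp_all
  have hd : G.Adj d.1 d.2 := hat.target ▸ h.represents.adj_getD hvn hat.mem
  have hun := h.represents.lt_right hd
  have hlin := h.linear_lt
  have hsucc := card_corePositions_succ (G := G) (W := range n \ X) hlo
  rw [← hdegree, hat.target] at hsucc
  have hle :=
    card_corePositions_le (W := range n \ X) (p := s.reg Reg.dart + 1) h.represents hvn hhi
  have hcheck := fun s₂ => checkDangling_run (s := s₂) h (X := X) (d := d)
  generalize n * ((off inp n - off inp 0) * (N * 12 + 35) + 7) = b at hcheck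
  refine Run.of_le (b := 1 + ((N * 6 + 9) + ((b + 3) + (1 + 1) + 1))) ?_ (by omega)
  refine .seq (.read rfl hat.target (by omega) ?_)
  have hF₁ := (Frame.refl Reg.query s).setReg (r := Reg.query) (v := d.2)
  refine .bind (member_run (x := d.2) (hr.frame hF₁) (by simp) h.lt_two_pow (by omega))
    fun s₂ ⟨hF₂, _, hfound⟩ => ?_
  have hF₂ := hF₁.mono.trans hF₂
  have hr₂ := hr.frame hF₂
  refine .ite (b := b + 3 + (1 + 1)) (fun hc => ?_) (fun hc => ?_)
  · have hu : d.2 ∈ range n \ X := by simpa [Cmp.holds, hfound, hr₂.zero, hun] using hc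
    refine .bind (hcheck s₂ hr₂ (hat.frame hF₂) hv hu) fun s₃ ⟨hF₃, hmismatch⟩ => ?_
    have hr₃ := hr₂.frame hF₃
    have hF₃ := hF₂.mono.trans hF₃
    refine .ite (fun hc => ?_) (fun hc => ?_) <;>
      simp only [Cmp.holds, hr₃.zero, ne_eq, hmismatch] at hc
    · rw [if_pos ⟨hu, hc⟩] at hsucc
      exact .add (a := s.reg Reg.degree) (c := 1) (hF₃.reg_eq rfl) hr₃.one (by omega)
        ⟨hF₃.mono.setReg, by simp [hsucc]⟩
    · rw [if_neg fun hc' => hc hc'.2] at hsucc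
      exact .skip ⟨hF₃.mono, by rw [hsucc, hF₃.reg_eq rfl, add_zero]⟩
  · have hu : d.2 ∉ range n \ X := by simpa [Cmp.holds, hfound, hr₂.zero, hun] using hc
    rw [if_neg fun hc' => hu hc'.1] at hsucc
    exact (Run.skip ⟨hF₂.mono, by rw [hsucc, hF₂.reg_eq rfl, add_zero]⟩).of_le (by omega)

/-- A bound on the number of steps that `countCore` needs for one of `M` darts. -/
def dartCost (n M N : ℕ) : ℕ := n * (M * (N * 12 + 35) + 7) + (N * 6 + 16) + 2

theorem countCore_run (h : Setting w inp n N G) (hr : Ready n X s) (hv : v ∈ range n \ X)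
    (hvertex : s.reg Reg.vertex = v) :
    Run w inp countCore s (#(positions inp v) * dartCost n (off inp n - off inp 0) N + 6)
      fun s' => Frame Reg.dart s s' ∧ s'.reg Reg.degree = coreDeg G (range n \ X) v := by
  have hvn : v < n := by simp_all
  have hoff := h.off_lt (i := v + 1) hvn
  have hcount := fun s₂ p => countDart_run (s := s₂) h (X := X) (d := (v, inp.getD p 0))
  rw [dartCost]
  generalize n * ((off inp n - off inp 0) * (N * 12 + 35) + 7) + (N * 6 + 16) = b at hcount ⊢
  refine Run.of_le (b := 4 + (1 + (∑ j ∈ Ico (off inp v) (off inp (v + 1)),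
    ((b + 1) + 1) + 1))) ?_ (by rw [sum_const, smul_eq_mul, positions]; lia)
  refine .bind (readRange_run h hr hvertex hvn) fun s₁ ⟨hF₁, hdart, hend⟩ => ?_
  have hr₁ := hr.frame hF₁
  refine .seq (.move hr₁.zero hr₁.one ?_)
  refine Run.loop_range (I := fun p s' => Frame Reg.dart s s' ∧ s'.reg Reg.dart = p ∧
    off inp v ≤ p ∧ s'.reg Reg.dartEnd = off inp (v + 1) ∧
    s'.reg Reg.degree = #(corePositions inp G (range n \ X) v p)) (fun _ => _) _ ?_ ?_
    (h.represents.off_le_succ v hvn)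
    ⟨hF₁.setReg, by simp [hdart], le_rfl, by simp [hend], by simp [corePositions]⟩
  · rintro _ s₂ hp ⟨hF₂, rfl, hle, hend, hdegree⟩
    refine ⟨by simpa [Cmp.holds, hend], ?_⟩
    refine .bind (hcount s₂ (s₂.reg Reg.dart) (hr.frame hF₂)
      ⟨hF₂.reg_eq hvertex, mem_positions.2 ⟨hle, hp⟩, rfl⟩ hv hdegree)
      fun s₃ ⟨hF₃, hdegree₃⟩ => ?_
    have hF := hF₂.trans hF₃.mono
    refine .add (hF₃.reg_eq rfl) (hr.frame hF).one (by omega) ?_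
    exact ⟨hF.setReg, by simp, by omega, by simpa using hF₃.reg_eq hend, by simpa using hdegree₃⟩
  · rintro s₂ ⟨hF₂, hdart, -, hend, hdegree⟩
    exact ⟨by simp [Cmp.holds, hdart, hend], hF₂,
      hdegree.trans (card_corePositions_off_succ h.represents hvn)⟩

end Degree

section FrameOn

/-- The states agree up to the registers in `L`, the registers with index at least `m`, and the
cells outside `A`. -/
structure FrameOn (A : Set ℕ) (L : List ℕ) (m : ℕ) (s s' : State) : Prop where
  mem : Set.EqOn s'.mem s.mem A
  top : s'.top = s.top
  reg : ∀ r < m, r ∉ L → s'.reg r = s.reg r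

variable {A : Set ℕ} {L : List ℕ} {m r v a : ℕ} {s s' s'' : State}

theorem Frame.frameOn (h : Frame m s s') : FrameOn A L m s s' :=
  ⟨fun _ _ => congrFun h.mem _, h.top, fun r hr _ => h.reg r hr⟩

theorem FrameOn.trans (h : FrameOn A L m s s') (h' : FrameOn A L m s' s'') :
    FrameOn A L m s s'' :=
  ⟨h'.mem.trans h.mem, h'.top.trans h.top, fun r hr hrL => (h'.reg r hr hrL).trans (h.reg r hr hrL)⟩

theorem FrameOn.mono {A' : Set ℕ} {L' : List ℕ} {m' : ℕ} (h : FrameOn A L m s s') (hA : A' ⊆ A)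
    (hL : L ⊆ L' := by decide) (hm : m' ≤ m := by decide) : FrameOn A' L' m' s s' :=
  ⟨h.mem.mono hA, h.top, fun r hr hrL => h.reg r (hr.trans_le hm) fun hr' => hrL (hL hr')⟩

theorem FrameOn.setReg (h : FrameOn A L m s s') (hr : m ≤ r ∨ r ∈ L := by decide) :
    FrameOn A L m s (s'.setReg r v) := by
  refine ⟨h.mem, h.top, fun r' hr' hrL => ?_⟩
  rw [State.reg_setReg, if_neg, h.reg r' hr' hrL]
  rintro rfl
  exact hr.elim (by omega) hrL

theorem FrameOn.setMem (h : FrameOn A L m s s') (ha : a ∉ A) : FrameOn A L m s (s'.setMem a v) :=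
  ⟨fun _ hx => (Function.update_of_ne (ne_of_mem_of_not_mem hx ha) _ _).trans (h.mem hx), h.top,
    h.reg⟩

theorem FrameOn.reg_eq (h : FrameOn A L m s s') (hv : s.reg r = v)
    (hr : r < m ∧ r ∉ L := by decide) : s'.reg r = v :=
  (h.reg r hr.1 hr.2).trans hv

theorem Ready.frameOn {n : ℕ} {X : Finset ℕ} (h : Ready n X s) (hF : FrameOn A L m s s')
    (hA : Set.Ico 0 #X ⊆ A)
    (hr : ∀ r ∈ Finset.Icc Reg.size Reg.two, r < m ∧ r ∉ L := by decide) : Ready n X s' where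
  size := hF.reg_eq h.size (hr _ (by decide))
  zero := hF.reg_eq h.zero (hr _ (by decide))
  one := hF.reg_eq h.one (hr _ (by decide))
  order := hF.reg_eq h.order (hr _ (by decide))
  two := hF.reg_eq h.two (hr _ (by decide))
  card_le_top := hF.top ▸ h.card_le_top
  strictMonoOn := h.strictMonoOn.congr (hF.mem.mono hA).symm
  image_mem := (image_congr fun a ha => hF.mem (hA (by simpa using ha))).trans h.image_mem
  subset := h.subset

end FrameOn

section Candidates

variable {w n c K B item : ℕ} {inp : List ℕ} {X S T : Finset ℕ} {s s' : State}

theorem bijOn_update_of_mem {f : ℕ → ℕ} {A T : Set ℕ} {a y : ℕ} (h : Set.BijOn f A T) (ha : a ∈ A)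
    (hy : y ∉ T) : Set.BijOn (Function.update f a y) A (insert y (T \ {f a})) := by
  have heq : Set.EqOn f (Function.update f a y) (A \ {a}) := fun _ hx =>
    (Function.update_of_ne hx.2 _ _).symm
  have hins := ((h.sdiff_singleton ha).congr heq).insert (a := a)
    (by rw [Function.update_self]; exact fun hy' => hy hy'.1)
  rwa [Function.update_self, Set.insert_sdiff_singleton, Set.insert_eq_of_mem ha] at hins

theorem bijOn_update_of_notMem {f : ℕ → ℕ} {A T : Set ℕ} {a y : ℕ} (h : Set.BijOn f A T)
    (ha : a ∉ A) (hy : y ∉ T) : Set.BijOn (Function.update f a y) (insert a A) (insert y T) := by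
  have heq : Set.EqOn f (Function.update f a y) A := fun _ hx =>
    (Function.update_of_ne (ne_of_mem_of_not_mem hx ha) _ _).symm
  have hins := (h.congr heq).insert (a := a) (by rwa [Function.update_self])
  rwa [Function.update_self] at hins

section Selection

variable {α : Type*} [DecidableEq α] {f : α → ℕ} {m : ℕ} {S T T' : Finset α} {x y : α}

theorem IsTopSelection.insert_of_card_lt (h : IsTopSelection f m S T) (hT : #T < m) :
    IsTopSelection f m (insert x S) (insert x T) := by
  obtain rfl := h.eq_or_card_eq.resolve_right hT.ne
  exact ⟨subset_rfl, (card_insert_le x T).trans hT, .inl rfl, fun z hz hz' => absurd hz hz'⟩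

theorem IsTopSelection.insert_of_forall_le (h : IsTopSelection f m S T)
    (hT' : insert y T' = insert x T) (hy : y ∉ T') (hcard : #T' = m) (hle : ∀ z ∈ T', f y ≤ f z) :
    IsTopSelection f m (insert x S) T' where
  subset := calc
    T' ⊆ insert x T := hT' ▸ subset_insert y T'
    _ ⊆ insert x S := insert_subset_insert x h.subset
  card_le := hcard.le
  eq_or_card_eq := .inr hcard
  le_of_notMem z hz hz' t ht := by
    have hyT : y ∈ insert x T := hT' ▸ mem_insert_self y T'
    have htT : t ∈ insert x T := hT' ▸ mem_insert_of_mem ht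
    by_cases hzT : z ∈ insert x T
    · obtain rfl : z = y := (mem_insert.1 (hT' ▸ hzT)).resolve_right hz'
      exact hle t ht
    · obtain ⟨hzx, hzT'⟩ := not_or.1 (mt mem_insert.2 hzT)
      have hzS := mem_of_mem_insert_of_ne hz hzx
      rcases mem_insert.1 htT with rfl | htT
      · have hyT := mem_of_mem_insert_of_ne hyT (ne_of_mem_of_not_mem ht hy).symm
        exact (h.le_of_notMem z hzS hzT' y hyT).trans (hle t ht)
      · exact h.le_of_notMem z hzS hzT' t htT

end Selection

/-- The cells from `Reg.base` on, `Reg.length` in number, list the `Reg.capacity` largest elements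
of `S`, or all of them if there are fewer. -/
structure Candidates (B K : ℕ) (S T : Finset ℕ) (s : State) : Prop where
  base : s.reg Reg.base = B
  capacity : s.reg Reg.capacity = K
  bijOn : Set.BijOn s.mem (Ico B (B + s.reg Reg.length)) T
  isTopSelection : IsTopSelection id K S T

theorem Candidates.length_eq (h : Candidates B K S T s) : s.reg Reg.length = #T := by
  rw [← h.bijOn.finsetCard_eq, Nat.card_Ico, Nat.add_sub_cancel_left]

theorem Candidates.frame {m : ℕ} (h : Candidates B K S T s) (hF : Frame m s s')
    (hm : Reg.length < m := by decide) : Candidates B K S T s' where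
  base := hF.reg_eq h.base (by simp_all; omega)
  capacity := hF.reg_eq h.capacity (by simp_all; omega)
  bijOn := by rw [hF.mem, hF.reg _ hm]; exact h.bijOn
  isTopSelection := h.isTopSelection

/-- Compare `Reg.item` with all the listed candidates in turn, each time exchanging it with the
candidate if that one is smaller. -/
def bubble : Prog :=
  .loop .lt Reg.pointer Reg.pointerEnd (
    .load Reg.word Reg.pointer ⨟
    .ite .lt Reg.word Reg.item
      (.store Reg.pointer Reg.item ⨟ .move Reg.item Reg.word) .skip ⨟
    .op .add Reg.pointer Reg.pointer Reg.one)

/-- The invariant of `bubble`, started in `s` with a list of the elements of `T`, while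
`Reg.pointer` is at `p`. -/
structure BubbleState (B c item : ℕ) (T : Finset ℕ) (s : State) (p : ℕ) (s' : State) : Prop where
  frameOn : FrameOn (Set.Iio B) [] Reg.pointer s s'
  pointer : s'.reg Reg.pointer = p
  pointerEnd : s'.reg Reg.pointerEnd = B + c
  exists_list : ∃ T' : Finset ℕ, Set.BijOn s'.mem (Ico B (B + c)) T' ∧ s'.reg Reg.item ∉ T' ∧
    insert (s'.reg Reg.item) T' = insert item T
  item_le : ∀ a ∈ Ico B p, s'.reg Reg.item ≤ s'.mem a

theorem BubbleState.step {p : ℕ} (hone : s.reg Reg.one = 1) (htop : B + c ≤ s.top)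
    (hw : B + c < 2 ^ w) (hBp : B ≤ p) (hp : p < B + c) (h : BubbleState B c item T s p s') :
    Run w inp (.load Reg.word Reg.pointer ⨟
      .ite .lt Reg.word Reg.item
        (.store Reg.pointer Reg.item ⨟ .move Reg.item Reg.word) .skip ⨟
      .op .add Reg.pointer Reg.pointer Reg.one) s' 5 (BubbleState B c item T s (p + 1)) := by
  obtain ⟨hF, hpointer, hend, ⟨T', hT', hnot, hins⟩, hle⟩ := h
  have hone' := hF.reg_eq hone
  have hle' : ∀ a ∈ Ico B (p + 1), a ≠ p → s'.reg Reg.item ≤ s'.mem a := fun a ha hap =>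
    hle a (by simp only [mem_Ico] at ha ⊢; omega)
  have hpA : p ∈ (Ico B (B + c) : Set ℕ) := by simp [hBp, hp]
  refine .seq (b₂ := 4) (.load (a := p) hpointer rfl (by rw [hF.top]; omega) ?_)
  refine .seq (b₁ := 3) (b₂ := 1) (.ite (b := 2) (fun hc => ?_) (fun hc => ?_)) <;>
    simp only [Cmp.holds, State.reg_setReg, reduceIte, not_lt,
      if_neg (by decide : Reg.item ≠ Reg.word)] at hc
  · refine .seq (b₂ := 1) (.store (a := p) (v := s'.reg Reg.item) (by simp [hpointer]) (by simp)
      (by rw [State.top_setReg, hF.top]; omega) ?_)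
    refine .move (a := s'.mem p) (by simp) (by simp [hone']) ?_
    refine .add (a := p) (c := 1) (by simp [hpointer]) (by simp [hone']) (by omega) ?_
    refine ⟨((hF.setReg.setMem (by simpa using hBp)).setReg).setReg, by simp, by simp [hend],
      ⟨insert (s'.reg Reg.item) (T'.erase (s'.mem p)), ?_, by simp [hc.ne], ?_⟩,
      fun a ha => ?_⟩
    · simpa using bijOn_update_of_mem hT' hpA hnot
    · simpa [insert_comm (s'.mem p), insert_erase (hT'.mapsTo hpA)] using hins
    · rcases eq_or_ne a p with rfl | hap
      · simpa using hc.le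
      · simpa [hap] using hc.le.trans (hle' a ha hap)
  · refine (Run.skip ?_).of_le (by omega)
    refine .add (a := p) (c := 1) (by simp [hpointer]) (by simp [hone']) (by omega) ?_
    refine ⟨hF.setReg.setReg, by simp, by simp [hend], ⟨T', hT', by simpa, by simpa⟩,
      fun a ha => ?_⟩
    rcases eq_or_ne a p with rfl | hap
    · simpa using hc
    · simpa using hle' a ha hap

theorem bubble_run (hone : s.reg Reg.one = 1) (htop : B + c ≤ s.top) (hw : B + c < 2 ^ w)
    (hpointer : s.reg Reg.pointer = B) (hend : s.reg Reg.pointerEnd = B + c)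
    (hT : Set.BijOn s.mem (Ico B (B + c)) T) (hitem : s.reg Reg.item ∉ T) :
    Run w inp bubble s (c * 6 + 1) (BubbleState B c (s.reg Reg.item) T s (B + c)) := by
  refine Run.loop_range_const (I := fun i => BubbleState B c (s.reg Reg.item) T s (B + i)) 5 c
    (fun i s' hi h => ⟨?_, h.step hone htop hw (B.le_add_right i) (Nat.add_lt_add_left hi B)⟩)
    (fun s' h => ⟨?_, h⟩)
    ⟨(Frame.refl _ _).frameOn, hpointer, hend, ⟨T, hT, hitem, rfl⟩, by simp⟩
  · simpa [Cmp.holds, h.pointer, h.pointerEnd]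
  · simp [Cmp.holds, h.pointer, h.pointerEnd]

/-- With `v` the content of `Reg.vertex` and `d` that of `Reg.degree`, offer `d * n + v` to the list
of candidates. -/
def addCandidate : Prog :=
  .op .mul Reg.item Reg.degree Reg.order ⨟ .op .add Reg.item Reg.item Reg.vertex ⨟
  .move Reg.pointer Reg.base ⨟ .op .add Reg.pointerEnd Reg.base Reg.length ⨟ bubble ⨟
  .ite .lt Reg.length Reg.capacity
    (.store Reg.pointerEnd Reg.item ⨟ .op .add Reg.length Reg.length Reg.one) .skip

theorem addCandidate_run {d v : ℕ} (hr : Ready n X s) (h : Candidates B K S T s)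
    (hdegree : s.reg Reg.degree = d) (hvertex : s.reg Reg.vertex = v) (hnot : d * n + v ∉ S)
    (htop : B + K ≤ s.top) (hw : B + K < 2 ^ w) (hw' : d * n + v < 2 ^ w) :
    Run w inp addCandidate s (K * 6 + 8) fun s' =>
      FrameOn (Set.Iio B) [Reg.length] Reg.pointer s s' ∧
        ∃ T', Candidates B K (insert (d * n + v) S) T' s' := by
  have hlength := h.length_eq
  obtain ⟨hbase, hcapacity, hT, hsel⟩ := h
  have hTK := hsel.card_le
  generalize hitem : d * n + v = item at *
  rw [hlength] at hT
  refine Run.of_le (b := 1 + (1 + (1 + (1 + ((#T * 6 + 1) + ((1 + 1) + 1)))))) ?_ (by omega)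
  refine .seq (.mul hdegree hr.order (by omega) ?_)
  refine .seq (.add (a := d * n) (c := v) (by simp) (by simp [hvertex]) (by omega) ?_)
  refine .seq (.move (a := B) (by simp [hbase]) (by simp [hr.one]) ?_)
  refine .seq (.add (a := B) (c := #T) (by simp [hbase]) (by simp [hlength]) (by omega) ?_)
  refine .bind (bubble_run (B := B) (c := #T) (T := T) (by simp [hr.one]) (by simp; omega)
    (by omega) (by simp) (by simp) hT (by simpa [hitem] using fun h' => hnot (hsel.subset h')))
    fun s₁ ⟨hF₁, _, hend, ⟨T', hT', hitem', hins⟩, hle⟩ => ?_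
  have hF : FrameOn (Set.Iio B) [Reg.length] Reg.pointer s s₁ :=
    (Frame.refl _ _).setReg.setReg.setReg.setReg.frameOn.trans (hF₁.mono subset_rfl)
  have hcard : #T' = #T := by rw [← hT'.finsetCard_eq, Nat.card_Ico, Nat.add_sub_cancel_left]
  have hlength₁ : s₁.reg Reg.length = #T := hF₁.reg_eq (by simp [hlength])
  have hcapacity₁ : s₁.reg Reg.capacity = K := hF₁.reg_eq (by simp [hcapacity])
  have hbase₁ : s₁.reg Reg.base = B := hF₁.reg_eq (by simp [hbase])
  have hone₁ : s₁.reg Reg.one = 1 := hF₁.reg_eq (by simp [hr.one])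
  have hins : insert (s₁.reg Reg.item) T' = insert item T := by simpa [hitem] using hins
  refine .ite (fun hc => ?_) (fun hc => ?_) <;>
    simp only [Cmp.holds, hlength₁, hcapacity₁, not_lt] at hc
  · refine .seq (.store hend rfl (by rw [hF.top]; omega) ?_)
    refine .add (a := #T) (c := 1) (by simp [hlength₁]) (by simp [hone₁]) (by omega) ?_
    refine ⟨(hF.setMem (by simp)).setReg, insert item T, by simp [hbase₁], by simp [hcapacity₁], ?_,
      hsel.insert_of_card_lt hc⟩
    have happend := bijOn_update_of_notMem (a := B + #T) hT' (by simp) hitem'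
    rw [← coe_insert, ← Nat.Ico_succ_right_eq_insert_Ico (B.le_add_right _), ← coe_insert, hins]
      at happend
    simpa [add_assoc] using happend
  · refine (Run.skip ⟨hF, T', hbase₁, hcapacity₁, by rwa [hlength₁], ?_⟩).of_le (by omega)
    refine hsel.insert_of_forall_le hins hitem' (by omega) fun y hy => ?_
    obtain ⟨a, ha, rfl⟩ := hT'.surjOn hy
    exact hle a (by simpa using ha)

end Candidates

section Insertion

variable {w n N c x q : ℕ} {inp : List ℕ} {f : ℕ → ℕ} {X : Finset ℕ} {s s' : State}

/-- The sequence `f` with its terms `p, …, c - 1` moved to the next larger index. -/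
def shiftFrom (f : ℕ → ℕ) (p c : ℕ) (a : ℕ) : ℕ := if p < a ∧ a ≤ c then f (a - 1) else f a

theorem update_shiftFrom_succ {p : ℕ} (hp : p < c) :
    Function.update (shiftFrom f (p + 1) c) (p + 1) (f p) = shiftFrom f p c := by
  funext a
  rcases eq_or_ne a (p + 1) with rfl | ha
  · simp [shiftFrom, hp]
  · rw [Function.update_of_ne ha, shiftFrom, shiftFrom]
    exact if_congr (by omega) rfl rfl

theorem shiftFrom_self : shiftFrom f c c = f := funext fun _ => if_neg (by omega)

/-- The sequence `f` with `x` inserted before its term `q`, if `c` is the number of its terms. -/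
def insertAt (f : ℕ → ℕ) (c q x : ℕ) : ℕ → ℕ := Function.update (shiftFrom f q c) q x

theorem insertAt_apply (a : ℕ) : insertAt f c q x a =
    if a < q then f a else if a = q then x else if a ≤ c then f (a - 1) else f a := by
  simp only [insertAt, shiftFrom, Function.update_apply]
  split_ifs <;> first | rfl | omega

theorem Brackets.lt_of_notMem (h : Brackets f 0 c x q q) (hx : x ∉ f '' Set.Ico 0 c) :
    ∀ a, q ≤ a → a < c → x < f a := fun a hqa hac =>
  (h.le_of_le a hqa hac).lt_of_ne fun heq => hx ⟨a, ⟨a.zero_le, hac⟩, heq.symm⟩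

theorem Brackets.strictMonoOn_insertAt (h : Brackets f 0 c x q q)
    (hf : StrictMonoOn f (Set.Ico 0 c)) (hx : x ∉ f '' Set.Ico 0 c) :
    StrictMonoOn (insertAt f c q x) (Set.Ico 0 (c + 1)) := by
  have hqc := h.le_hi
  have hlt : ∀ i < q, f i < x := fun i => h.lt_of_lt i i.zero_le
  have hgt := h.lt_of_notMem hx
  rintro a - b ⟨-, hb⟩ hab
  have hmono : ∀ i j, i < j → j < c → f i < f j := fun i j hij hj =>
    hf ⟨i.zero_le, hij.trans hj⟩ ⟨j.zero_le, hj⟩ hij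
  simp only [insertAt_apply]
  rcases lt_trichotomy a q with ha | rfl | ha
  · rw [if_pos ha]
    split_ifs
    exacts [hmono a b hab (by omega), hlt a ha, (hlt a ha).trans (hgt _ (by omega) (by omega)),
      by omega]
  · rw [if_neg a.lt_irrefl, if_pos rfl, if_neg (by omega), if_neg (by omega), if_pos (by omega)]
    exact hgt _ (by omega) (by omega)
  · rw [if_neg (by omega), if_neg (by omega), if_pos (by omega), if_neg (by omega),
      if_neg (by omega), if_pos (by omega)]
    exact hmono _ _ (by omega) (by omega)

theorem Brackets.image_insertAt (h : Brackets f 0 c x q q) :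
    (range (c + 1)).image (insertAt f c q x) = insert x ((range c).image f) := by
  have hqc := h.le_hi
  ext y
  simp only [mem_image, mem_range, mem_insert, insertAt_apply]
  refine ⟨fun ⟨a, ha, hay⟩ => ?_, ?_⟩
  · split_ifs at hay with h₁ h₂ h₃
    exacts [.inr ⟨a, by omega, hay⟩, .inl hay.symm, .inr ⟨a - 1, by omega, hay⟩,
      absurd (Nat.le_of_lt_succ ha) h₃]
  · rintro (rfl | ⟨a, ha, rfl⟩)
    · exact ⟨q, by omega, by simp⟩
    · by_cases haq : a < q
      · exact ⟨a, by omega, if_pos haq⟩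
      · exact ⟨a + 1, by omega, by grind⟩

/-- Move the cells from `Reg.low` up to, but not including `Reg.size`, to the next larger
address. -/
def makeRoom : Prog :=
  .move Reg.middle Reg.size ⨟
  .loop .lt Reg.low Reg.middle (
    .op .sub Reg.address Reg.middle Reg.one ⨟ .load Reg.word Reg.address ⨟
    .store Reg.middle Reg.word ⨟ .move Reg.middle Reg.address)

/-- The invariant of `makeRoom`, started in `s`, when the `fuel` cells from `q` on are still to be
moved. -/
structure ShiftState (c q : ℕ) (s : State) (fuel : ℕ) (s' : State) : Prop where
  top : s'.top = s.top
  reg : ∀ r < Reg.middle, s'.reg r = s.reg r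
  middle : s'.reg Reg.middle = q + fuel
  le : q + fuel ≤ c
  mem : s'.mem = shiftFrom s.mem (q + fuel) c

theorem ShiftState.step {fuel : ℕ} (hone : s.reg Reg.one = 1) (htop : c < s.top)
    (hw : c < 2 ^ w) (h : ShiftState c q s (fuel + 1) s') :
    Run w inp (.op .sub Reg.address Reg.middle Reg.one ⨟ .load Reg.word Reg.address ⨟
      .store Reg.middle Reg.word ⨟ .move Reg.middle Reg.address) s' 4 (ShiftState c q s fuel) := by
  obtain ⟨htop', hreg, hmiddle, hle, hmem⟩ := h
  have hone' : s'.reg Reg.one = 1 := (hreg _ (by decide)).trans hone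
  refine .seq (b₂ := 3) (.sub hmiddle hone' (by omega) (by omega) ?_)
  refine .seq (b₂ := 2) (.load (a := q + fuel) (v := s.mem (q + fuel)) (by simp) ?_
    (by rw [State.top_setReg]; omega) ?_)
  · simp [hmem, shiftFrom]
  refine .seq (b₂ := 1) (.store (a := q + fuel + 1) (v := s.mem (q + fuel))
    (by simp [hmiddle, add_assoc]) (by simp) (by simp only [State.top_setReg]; omega) ?_)
  refine .move (a := q + fuel) (by simp) (by simp [hone']) ?_
  refine ⟨htop', fun r hr => ?_, by simp, by omega, ?_⟩
  · have := hr.trans (by decide : Reg.middle < Reg.word)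
    have := hr.trans (by decide : Reg.middle < Reg.address)
    simp only [State.reg_setReg, State.reg_setMem]
    rw [if_neg (by omega), if_neg (by omega), if_neg (by omega), hreg r hr]
  · simp only [State.mem_setReg, State.mem_setMem, hmem]
    exact update_shiftFrom_succ hle

theorem makeRoom_run (hone : s.reg Reg.one = 1) (hlow : s.reg Reg.low = q)
    (hsize : s.reg Reg.size = c) (hqc : q ≤ c) (htop : c < s.top) (hw : c < 2 ^ w) :
    Run w inp makeRoom s (c * 5 + 2) (ShiftState c q s 0) := by
  refine Run.of_le (b := 1 + ((c - q) * 5 + 1)) ?_ (by omega)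
  refine .seq (.move hsize hone ?_)
  refine Run.loop (I := ShiftState c q s) 4 (fun fuel s' h hc => ?_) (fun fuel s' h hc => ?_)
    ⟨rfl, fun r hr => ?_, by simp [hqc], by omega, ?_⟩
  · cases fuel with
    | zero => simp [Cmp.holds, h.middle, h.reg Reg.low (by decide), hlow] at hc
    | succ fuel => exact ⟨fuel, rfl, h.step hone htop hw⟩
  · obtain rfl : fuel = 0 := by
      simpa [Cmp.holds, h.middle, h.reg Reg.low (by decide), hlow] using hc
    exact h
  · rw [State.reg_setReg, if_neg hr.ne]
  · rw [Nat.add_sub_cancel' hqc, shiftFrom_self, State.mem_setReg]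

/-- Insert `Reg.query` into the stored set. -/
def insertVertex : Prog :=
  locate ⨟ makeRoom ⨟ .store Reg.low Reg.query ⨟ .op .add Reg.size Reg.size Reg.one

theorem Ready.insertAt (h : Ready n X s) (hB : Brackets s.mem 0 #X x q q) (hx : x < n)
    (hxX : x ∉ X) (hmem : s'.mem = insertAt s.mem #X q x) (htop : #X < s'.top)
    (hsize : s'.reg Reg.size = #X + 1)
    (hreg : ∀ r ∈ Finset.Icc Reg.zero Reg.two, s'.reg r = s.reg r) : Ready n (insert x X) s' where
  size := by rw [hsize, card_insert_of_notMem hxX]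
  zero := (hreg _ (by decide)).trans h.zero
  one := (hreg _ (by decide)).trans h.one
  order := (hreg _ (by decide)).trans h.order
  two := (hreg _ (by decide)).trans h.two
  card_le_top := by rwa [card_insert_of_notMem hxX]
  strictMonoOn := by
    rw [card_insert_of_notMem hxX, hmem]
    exact hB.strictMonoOn_insertAt h.strictMonoOn (mt h.mem_iff.2 hxX)
  image_mem := by rw [card_insert_of_notMem hxX, hmem, hB.image_insertAt, h.image_mem]
  subset := insert_subset (mem_range.2 hx) h.subset

theorem insertVertex_run (h : Ready n X s) (hquery : s.reg Reg.query = x) (hx : x < n)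
    (hxX : x ∉ X) (htop : #X < s.top) (hN : n < 2 ^ N) (hw : 2 * n + 2 < 2 ^ w) :
    Run w inp insertVertex s (N * 6 + n * 5 + 8) fun s' =>
      FrameOn (Set.Ioi #X) [Reg.size] Reg.low s s' ∧ Ready n (insert x X) s' := by
  have hXn := h.card_le
  refine Run.of_le (b := (N * 6 + 4) + ((#X * 5 + 2) + (1 + 1))) ?_ (by omega)
  refine .bind (locate_run h hquery hN (by omega)) fun s₁ ⟨hF, hB⟩ => ?_
  have hqX := hB.le_hi
  generalize hq : s₁.reg Reg.low = q at *
  refine .bind (makeRoom_run (hF.reg_eq h.one) hq (hF.reg_eq h.size) hqX (hF.top ▸ htop)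
    (by omega)) fun s₂ hs => ?_
  have hreg : ∀ r < Reg.low, s₂.reg r = s.reg r := fun r hr =>
    (hs.reg r (hr.trans (by decide))).trans (hF.reg r hr)
  have htop₂ := hs.top.trans hF.top
  refine .seq (.store (a := q) (v := x) ((hs.reg _ (by decide)).trans hq)
    ((hreg _ (by decide)).trans hquery) (by omega) ?_)
  refine .add (a := #X) (c := 1) ((hreg _ (by decide)).trans h.size)
    ((hreg _ (by decide)).trans h.one) (by omega) ?_
  have hmem : Function.update s₂.mem q x = ROWordRAM.insertAt s.mem #X q x := by
    rw [hs.mem, hF.mem, insertAt, add_zero]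
  refine ⟨⟨fun a ha => ?_, htop₂, fun r hr hrL => ?_⟩,
    h.insertAt hB hx hxX hmem (htop₂ ▸ htop) (by simp) fun r hr => ?_⟩
  · rw [State.mem_setReg, State.mem_setMem, hmem, insertAt_apply]
    have : #X < a := ha
    rw [if_neg (by omega), if_neg (by omega), if_neg (by omega)]
  · rw [State.reg_setReg, if_neg (by simpa using hrL)]
    exact hreg r hr
  · have hr' : ∀ r ∈ Finset.Icc Reg.zero Reg.two, r ≠ Reg.size ∧ r < Reg.low := by decide
    rw [State.reg_setReg, if_neg (hr' r hr).1]
    exact hreg r (hr' r hr).2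

end Insertion

section Codes

variable {α β : Type*} [DecidableEq β] {f f' : α → ℕ} {m n v : ℕ} {S : Finset α}
  {G : SimpleGraph ℕ} {W : Finset ℕ}

theorem IsTopSelection.exists_of_image {e : β → ℕ} {g : α → β} {E : Finset β}
    (h : IsTopSelection e m (S.image g) E) (hg : Set.InjOn g S) :
    ∃ T, T.image g = E ∧ IsTopSelection (e ∘ g) m S T := by
  obtain ⟨T, hTS, rfl⟩ := subset_image_iff.1 h.subset
  have hcard : #(T.image g) = #T := card_image_of_injOn (hg.mono hTS)
  refine ⟨T, rfl, hTS, hcard ▸ h.card_le, h.eq_or_card_eq.imp (fun heq => ?_) hcard.symm.trans,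
    fun x hx hxT y hy => ?_⟩
  · refine hTS.antisymm fun x hx => ?_
    obtain ⟨y, hy, hyx⟩ := mem_image.1 (heq ▸ mem_image_of_mem g hx)
    rwa [← hg (hTS hy) hx hyx]
  · refine h.le_of_notMem _ (mem_image_of_mem g hx) (fun hx' => hxT ?_) _ (mem_image_of_mem g hy)
    obtain ⟨z, hz, hzx⟩ := mem_image.1 hx'
    rwa [← hg (hTS hz) hx hzx]

theorem IsTopSelection.of_monotone {T : Finset α} (h : IsTopSelection f m S T)
    (hf : ∀ x ∈ S, ∀ y ∈ S, f x ≤ f y → f' x ≤ f' y) : IsTopSelection f' m S T :=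
  ⟨h.subset, h.card_le, h.eq_or_card_eq, fun x hx hxT y hy =>
    hf x hx y (h.subset hy) (h.le_of_notMem x hx hxT y hy)⟩

/-- The number that stands for the vertex `v` in the list of candidates: codes are ordered by core
degree, and `v` is the remainder modulo `n`. -/
noncomputable def code (G : SimpleGraph ℕ) (W : Finset ℕ) (n v : ℕ) : ℕ := coreDeg G W v * n + v

theorem code_mod (hv : v < n) : code G W n v % n = v := by
  rw [code, Nat.mul_add_mod_self_right, Nat.mod_eq_of_lt hv]

theorem code_div (hv : v < n) : code G W n v / n = coreDeg G W v := by
  rw [code, add_comm, Nat.add_mul_div_right _ _ (by omega), Nat.div_eq_of_lt hv, Nat.zero_add]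

theorem injOn_code (hW : W ⊆ range n) : Set.InjOn (code G W n) W := fun u hu v hv huv => by
  rw [← code_mod (G := G) (W := W) (mem_range.1 (hW hu)), huv, code_mod (mem_range.1 (hW hv))]

theorem exists_isTopSelection_of_codes {E : Finset ℕ} (hW : W ⊆ range n)
    (hE : IsTopSelection id m ((core G W).image (code G W n)) E) :
    ∃ T : Finset ℕ, Set.BijOn (· % n) E T ∧ IsTopSelection (degIn G (core G W)) m (core G W) T := by
  have hlt : ∀ v ∈ core G W, v < n := fun v hv => mem_range.1 (hW (core_subset hv))
  obtain ⟨T, rfl, hT⟩ := hE.exists_of_image ((injOn_code hW).mono core_subset)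
  refine ⟨T, ?_, hT.of_monotone fun x hx y hy hxy => ?_⟩
  · have hmod : ∀ v ∈ T, code G W n v % n = v := fun v hv => code_mod (hlt v (hT.subset hv))
    refine ⟨?_, ?_, fun v hv => ⟨_, mem_coe.2 (mem_image_of_mem _ hv), hmod v hv⟩⟩
    · intro e he
      obtain ⟨v, hv, rfl⟩ := mem_image.1 he
      simpa [hmod v hv] using hv
    · intro e he e' he' hee'
      obtain ⟨v, hv, rfl⟩ := mem_image.1 he
      obtain ⟨v', hv', rfl⟩ := mem_image.1 he'
      rw [show v = v' by simpa [hmod v hv, hmod v' hv'] using hee']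
  · rw [← coreDeg_eq_degIn_core hx, ← coreDeg_eq_degIn_core hy, ← code_div (hlt x hx),
      ← code_div (hlt y hy)]
    exact Nat.div_le_div_right hxy

end Codes

section Collect

variable {w n N K B v : ℕ} {inp : List ℕ} {G : SimpleGraph ℕ} {W X : Finset ℕ} {s s' : State}

/-- The vertices of the core that are smaller than `i`, which are those that `collect` has
treated when `Reg.vertex` is `i`. -/
noncomputable def coreBelow (G : SimpleGraph ℕ) (W : Finset ℕ) (i : ℕ) : Finset ℕ :=
  {v ∈ core G W | v < i}

theorem coreBelow_succ_of_mem (hv : v ∈ core G W) :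
    coreBelow G W (v + 1) = insert v (coreBelow G W v) := by
  ext u
  simp only [coreBelow, mem_filter, mem_insert, Nat.lt_succ_iff_lt_or_eq]
  grind

theorem coreBelow_succ_of_notMem (hv : v ∉ core G W) :
    coreBelow G W (v + 1) = coreBelow G W v := by
  ext u
  simp only [coreBelow, mem_filter, Nat.lt_succ_iff_lt_or_eq]
  grind

theorem coreBelow_eq_core (hW : W ⊆ range n) : coreBelow G W n = core G W :=
  filter_true_of_mem fun _ hv => mem_range.1 (hW (core_subset hv))

theorem code_notMem_image_coreBelow (hW : W ⊆ range n) (hv : v ∈ W) :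
    code G W n v ∉ (coreBelow G W v).image (code G W n) := by
  intro hmem
  obtain ⟨u, hu, huv⟩ := mem_image.1 hmem
  obtain ⟨hu, huv'⟩ := mem_filter.1 hu
  exact huv'.ne (injOn_code hW (core_subset hu) hv huv)

theorem code_lt_two_pow (h : Setting w inp n N G) (hv : v < n) : code G W n v < 2 ^ w := by
  have hdeg := Nat.mul_le_mul_right n (coreDeg_le h.represents hv (W := W))
  have hlarge := h.mul_le_two_pow
  rw [code]
  nlinarith

/-- Offer the vertex `Reg.vertex`, which is not in the stored set, as a candidate if it is in the
core. -/
def offerVertex : Prog :=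
  countCore ⨟ .ite .le Reg.two Reg.degree (.const Reg.answer 1 ⨟ addCandidate) .skip

/-- Make the list of candidates, and set `Reg.answer` to `0` exactly if the core is empty. -/
def collect : Prog :=
  .move Reg.length Reg.zero ⨟ .move Reg.answer Reg.zero ⨟ .move Reg.vertex Reg.zero ⨟
  .loop .lt Reg.vertex Reg.order (
    .move Reg.query Reg.vertex ⨟ member ⨟
    .ite .eq Reg.found Reg.zero offerVertex .skip ⨟
    .op .add Reg.vertex Reg.vertex Reg.one)

/-- What `collect`, started in `s`, has achieved when the vertices smaller than `i` are treated. -/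
structure CollectState (G : SimpleGraph ℕ) (W : Finset ℕ) (n B K : ℕ) (s : State) (i : ℕ)
    (s' : State) : Prop where
  frameOn : FrameOn (Set.Iio B) [Reg.answer, Reg.length] Reg.vertex s s'
  answer : s'.reg Reg.answer = 0 ↔ coreBelow G W i = ∅
  candidates : ∃ E, Candidates B K ((coreBelow G W i).image (code G W n)) E s'

theorem CollectState.frame {i : ℕ} {s'' : State} (h : CollectState G W n B K s i s')
    (hF : Frame Reg.vertex s' s'') : CollectState G W n B K s i s'' where
  frameOn := h.frameOn.trans hF.frameOn
  answer := by rw [hF.reg _ (by decide), h.answer]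
  candidates := h.candidates.imp fun _ hE => hE.frame hF

theorem offerVertex_run (h : Setting w inp n N G) (hr : Ready n X s') (hv : v ∈ range n \ X)
    (hvertex : s'.reg Reg.vertex = v) (hs : CollectState G (range n \ X) n B K s v s')
    (hXB : #X ≤ B) (htop : B + K ≤ s'.top) (hw : B + K < 2 ^ w) :
    Run w inp offerVertex s'
      (#(positions inp v) * dartCost n (off inp n - off inp 0) N + (K * 6 + 16))
      fun s'' => s''.reg Reg.vertex = v ∧ CollectState G (range n \ X) n B K s (v + 1) s'' := by
  set W := range n \ X with hW
  have hWn : W ⊆ range n := sdiff_subset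
  have hvn : v < n := mem_range.1 (hWn hv)
  have hcode := code_lt_two_pow (W := W) h hvn
  have hone : 1 < 2 ^ w := by have := h.linear_lt; omega
  have hcount := countCore_run h hr hv hvertex
  generalize #(positions inp v) * dartCost n (off inp n - off inp 0) N = b at hcount ⊢
  refine Run.of_le (b := b + 6 + ((1 + (K * 6 + 8)) + 1)) ?_ (by omega)
  refine .bind hcount fun s₁ ⟨hF, hdegree⟩ => ?_
  have hr₁ := hr.frame hF
  have hs₁ := hs.frame (hF.mono)
  have hvertex₁ : s₁.reg Reg.vertex = v := hF.reg_eq hvertex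
  rw [← hW] at hdegree
  refine .ite (fun hc => ?_) (fun hc => ?_) <;>
    simp only [Cmp.holds, hr₁.two, hdegree] at hc
  · have hvcore : v ∈ core G W := mem_core.2 ⟨hv, hc⟩
    obtain ⟨E, hE⟩ := hs₁.candidates
    have hF₁ : FrameOn (Set.Iio B) [Reg.answer, Reg.length] Reg.vertex s₁
        (s₁.setReg Reg.answer 1) := (Frame.refl Reg.vertex s₁).frameOn.setReg
    refine .seq (.const hone ?_)
    refine (addCandidate_run (d := coreDeg G W v) (v := v)
      (hr₁.frameOn hF₁ fun a ha => ha.2.trans_le hXB)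
      (S := (coreBelow G W v).image (code G W n)) (T := E) (K := K) (B := B)
      ⟨by simp [hE.base], by simp [hE.capacity], by simpa using hE.bijOn, hE.isTopSelection⟩
      (by simp [hdegree]) (by simp [hvertex₁])
      (code_notMem_image_coreBelow hWn hv) (by simpa [hF.top] using htop) hw hcode).imp
      fun s₂ ⟨hF₂, hE₂⟩ => ⟨hF₂.reg_eq (by simp [hvertex₁]), ?_, ?_, ?_⟩
    · exact (hs₁.frameOn.trans hF₁).trans (hF₂.mono subset_rfl)
    · rw [hF₂.reg_eq (v := 1) (by simp), coreBelow_succ_of_mem hvcore]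
      simp
    · rwa [coreBelow_succ_of_mem hvcore, image_insert]
  · have hvcore : v ∉ core G W := fun hv' => hc (mem_core.1 hv').2
    refine (Run.skip ⟨hvertex₁, ?_⟩).of_le (by omega)
    exact ⟨hs₁.frameOn, coreBelow_succ_of_notMem hvcore ▸ hs₁.answer,
      coreBelow_succ_of_notMem hvcore ▸ hs₁.candidates⟩

theorem CollectState.step (h : Setting w inp n N G) (hr : Ready n X s) (hXB : #X ≤ B)
    (htop : B + K ≤ s.top) (hw : B + K < 2 ^ w) (hv : v < n) (hvertex : s'.reg Reg.vertex = v)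
    (hs : CollectState G (range n \ X) n B K s v s') :
    Run w inp (.move Reg.query Reg.vertex ⨟ member ⨟
      .ite .eq Reg.found Reg.zero offerVertex .skip ⨟
      .op .add Reg.vertex Reg.vertex Reg.one) s'
      (#(positions inp v) * dartCost n (off inp n - off inp 0) N + (N * 6 + K * 6 + 28))
      fun s'' => s''.reg Reg.vertex = v + 1 ∧
        CollectState G (range n \ X) n B K s (v + 1) s'' := by
  have hl := h.linear_lt
  have hr₁ : Ready n X s' := hr.frameOn hs.frameOn fun a ha => ha.2.trans_le hXB
  have hoffer := fun s₂ => offerVertex_run (s' := s₂) (X := X) (B := B) (K := K) (s := s) (v := v) h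
  generalize #(positions inp v) * dartCost n (off inp n - off inp 0) N = b at hoffer ⊢
  refine Run.of_le (b := 1 + ((N * 6 + 9) + ((b + (K * 6 + 16) + 1) + 1))) ?_ (by omega)
  refine .seq (.move hvertex hr₁.one ?_)
  have hF₁ : Frame Reg.query s' (s'.setReg Reg.query v) := (Frame.refl _ _).setReg
  refine .bind (member_run (x := v) (hr₁.frame hF₁) (by simp) h.lt_two_pow (by omega))
    fun s₂ ⟨hF₂, _, hfound⟩ => ?_
  have hF : Frame Reg.found s' s₂ := hF₁.mono.trans hF₂
  have hr₂ := hr₁.frame hF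
  have hs₂ := hs.frame hF.mono
  have hvertex₂ := hF.reg_eq hvertex
  refine .bind (b₂ := 1) (Q' := fun s₃ => s₃.reg Reg.vertex = v ∧
      CollectState G (range n \ X) n B K s (v + 1) s₃)
    (.ite (fun hc => ?_) (fun hc => ?_)) fun s₃ ⟨hvertex₃, hs₃⟩ => ?_
  · have hvX : v ∉ X := by simpa [Cmp.holds, hr₂.zero, hfound] using hc
    exact hoffer s₂ hr₂ (by simp [hv, hvX]) hvertex₂ hs₂ hXB (by rwa [hs₂.frameOn.top]) hw
  · have hvX : v ∈ X := by simpa [Cmp.holds, hr₂.zero, hfound] using hc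
    have hvcore : v ∉ core G (range n \ X) := fun hv' => (mem_sdiff.1 (core_subset hv')).2 hvX
    refine (Run.skip ⟨hvertex₂, ?_⟩).of_le (by omega)
    exact ⟨hs₂.frameOn, coreBelow_succ_of_notMem hvcore ▸ hs₂.answer,
      coreBelow_succ_of_notMem hvcore ▸ hs₂.candidates⟩
  · refine .add hvertex₃ (hs₃.frameOn.reg_eq hr.one) (by omega) ⟨by simp, hs₃.frame ?_⟩
    exact (Frame.refl _ _).setReg

/-- A bound for the running time of `collect` if there are `M` darts and `n < 2 ^ N`. -/
def collectCost (n M N K : ℕ) : ℕ := M * dartCost n M N + n * (N * 6 + K * 6 + 29) + 4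

theorem collect_run (h : Setting w inp n N G) (hr : Ready n X s) (hbase : s.reg Reg.base = B)
    (hcapacity : s.reg Reg.capacity = K) (hXB : #X ≤ B) (htop : B + K ≤ s.top)
    (hw : B + K < 2 ^ w) :
    Run w inp collect s (collectCost n (off inp n - off inp 0) N K) fun s' =>
      FrameOn (Set.Iio B) [Reg.answer, Reg.length] Reg.vertex s s' ∧
      (s'.reg Reg.answer = 0 ↔ core G (range n \ X) = ∅) ∧
      ∃ E, Candidates B K
        ((core G (range n \ X)).image (code G (range n \ X) n)) E s' := by
  have hstep := fun v s' => CollectState.step (v := v) (s' := s') (K := K) h hr hXB htop hw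
  have hsum := h.represents.off_add_sum_card_positions le_rfl
  rw [collectCost]
  generalize dartCost n (off inp n - off inp 0) N = D at hstep ⊢
  refine Run.of_le (b := 1 + (1 + (1 + (∑ v ∈ Ico 0 n,
    (#(positions inp v) * D + (N * 6 + K * 6 + 28) + 1) + 1)))) ?_ ?_
  rotate_left
  · have hM : off inp n - off inp 0 = ∑ v ∈ range n, #(positions inp v) := by omega
    simp only [sum_add_distrib, ← sum_mul, Nat.Ico_zero_eq_range, sum_const, card_range,
      smul_eq_mul, hM]
    lia
  refine .seq (.move hr.zero hr.one ?_)
  refine .seq (.move (a := 0) (by simp [hr.zero]) (by simp [hr.one]) ?_)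
  refine .seq (.move (a := 0) (by simp [hr.zero]) (by simp [hr.one]) ?_)
  refine Run.loop_range (I := fun v s' => s'.reg Reg.vertex = v ∧
    CollectState G (range n \ X) n B K s v s') _ n
    (fun v s' hv ⟨hvertex, hs⟩ => ⟨?_, hstep v s' hv hvertex hs⟩)
    (fun s' ⟨hvertex, hs⟩ => ⟨?_, hs.frameOn, ?_, ?_⟩) n.zero_le
    ⟨by simp, (Frame.refl _ _).frameOn.setReg.setReg.setReg, by simp [coreBelow], ∅,
      by simp [hbase], by simp [hcapacity], by simp, by simp [coreBelow], by simp,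
      .inl (by simp [coreBelow]), by simp [coreBelow]⟩
  · simpa [Cmp.holds, hvertex, hs.frameOn.reg_eq hr.order]
  · simp [Cmp.holds, hvertex, hs.frameOn.reg_eq hr.order]
  · rw [← coreBelow_eq_core sdiff_subset, hs.answer]
  · rw [← coreBelow_eq_core (G := G) sdiff_subset]
    exact hs.candidates

end Collect

section InsertAll

variable {w n N B c p : ℕ} {inp : List ℕ} {G : SimpleGraph ℕ} {X T : Finset ℕ} {s s' : State}

/-- Insert all candidates into the stored set. -/
def insertAll : Prog :=
  .move Reg.pointer Reg.base ⨟ .op .add Reg.pointerEnd Reg.base Reg.length ⨟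
  .loop .lt Reg.pointer Reg.pointerEnd (
    .load Reg.query Reg.pointer ⨟ .op .mod Reg.query Reg.query Reg.order ⨟ insertVertex ⨟
    .op .add Reg.pointer Reg.pointer Reg.one)

/-- The invariant of `insertAll`, started in `s`, while `Reg.pointer` is at `p`. -/
structure InsertState (n B c : ℕ) (X : Finset ℕ) (s : State) (p : ℕ) (s' : State) : Prop where
  frameOn : FrameOn (Set.Ici B) [Reg.size] Reg.pointer s s'
  pointer : s'.reg Reg.pointer = p
  pointerEnd : s'.reg Reg.pointerEnd = B + c
  ready : Ready n (X ∪ (Ico B p).image (s.mem · % n)) s'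

theorem InsertState.step (h : Setting w inp n N G) (hXB : #X + c ≤ B) (htop : B + c ≤ s.top)
    (hw : B + c < 2 ^ w) (hT : Set.BijOn (s.mem · % n) (Ico B (B + c)) T)
    (hTX : T ⊆ range n \ X) (hBp : B ≤ p) (hp : p < B + c) (hs : InsertState n B c X s p s') :
    Run w inp (.load Reg.query Reg.pointer ⨟ .op .mod Reg.query Reg.query Reg.order ⨟
      insertVertex ⨟ .op .add Reg.pointer Reg.pointer Reg.one) s' (N * 6 + n * 5 + 11)
      (InsertState n B c X s (p + 1)) := by
  obtain ⟨hF, hpointer, hend, hr⟩ := hs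
  set Y := X ∪ (Ico B p).image (s.mem · % n) with hY
  have hl := h.linear_lt
  have hpT : s.mem p % n ∈ range n \ X := hTX (hT.mapsTo (by simp [hBp, hp]))
  simp only [mem_sdiff, mem_range] at hpT
  have hYB : #Y < B := by
    have hcard := (card_union_le X _).trans
      (Nat.add_le_add_left (card_image_le (s := Ico B p) (f := (s.mem · % n))) #X)
    rw [Nat.card_Ico, ← hY] at hcard
    omega
  have hnot : s.mem p % n ∉ Y := by
    refine fun hmem => (mem_union.1 hmem).elim hpT.2 fun hmem => ?_
    obtain ⟨q, hq, hqp⟩ := mem_image.1 hmem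
    rw [mem_Ico] at hq
    have heq := hT.injOn (by simp; omega) (by simp; omega) hqp
    omega
  have hmem : s'.mem p = s.mem p := hF.mem hBp
  refine Run.of_le (b := 1 + (1 + ((N * 6 + n * 5 + 8) + 1))) ?_ (by omega)
  refine .seq (.load hpointer hmem (by rw [hF.top]; omega) ?_)
  refine .seq (.mod (a := s.mem p) (c := n) (by simp) (by simp [hr.order]) ?_)
  have hF₁ : Frame Reg.query s'
      ((s'.setReg Reg.query (s.mem p)).setReg Reg.query (s.mem p % n)) :=
    (Frame.refl _ _).setReg.setReg
  refine .bind (insertVertex_run (hr.frame hF₁) (by simp) hpT.1 hnot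
    (by rw [hF₁.top, hF.top]; omega) h.lt_two_pow (by omega)) fun s₂ ⟨hF₂, hr₂⟩ => ?_
  have hF' : FrameOn (Set.Ici B) [Reg.size] Reg.query s' s₂ :=
    hF₁.frameOn.trans (hF₂.mono fun a ha => hYB.trans_le ha)
  refine .add (hF'.reg_eq hpointer) hr₂.one (by omega) ?_
  refine ⟨(hF.trans (hF'.mono subset_rfl)).setReg, by simp, by simp [hF'.reg_eq hend], ?_⟩
  rw [Nat.Ico_succ_right_eq_insert_Ico hBp, image_insert, union_insert]
  exact hr₂.frame (m := Reg.pointer) (Frame.refl _ _).setReg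

theorem insertAll_run (h : Setting w inp n N G) (hr : Ready n X s) (hbase : s.reg Reg.base = B)
    (hlength : s.reg Reg.length = c) (hXB : #X + c ≤ B) (htop : B + c ≤ s.top)
    (hw : B + c < 2 ^ w) (hT : Set.BijOn (s.mem · % n) (Ico B (B + c)) T)
    (hTX : T ⊆ range n \ X) :
    Run w inp insertAll s (c * (N * 6 + n * 5 + 12) + 3) fun s' =>
      FrameOn (Set.Ici B) [Reg.size] Reg.pointer s s' ∧ Ready n (X ∪ T) s' := by
  refine Run.of_le (b := 1 + (1 + (c * (N * 6 + n * 5 + 11 + 1) + 1))) ?_ (by lia)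
  refine .seq (.move hbase hr.one ?_)
  refine .seq (.add (a := B) (c := c) (by simp [hbase]) (by simp [hlength]) hw ?_)
  refine Run.loop_range_const (I := fun i => InsertState n B c X s (B + i)) _ c
    (fun i s' hi hs => ⟨by simpa [Cmp.holds, hs.pointer, hs.pointerEnd],
      hs.step h hXB htop hw hT hTX (B.le_add_right i) (Nat.add_lt_add_left hi B)⟩)
    (fun s' hs => ⟨by simp [Cmp.holds, hs.pointer, hs.pointerEnd], hs.frameOn, ?_⟩)
    ⟨(Frame.refl _ _).frameOn.setReg.setReg, by simp, by simp, ?_⟩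
  · have himage : (Ico B (B + c)).image (s.mem · % n) = T := by
      rw [← coe_inj, coe_image, hT.image_eq]
    exact himage ▸ hs.ready
  · simpa using hr.frame (m := Reg.pointer) (Frame.refl _ _).setReg.setReg

end InsertAll

section Round

variable {w n N k j : ℕ} {inp : List ℕ} {G : SimpleGraph ℕ} {W X : Finset ℕ} {s s' : State}

/-- The graph that `G` induces on `W` has a feedback vertex set of at most `k` vertices. -/
def HasFeedback (G : SimpleGraph ℕ) (W : Finset ℕ) (k : ℕ) : Prop :=
  ∃ F : Finset ℕ, #F ≤ k ∧ IsForestOn G (W \ F)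

/-- The state holds a correct answer for the instance with the graph `G` on `{0, …, n - 1}` and the
parameter `k`, and only cells within the space bound have been accessed. -/
structure Solved (G : SimpleGraph ℕ) (n k : ℕ) (s : State) : Prop where
  top_le : s.top ≤ 3 * k * k + 3 * k + 1
  answer : (s.reg Reg.answer = 1 ∧ ∃ X ⊆ range n, (range (s.reg Reg.size)).image s.mem = X ∧
      #X ≤ 3 * k * k ∧ IsForestOn G (range n \ X)) ∨
    (s.reg Reg.answer = 0 ∧ ¬ HasFeedback G (range n) k)

/-- The search goes on with the stored set `X` and `j` further rounds that may extend it. -/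
structure Searching (G : SimpleGraph ℕ) (n k j : ℕ) (X : Finset ℕ) (s : State) : Prop where
  ready : Ready n X s
  capacity : s.reg Reg.capacity = 3 * k
  base : s.reg Reg.base = 3 * k * k
  budget : s.reg Reg.budget = j
  running : s.reg Reg.running = 1
  top : s.top = 3 * k * k + 3 * k + 1
  budget_le : j ≤ k
  card_le : #X + 3 * k * j ≤ 3 * k * k
  hasFeedback : HasFeedback G (range n) k → HasFeedback G (range n \ X) j

/-- The search has ended. -/
structure Stopped (G : SimpleGraph ℕ) (n k : ℕ) (s : State) : Prop extends Solved G n k s where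
  zero : s.reg Reg.zero = 0
  running : s.reg Reg.running = 0

/-- Stop if what remains of the graph has an empty core, or else if no rounds are left; otherwise
extend the stored set by the vertices with largest core degree. -/
def round : Prog :=
  collect ⨟
  .ite .eq Reg.answer Reg.zero (.const Reg.answer 1 ⨟ .const Reg.running 0)
    (.ite .eq Reg.budget Reg.zero (.const Reg.answer 0 ⨟ .const Reg.running 0)
      (insertAll ⨟ .op .sub Reg.budget Reg.budget Reg.one))

theorem Searching.frameOn {A : Set ℕ} {L : List ℕ} {m : ℕ} (h : Searching G n k j X s)
    (hF : FrameOn A L m s s') (hA : Set.Ico 0 #X ⊆ A)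
    (hr : ∀ r ∈ Finset.Icc Reg.size Reg.running, r ≠ Reg.param → r < m ∧ r ∉ L := by decide) :
    Searching G n k j X s' where
  ready := h.ready.frameOn hF hA fun r hr' => hr r
    (Icc_subset_Icc_right (by decide) hr') ((mem_Icc.1 hr').2.trans_lt (by decide)).ne
  capacity := hF.reg_eq h.capacity (hr _ (by decide) (by decide))
  base := hF.reg_eq h.base (hr _ (by decide) (by decide))
  budget := hF.reg_eq h.budget (hr _ (by decide) (by decide))
  running := hF.reg_eq h.running (hr _ (by decide) (by decide))
  top := hF.top.trans h.top
  budget_le := h.budget_le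
  card_le := h.card_le
  hasFeedback := h.hasFeedback

theorem Searching.card_le_capacity_mul (h : Searching G n k j X s) : #X ≤ 3 * k * k :=
  (Nat.le_add_right _ _).trans h.card_le

theorem Searching.stopped_of_core_eq_empty (h : Searching G n k j X s)
    (hcore : core G (range n \ X) = ∅) :
    Stopped G n k ((s.setReg Reg.answer 1).setReg Reg.running 0) where
  top_le := h.top.le
  answer := .inl ⟨by simp, X, h.ready.subset, by simp [h.ready.size, h.ready.image_mem],
    h.card_le_capacity_mul, isTwoCore_core.isForestOn_iff_eq_empty.2 hcore⟩
  zero := by simp [h.ready.zero]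
  running := by simp

theorem Searching.stopped_of_core_ne_empty (h : Searching G n k 0 X s)
    (hcore : core G (range n \ X) ≠ ∅) :
    Stopped G n k ((s.setReg Reg.answer 0).setReg Reg.running 0) where
  top_le := h.top.le
  answer := .inr ⟨by simp, fun hG => hcore <| isTwoCore_core.isForestOn_iff_eq_empty.1 <| by
    obtain ⟨F, hF, hforest⟩ := h.hasFeedback hG
    rwa [card_eq_zero.1 (Nat.le_zero.1 hF), sdiff_empty] at hforest⟩
  zero := by simp [h.ready.zero]
  running := by simp

theorem HasFeedback.sdiff_isTopSelection {T : Finset ℕ} (h : HasFeedback G W (j + 1))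
    (hjk : j + 1 ≤ k) (hne : core G W ≠ ∅)
    (hT : IsTopSelection (degIn G (core G W)) (3 * k) (core G W) T) : HasFeedback G (W \ T) j := by
  obtain ⟨F, hF, hforest⟩ := h
  obtain ⟨F', hF', hforest'⟩ := isTwoCore_core.exists_smaller_feedback (hF.trans hjk) hforest
    (nonempty_iff_ne_empty.2 hne) hT
  exact ⟨F', by omega, hforest'⟩

/-- A bound for the running time of `round` if there are `M` darts and `n < 2 ^ N`, where `K` is the
content of `Reg.capacity`. -/
def roundCost (n M N K : ℕ) : ℕ := collectCost n M N K + K * (N * 6 + n * 5 + 12) + 6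

theorem Searching.extend_run (h : Setting w inp n N G) (hs : Searching G n k (j + 1) X s)
    (hw : 3 * k * k + 3 * k < 2 ^ w) (hcore : core G (range n \ X) ≠ ∅) {E : Finset ℕ}
    (hE : Candidates (3 * k * k) (3 * k)
      ((core G (range n \ X)).image (code G (range n \ X) n)) E s) :
    Run w inp (insertAll ⨟ .op .sub Reg.budget Reg.budget Reg.one) s
      (3 * k * (N * 6 + n * 5 + 12) + 4) fun s' => ∃ Y, Searching G n k j Y s' := by
  set W := range n \ X
  have hXj : #X + (3 * k * j + 3 * k) ≤ 3 * k * k := hs.card_le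
  have hjk := hs.budget_le
  obtain ⟨T, hET, hT⟩ := exists_isTopSelection_of_codes sdiff_subset hE.isTopSelection
  have hTW : T ⊆ W := hT.subset.trans core_subset
  have hTk : #T ≤ 3 * k := hT.card_le
  have hlength : s.reg Reg.length = #T := by rw [hE.length_eq, hET.finsetCard_eq]
  have hbij := hET.comp (hlength ▸ hE.bijOn)
  have hcost : #T * (N * 6 + n * 5 + 12) ≤ 3 * k * (N * 6 + n * 5 + 12) :=
    Nat.mul_le_mul_right _ hTk
  refine Run.of_le (b := #T * (N * 6 + n * 5 + 12) + 3 + 1) ?_ (by omega)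
  refine .bind (insertAll_run h hs.ready hs.base hlength (by omega) (by rw [hs.top]; omega)
    (by omega) hbij hTW) fun s₁ ⟨hF, hr⟩ => ?_
  refine .sub (hF.reg_eq hs.budget) hr.one (by omega) (by lia) ⟨X ∪ T, ?_⟩
  refine ⟨hr.frame (m := Reg.budget) (Frame.refl _ _).setReg, by simp [hF.reg_eq hs.capacity],
    by simp [hF.reg_eq hs.base], by simp, by simp [hF.reg_eq hs.running], hF.top.trans hs.top,
    by omega, ?_, fun hG => ?_⟩
  · have := card_union_le X T
    omega
  · rw [← sup_eq_union, ← sdiff_sdiff_left]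
    exact (hs.hasFeedback hG).sdiff_isTopSelection hjk hcore hT

theorem Searching.round_run (h : Setting w inp n N G) (hs : Searching G n k j X s)
    (hw : 3 * k * k + 3 * k + 1 < 2 ^ w) :
    Run w inp round s (roundCost n (off inp n - off inp 0) N (3 * k)) fun s' =>
      Stopped G n k s' ∨ ∃ j' Y, j = j' + 1 ∧ Searching G n k j' Y s' := by
  have hcollect := collect_run h hs.ready hs.base hs.capacity hs.card_le_capacity_mul
    (hs.top ▸ Nat.le_succ _) (by omega)
  rw [roundCost]
  generalize collectCost n (off inp n - off inp 0) N (3 * k) = b at hcollect ⊢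
  refine Run.of_le (b := b + ((3 * k * (N * 6 + n * 5 + 12) + 4 + 1) + 1)) ?_ (by omega)
  refine .bind hcollect fun s₁ ⟨hF, hanswer, E, hE⟩ => ?_
  have hs₁ := hs.frameOn hF fun a ha => ha.2.trans_le hs.card_le_capacity_mul
  refine .ite (fun hc => ?_) (fun hc => .ite (fun hc' => ?_) (fun hc' => ?_)) <;>
    simp only [Cmp.holds, hs₁.ready.zero, hanswer] at hc
  · refine Run.of_le (b := 1 + 1) ?_ (by omega)
    exact .seq (.const (by omega) (.const (by omega) (.inl (hs₁.stopped_of_core_eq_empty hc))))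
  · simp only [Cmp.holds, hs₁.ready.zero, hs₁.budget] at hc'
    subst hc'
    refine Run.of_le (b := 1 + 1) ?_ (by omega)
    exact .seq (.const (by omega) (.const (by omega) (.inl (hs₁.stopped_of_core_ne_empty hc))))
  · simp only [Cmp.holds, hs₁.ready.zero, hs₁.budget] at hc'
    obtain ⟨j, rfl⟩ := Nat.exists_eq_succ_of_ne_zero hc'
    exact (hs₁.extend_run h (by omega) hc hE).imp fun s₂ ⟨Y, hY⟩ => .inr ⟨j, Y, rfl, hY⟩

end Round

section Solver

variable {w n N M k j : ℕ} {inp : List ℕ} {G : SimpleGraph ℕ} {X : Finset ℕ} {s : State}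

@[simp] theorem State.reg_touch (s : State) (a : ℕ) : (s.touch a).reg = s.reg := rfl

@[simp] theorem State.mem_touch (s : State) (a : ℕ) : (s.touch a).mem = s.mem := rfl

@[simp] theorem State.top_touch (s : State) (a : ℕ) : (s.touch a).top = max s.top (a + 1) := rfl

theorem Run.store_touch {Q : State → Prop} {x y a v : ℕ} (hx : s.reg x = a) (hy : s.reg y = v)
    (h : Q ((s.touch a).setMem a v)) : Run w inp (.store x y) s 1 Q :=
  ⟨_, 1, .store s x y, le_rfl, by rwa [hx, hy]⟩

/-- Return the set of all vertices. -/
def returnAll : Prog :=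
  .move Reg.size Reg.order ⨟ .const Reg.answer 1 ⨟ .const Reg.vertex 0 ⨟
  .loop .lt Reg.vertex Reg.order (
    .store Reg.vertex Reg.vertex ⨟ .op .add Reg.vertex Reg.vertex Reg.one)

/-- The invariant of `returnAll` before the vertex `i` is listed. -/
structure ListingState (n i : ℕ) (s : State) : Prop where
  answer : s.reg Reg.answer = 1
  size : s.reg Reg.size = n
  one : s.reg Reg.one = 1
  order : s.reg Reg.order = n
  vertex : s.reg Reg.vertex = i
  top_le : s.top ≤ i
  mem : ∀ a < i, s.mem a = a

theorem ListingState.step {i : ℕ} (h : ListingState n i s) (hw : i + 1 < 2 ^ w) :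
    Run w inp (.store Reg.vertex Reg.vertex ⨟ .op .add Reg.vertex Reg.vertex Reg.one) s 2
      (ListingState n (i + 1)) := by
  refine Run.of_le (b := 1 + 1) ?_ le_rfl
  refine .seq (.store_touch h.vertex h.vertex ?_)
  refine .add (a := i) (c := 1) h.vertex h.one hw ⟨by simp [h.answer], by simp [h.size],
    by simp [h.one], by simp [h.order], by simp, ?_, fun a ha => ?_⟩
  · simpa using h.top_le.trans i.le_succ
  · rcases Nat.lt_succ_iff_lt_or_eq.1 ha with hai | rfl
    · simpa [hai.ne] using h.mem a hai
    · simp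

theorem ListingState.solved (h : ListingState n n s) (hn : n ≤ 3 * k * k) : Solved G n k s where
  top_le := by have := h.top_le; omega
  answer := by
    refine .inl ⟨h.answer, range n, subset_rfl, ?_, by rwa [card_range], ?_⟩
    · rw [h.size, image_congr (g := id) fun a ha => h.mem a (by simpa using ha), image_id]
    · rw [sdiff_self]
      exact isForestOn_empty

theorem returnAll_run (hw : n + 1 < 2 ^ w) (hone : s.reg Reg.one = 1)
    (horder : s.reg Reg.order = n) (htop : s.top = 0) (hn : n ≤ 3 * k * k) :
    Run w inp returnAll s (n * 3 + 4) (Solved G n k) := by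
  refine Run.of_le (b := 1 + (1 + (1 + (n * (2 + 1) + 1)))) ?_ (by omega)
  refine .seq (.move horder hone (.seq (.const (by omega) (.seq (.const (by omega) ?_)))))
  exact Run.loop_range_const (I := ListingState n) _ n
    (fun i s' hi hs => ⟨by simpa [Cmp.holds, hs.vertex, hs.order], hs.step (by omega)⟩)
    (fun s' hs => ⟨by simp [Cmp.holds, hs.vertex, hs.order], hs.solved hn⟩)
    ⟨by simp, by simp, by simp [hone], by simp [horder], by simp, by simp [htop], by simp⟩

/-- Put the number of darts, which is the length of all adjacency arrays together, into
`Reg.word`. -/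
def countDarts : Prog :=
  .op .add Reg.address Reg.order Reg.two ⨟ .read Reg.word Reg.address ⨟
  .op .add Reg.address Reg.address Reg.one ⨟ .op .sub Reg.word Reg.word Reg.address

theorem countDarts_run (h : Setting w inp n N G) (hone : s.reg Reg.one = 1)
    (horder : s.reg Reg.order = n) (htwo : s.reg Reg.two = 2) :
    Run w inp countDarts s 4 fun s' =>
      Frame Reg.word s s' ∧ s'.reg Reg.word = off inp n - off inp 0 := by
  have hlin := h.linear_lt
  have hoff := h.off_lt le_rfl
  have hmono := h.represents.off_mono n.zero_le le_rfl
  rw [h.represents.off_zero] at hmono ⊢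
  refine Run.of_le (b := 1 + (1 + (1 + 1))) ?_ le_rfl
  refine .seq (.add horder htwo (by omega) ?_)
  refine .seq (.read (a := n + 2) (v := off inp n) (by simp) rfl (by omega) ?_)
  refine .seq (.add (a := n + 2) (c := 1) (by simp) (by simp [hone]) (by omega) ?_)
  refine .sub (a := off inp n) (c := n + 3) (by simp) (by simp) hmono (by omega) ?_
  exact ⟨(Frame.refl _ s).setReg.setReg.setReg.setReg, by simp⟩

theorem not_hasFeedback_of_lt (h : Represents inp n G)
    (hM : (k + 1) * n * 2 < off inp n - off inp 0) : ¬ HasFeedback G (range n) k := by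
  rintro ⟨F, hF, hforest⟩
  have hdeg := sum_degIn_le_of_isForestOn_sdiff hforest
  rw [← sum_congr rfl fun v hv => h.card_positions (mem_range.1 hv), card_range] at hdeg
  have hFn : (#F + 1) * n ≤ (k + 1) * n := by gcongr
  have := h.off_add_sum_card_positions le_rfl
  omega

/-- The registers for constants have been initialised, and no cell has been accessed. -/
structure Prepared (n k : ℕ) (s : State) : Prop where
  zero : s.reg Reg.zero = 0
  one : s.reg Reg.one = 1
  order : s.reg Reg.order = n
  two : s.reg Reg.two = 2
  param : s.reg Reg.param = k
  capacity : s.reg Reg.capacity = 3 * k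
  base : s.reg Reg.base = 3 * k * k
  top : s.top = 0

theorem Prepared.frame {m : ℕ} {s' : State} (h : Prepared n k s) (hF : Frame m s s')
    (hm : Reg.base < m := by decide) : Prepared n k s' :=
  have hF' := hF.mono hm
  ⟨hF'.reg_eq h.zero, hF'.reg_eq h.one, hF'.reg_eq h.order, hF'.reg_eq h.two, hF'.reg_eq h.param,
    hF'.reg_eq h.capacity, hF'.reg_eq h.base, hF.top.trans h.top⟩

/-- Begin the search with the empty set. This accesses the last cell that is ever needed, so that
later accesses do not change the high-water mark. -/
def startSearch : Prog :=
  .op .add Reg.address Reg.base Reg.capacity ⨟ .store Reg.address Reg.zero ⨟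
  .const Reg.size 0 ⨟ .move Reg.budget Reg.param ⨟ .const Reg.running 1

theorem Prepared.startSearch_run (h : Prepared n k s) (hw : 3 * k * k + 3 * k + 1 < 2 ^ w) :
    Run w inp startSearch s 5 (Searching G n k k ∅) := by
  refine Run.of_le (b := 1 + (1 + (1 + (1 + 1)))) ?_ le_rfl
  refine .seq (.add h.base h.capacity (by omega) ?_)
  refine .seq (.store_touch (a := 3 * k * k + 3 * k) (v := 0) (by simp) (by simp [h.zero]) ?_)
  refine .seq (.const (by omega) ?_)
  refine .seq (.move (a := k) (by simp [h.param]) (by simp [h.one]) ?_)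
  refine .const (by omega) ?_
  exact
    { ready := by constructor <;> simp [h.zero, h.one, h.order, h.two, StrictMonoOn]
      capacity := by simp [h.capacity]
      base := by simp [h.base]
      budget := by simp
      running := by simp
      top := by simp [h.top]
      budget_le := le_rfl
      card_le := by simp
      hasFeedback := by simp }

theorem Searching.loop_round_run (h : Setting w inp n N G) (hs : Searching G n k j X s)
    (hw : 3 * k * k + 3 * k + 1 < 2 ^ w) :
    Run w inp (.loop .ne Reg.running Reg.zero round) s
      ((j + 1) * (roundCost n (off inp n - off inp 0) N (3 * k) + 1) + 1) (Solved G n k) := by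
  refine Run.loop (I := fun fuel s' => Stopped G n k s' ∨
    ∃ j X, fuel = j + 1 ∧ Searching G n k j X s') _ ?_ ?_ (.inr ⟨j, X, rfl, hs⟩)
  · rintro fuel s' (hs' | ⟨j, Y, rfl, hs'⟩) hc
    · exact absurd (hs'.running.trans hs'.zero.symm) hc
    · exact ⟨j, rfl, hs'.round_run h hw⟩
  · rintro fuel s' (hs' | ⟨j, Y, rfl, hs'⟩) hc
    · exact hs'.toSolved
    · simp [Cmp.holds, hs'.running, hs'.ready.zero] at hc

theorem roundCost_mono {M M' K : ℕ} (h : M ≤ M') : roundCost n M N K ≤ roundCost n M' N K := by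
  unfold roundCost collectCost dartCost
  gcongr

/-- Search for a feedback vertex set, unless there are too many edges. -/
def search : Prog :=
  countDarts ⨟ .op .add Reg.key Reg.param Reg.one ⨟ .op .mul Reg.key Reg.key Reg.order ⨟
  .op .mul Reg.key Reg.key Reg.two ⨟
  .ite .lt Reg.key Reg.word (.const Reg.answer 0)
    (startSearch ⨟ .loop .ne Reg.running Reg.zero round)

theorem Prepared.search_run (h : Setting w inp n N G) (hs : Prepared n k s) (hk : 3 * k * k < n) :
    Run w inp search s ((k + 1) * (roundCost n ((k + 1) * n * 2) N (3 * k) + 1) + 14)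
      (Solved G n k) := by
  have hlin := h.linear_lt
  have hkn : k < n := by nlinarith [k.le_mul_self]
  have hlimit : (k + 1) * n * 2 < 2 ^ w := by nlinarith [h.mul_le_two_pow]
  set b := (k + 1) * (roundCost n ((k + 1) * n * 2) N (3 * k) + 1) with hb
  refine Run.of_le (b := 4 + (1 + (1 + (1 + (5 + (b + 1) + 1))))) ?_ (by omega)
  refine .bind (countDarts_run h hs.one hs.order hs.two) fun s₁ ⟨hF, hword⟩ => ?_
  have hs₁ := hs.frame hF
  refine .seq (.add (a := k) (c := 1) hs₁.param hs₁.one (by omega) ?_)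
  refine .seq (.mul (a := k + 1) (c := n) (by simp) (by simp [hs₁.order]) (by omega) ?_)
  refine .seq (.mul (a := (k + 1) * n) (c := 2) (by simp) (by simp [hs₁.two]) hlimit ?_)
  refine .ite (fun hc => ?_) (fun hc => ?_) <;>
    simp only [Cmp.holds, State.reg_setReg, reduceIte,
      if_neg (by decide : Reg.word ≠ Reg.key), hword, not_lt] at hc
  · exact (Run.const (by omega) ⟨by simp [hs₁.top],
      .inr ⟨by simp, not_hasFeedback_of_lt h.represents hc⟩⟩).of_le (by omega)
  · have hs₂ : Prepared n k (((s₁.setReg Reg.key (k + 1)).setReg Reg.key ((k + 1) * n)).setReg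
        Reg.key ((k + 1) * n * 2)) :=
      hs₁.frame (m := Reg.key) (Frame.refl _ _).setReg.setReg.setReg
    refine .bind (hs₂.startSearch_run (by nlinarith)) fun s₃ hs₃ =>
      (hs₃.loop_round_run h (by nlinarith)).of_le ?_
    rw [hb]
    gcongr
    exact roundCost_mono hc

/-- The program for Feedback Vertex Set. The first comparison makes sure that the computation of
`3 k ^ 2` does not overflow. -/
def solve : Prog :=
  .const Reg.one 1 ⨟ .const Reg.zero 0 ⨟ .const Reg.two 2 ⨟
  .read Reg.order Reg.zero ⨟ .read Reg.param Reg.one ⨟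
  .ite .le Reg.order Reg.param returnAll (
    .const Reg.capacity 3 ⨟ .op .mul Reg.capacity Reg.capacity Reg.param ⨟
    .op .mul Reg.base Reg.capacity Reg.param ⨟
    .ite .le Reg.order Reg.base returnAll search)

theorem solve_run (h : Setting w inp n N G) (hk : inp.getD 1 0 = k) (hkw : k < 2 ^ w) {b : ℕ}
    (hb : 3 * k * k < n → (k + 1) * (roundCost n ((k + 1) * n * 2) N (3 * k) + 1) ≤ b) :
    Run w inp solve State.init (b + n * 3 + 24) (Solved G n k) := by
  have hlin := h.linear_lt
  refine Run.of_le (b := 1 + (1 + (1 + (1 + (1 + ((1 + (1 + (1 + (b + n * 3 + 14 + 1)))) + 1))))))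
    ?_ (by omega)
  refine .seq (.const (by omega) (.seq (.const (by omega) (.seq (.const (by omega) ?_)))))
  refine .seq (.read (a := 0) (by simp) h.represents.head (by omega) ?_)
  refine .seq (.read (a := 1) (by simp) hk hkw ?_)
  refine .ite (fun hc => ?_) (fun hc => ?_)
  · have hnk : n ≤ k := by simpa [Cmp.holds] using hc
    have hkk := k.le_mul_self
    exact (returnAll_run (by omega) (by simp) (by simp) rfl (by nlinarith)).of_le (by omega)
  have hkn : k < n := by simpa [Cmp.holds] using hc
  refine .seq (.const (by omega) ?_)
  refine .seq (.mul (a := 3) (c := k) (by simp) (by simp) (by omega) ?_)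
  refine .seq (.mul (a := 3 * k) (c := k) (by simp) (by simp) (by nlinarith [h.mul_le_two_pow]) ?_)
  refine .ite (fun hc' => ?_) (fun hc' => ?_)
  · have hn : n ≤ 3 * k * k := by simpa [Cmp.holds] using hc'
    exact (returnAll_run (by omega) (by simp) (by simp) rfl hn).of_le (by omega)
  · have hn : 3 * k * k < n := by simpa [Cmp.holds] using hc'
    have := hb hn
    exact (Prepared.search_run h (by constructor <;> simp [State.init]) hn).of_le (by omega)

end Solver

section Encode

variable {n : ℕ} (G : SimpleGraph (Fin n)) (k : ℕ)

theorem encode_getD_zero : (encode G k).getD 0 0 = n := rfl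

theorem encode_getD_one : (encode G k).getD 1 0 = k := rfl

theorem off_encode {i : ℕ} (hi : i ≤ n) : off (encode G k) i =
    n + 3 + (((List.finRange n).take i).flatMap (neighborList G)).length := by
  rw [off, encode, List.append_assoc, List.getD_append_right _ _ _ _ (by simp),
    List.getD_append _ _ _ _ (by simp; omega)]
  simp [List.getD_eq_getElem?_getD, Nat.lt_succ_of_le hi]

theorem encode_getD_add (j : ℕ) : (encode G k).getD (n + 3 + j) 0 =
    (((List.finRange n).flatMap (neighborList G)).map Fin.val).getD j 0 := by
  rw [encode, List.getD_append_right _ _ _ _ (by simp)]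
  congr 1
  · simp [List.map_eq_flatMap]
  · simp

theorem flatMap_take_succ {α : Type*} (f : Fin n → List α) (v : Fin n) :
    ((List.finRange n).take (v + 1)).flatMap f = ((List.finRange n).take v).flatMap f ++ f v := by
  simp [List.take_add_one]

theorem off_encode_succ (v : Fin n) :
    off (encode G k) (v + 1) = off (encode G k) v + (neighborList G v).length := by
  rw [off_encode G k v.2, off_encode G k v.2.le, flatMap_take_succ, List.length_append,
    ← Nat.add_assoc]

theorem encode_getD_off (v : Fin n) {j : ℕ} (hj : j < (neighborList G v).length) :
    (encode G k).getD (off (encode G k) v + j) 0 = (neighborList G v)[j] := by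
  have hsplit : (List.finRange n).flatMap (neighborList G) =
      ((List.finRange n).take v).flatMap (neighborList G) ++ (neighborList G v ++
        ((List.finRange n).drop (v + 1)).flatMap (neighborList G)) := by
    rw [← List.append_assoc, ← flatMap_take_succ, ← List.flatMap_append, List.take_append_drop]
  rw [off_encode G k v.2.le, Nat.add_assoc, encode_getD_add, hsplit, List.map_append,
    List.map_append, List.getD_append_right _ _ _ _ (by simp), List.length_map,
    Nat.add_sub_cancel_left, List.getD_append _ _ _ _ (by simpa using hj)]
  simp [List.getD_eq_getElem?_getD, hj]

theorem mem_neighborList {v u : Fin n} : u ∈ neighborList G v ↔ G.Adj v u := by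
  simp [neighborList]

theorem pairwise_neighborList (v : Fin n) : (neighborList G v).Pairwise (· < ·) :=
  (List.pairwise_lt_finRange n).filter _

theorem mem_positions_encode (v : Fin n) {p : ℕ} : p ∈ positions (encode G k) v ↔
    ∃ j < (neighborList G v).length, off (encode G k) v + j = p := by
  rw [positions, off_encode_succ, mem_Ico]
  exact ⟨fun _ => ⟨p - off (encode G k) v, by omega, by omega⟩, fun _ => by omega⟩

theorem adj_iff_exists_mem_positions (v : Fin n) (u : ℕ) : (G.map Fin.valEmbedding).Adj v u ↔
    ∃ p ∈ positions (encode G k) v, (encode G k).getD p 0 = u := by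
  simp only [mem_positions_encode, SimpleGraph.map_adj]
  constructor
  · rintro ⟨a, b, hab, hav, rfl⟩
    obtain rfl : a = v := Fin.ext hav
    obtain ⟨j, hj, hb⟩ := List.getElem_of_mem ((mem_neighborList G).2 hab)
    exact ⟨_, ⟨j, hj, rfl⟩, by rw [encode_getD_off G k a hj, hb, Fin.valEmbedding_apply]⟩
  · rintro ⟨_, ⟨j, hj, rfl⟩, rfl⟩
    exact ⟨v, _, (mem_neighborList G).1 (List.getElem_mem hj), rfl, (encode_getD_off G k v hj).symm⟩

theorem strictMonoOn_positions_encode (v : Fin n) :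
    StrictMonoOn (fun p => (encode G k).getD p 0) (positions (encode G k) v) := by
  intro p hp q hq hpq
  rw [mem_coe, mem_positions_encode] at hp hq
  obtain ⟨i, hi, rfl⟩ := hp
  obtain ⟨j, hj, rfl⟩ := hq
  simp only [encode_getD_off G k v hi, encode_getD_off G k v hj]
  exact List.pairwise_iff_getElem.1 (pairwise_neighborList G v) i j hi hj (by omega)

theorem represents_encode : Represents (encode G k) n (G.map Fin.valEmbedding) where
  head := encode_getD_zero G k
  off_zero := by simp [off_encode G k n.zero_le]
  off_le_succ i hi := by simp [off_encode_succ G k ⟨i, hi⟩]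
  adj_iff v hv := adj_iff_exists_mem_positions G k ⟨v, hv⟩
  strictMonoOn v hv := strictMonoOn_positions_encode G k ⟨v, hv⟩
  lt_of_adj v u hvu := by
    obtain ⟨a, b, -, rfl, -⟩ := SimpleGraph.map_adj .. |>.1 hvu
    exact a.2

end Encode

section Transfer

variable {V V' : Type*} {G : SimpleGraph V} (f : V ↪ V')

theorem degIn_map (S : Finset V) (v : V) : degIn (G.map f) (S.map f) (f v) = degIn G S v := by
  have hmap : neighborsIn (G.map f) (S.map f) (f v) = (neighborsIn G S v).map f := by
    ext x
    simp only [mem_neighborsIn, mem_map]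
    constructor
    · rintro ⟨⟨a, ha, rfl⟩, h⟩
      exact ⟨a, ⟨ha, SimpleGraph.map_adj_apply.1 h⟩, rfl⟩
    · rintro ⟨a, ⟨ha, h⟩, rfl⟩
      exact ⟨⟨a, ha, rfl⟩, SimpleGraph.map_adj_apply.2 h⟩
  rw [degIn, hmap, card_map, degIn]

theorem isForestOn_map {W : Finset V} : IsForestOn (G.map f) (W.map f) ↔ IsForestOn G W := by
  refine ⟨fun h S hS hne => ?_, fun h S hS hne => ?_⟩
  · obtain ⟨v, hv, hdeg⟩ := h (S.map f) (map_subset_map.2 hS) hne.map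
    obtain ⟨u, hu, rfl⟩ := mem_map.1 hv
    exact ⟨u, hu, degIn_map (G := G) f S u ▸ hdeg⟩
  · obtain ⟨S, hSW, rfl⟩ := subset_map_iff.1 hS
    obtain ⟨v, hv, hdeg⟩ := h S hSW (map_nonempty.1 hne)
    exact ⟨f v, mem_map_of_mem f hv, (degIn_map f S v).trans_le hdeg⟩

variable {n k : ℕ} {G : SimpleGraph (Fin n)} {s : State}

theorem isFeedbackVertexSet_iff {X : Finset (Fin n)} : IsFeedbackVertexSet G (X : Set (Fin n)) ↔
    IsForestOn (G.map Fin.valEmbedding) (range n \ X.map Fin.valEmbedding) := by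
  classical
  rw [IsFeedbackVertexSet, ← coe_compl, ← isForestOn_iff_isAcyclic, ← Nat.Iio_eq_range,
    ← Fin.map_valEmbedding_univ, ← Finset.map_sdiff, isForestOn_map, compl_eq_univ_sdiff]

theorem IsYesInstance.hasFeedback (h : IsYesInstance G k) :
    HasFeedback (G.map Fin.valEmbedding) (range n) k := by
  obtain ⟨F, hF, hforest⟩ := h
  exact ⟨F.map Fin.valEmbedding, by rwa [card_map], isFeedbackVertexSet_iff.1 hforest⟩

theorem Solved.returns_or_answersNo (h : Solved (G.map Fin.valEmbedding) n k s) :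
    (∃ X : Finset (Fin n), Returns s X ∧ #X ≤ 3 * k ^ 2 ∧
      IsFeedbackVertexSet G (X : Set (Fin n))) ∨ (AnswersNo s ∧ ¬ IsYesInstance G k) := by
  rcases h.answer with ⟨hanswer, X, hX, himage, hcard, hforest⟩ | ⟨hanswer, hno⟩
  · rw [← Nat.Iio_eq_range, ← Fin.map_valEmbedding_univ, subset_map_iff] at hX
    obtain ⟨Y, -, rfl⟩ := hX
    refine .inl ⟨Y, ⟨hanswer, himage⟩, ?_, isFeedbackVertexSet_iff.2 hforest⟩
    rwa [card_map, mul_assoc, ← pow_two] at hcard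
  · exact .inr ⟨hanswer, fun h => hno h.hasFeedback⟩

end Transfer

section Bounds

variable {w n k : ℕ} {s : State}

theorem one_le_lg (x : ℕ) : 1 ≤ lg x :=
  Nat.log_pos (by norm_num) (by omega)

theorem add_three_le_two_pow_lg (x : ℕ) : x + 3 ≤ 2 ^ (lg x + 1) :=
  Nat.lt_pow_succ_log_self (by norm_num) (x + 2)

theorem sq_le_two_mul_two_pow (m : ℕ) : m ^ 2 ≤ 2 * 2 ^ m := by
  rcases lt_or_ge m 4 with h | h
  · interval_cases m <;> norm_num
  · induction m, h using Nat.le_induction with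
    | base => norm_num
    | succ m hm ih =>
      rw [pow_succ 2]
      nlinarith

theorem lg_le_of_lt_pow_four (h : n + 2 < (k + 2) ^ 4) : lg n ≤ 8 * lg k := by
  have hlg : lg n < 4 * (lg k + 1) := by
    refine Nat.log_lt_of_lt_pow (by omega) (h.trans_le ?_)
    rw [mul_comm 4, pow_mul]
    exact Nat.pow_le_pow_left (by have := add_three_le_two_pow_lg k; omega) 4
  have := one_le_lg k
  omega

theorem sq_mul_lg_le_of_pow_four_le (h : (k + 2) ^ 4 ≤ n + 2) :
    (k + 1) ^ 2 * lg n ≤ 2 * (n + 2) := by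
  have hlg : 2 ^ lg n ≤ n + 2 := Nat.pow_log_le_self 2 (by omega)
  refine (Nat.pow_le_pow_iff_left two_ne_zero).1 ?_
  calc ((k + 1) ^ 2 * lg n) ^ 2 = (k + 1) ^ 4 * lg n ^ 2 := by ring
    _ ≤ (k + 2) ^ 4 * (2 * 2 ^ lg n) := by
      gcongr
      · omega
      · exact sq_le_two_mul_two_pow _
    _ ≤ (n + 2) * (2 * (n + 2)) := by gcongr
    _ ≤ (2 * (n + 2)) ^ 2 := by nlinarith

-- Trades the factor `log n` for `log k`: either `n` is polynomial in `k`, or `k ^ 2 = O(√n)`.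
theorem sq_mul_lg_le (h : 3 * k * k < n) : (k + 1) ^ 2 * lg n ≤ 32 * ((n + 1) * lg k) := by
  rcases lt_or_ge (n + 2) ((k + 2) ^ 4) with hlt | hge
  · have hk : (k + 1) ^ 2 ≤ 4 * (n + 1) := by nlinarith
    calc (k + 1) ^ 2 * lg n ≤ 4 * (n + 1) * (8 * lg k) :=
          Nat.mul_le_mul hk (lg_le_of_lt_pow_four hlt)
      _ = 32 * ((n + 1) * lg k) := by ring
  · calc (k + 1) ^ 2 * lg n ≤ 2 * (n + 2) := sq_mul_lg_le_of_pow_four_le hge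
      _ ≤ 32 * ((n + 1) * 1) := by omega
      _ ≤ 32 * ((n + 1) * lg k) := by
        gcongr
        exact one_le_lg k

theorem roundCost_le (n k : ℕ) : roundCost n ((k + 1) * n * 2) (lg n + 1) (3 * k) + 1 ≤
    475 * ((k + 1) ^ 2 * (n + 1) ^ 3 * lg n) := by
  obtain ⟨l, hl⟩ := Nat.exists_eq_add_of_le (one_le_lg n)
  rw [hl, roundCost, collectCost, dartCost]
  -- In the expansions in `n`, `k` and `l`, every coefficient on the left is at most the one on the
  -- right.
  ring_nf
  omega

theorem rounds_cost_le (h : 3 * k * k < n) :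
    (k + 1) * (roundCost n ((k + 1) * n * 2) (lg n + 1) (3 * k) + 1) ≤
      15200 * ((n + 1) ^ 4 * (k + 1) * lg k) :=
  calc (k + 1) * (roundCost n ((k + 1) * n * 2) (lg n + 1) (3 * k) + 1)
    _ ≤ (k + 1) * (475 * ((k + 1) ^ 2 * (n + 1) ^ 3 * lg n)) := by
        gcongr
        exact roundCost_le n k
    _ = 475 * ((k + 1) * (n + 1) ^ 3) * ((k + 1) ^ 2 * lg n) := by ring
    _ ≤ 475 * ((k + 1) * (n + 1) ^ 3) * (32 * ((n + 1) * lg k)) :=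
        Nat.mul_le_mul_left _ (sq_mul_lg_le h)
    _ = 15200 * ((n + 1) ^ 4 * (k + 1) * lg k) := by ring

theorem setting_encode (G : SimpleGraph (Fin n)) (k : ℕ) (hw : 6 * lg n ≤ w) :
    Setting w (encode G k) n (lg n + 1) (G.map Fin.valEmbedding) where
  represents := represents_encode G k
  mul_le_two_pow := by
    have hn := add_three_le_two_pow_lg n
    have hlg := one_le_lg n
    calc 4 * ((n + 3) * (n + 3)) ≤ 2 ^ 2 * (2 ^ (lg n + 1) * 2 ^ (lg n + 1)) := by
          gcongr
          norm_num
      _ = 2 ^ (2 + ((lg n + 1) + (lg n + 1))) := by simp only [pow_add]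
      _ ≤ 2 ^ w := Nat.pow_le_pow_right two_pos (by omega)
  lt_two_pow := by have := add_three_le_two_pow_lg n; omega

theorem solve_encode_run (G : SimpleGraph (Fin n)) (hw : 6 * lg n ≤ w) (hk : k < 2 ^ w) :
    Run w (encode G k) solve State.init (15224 * ((n + 1) ^ 4 * (k + 1) * lg k))
      (Solved (G.map Fin.valEmbedding) n k) := by
  refine (solve_run (setting_encode G k hw) (encode_getD_one G k) hk rounds_cost_le).of_le ?_
  have hn : n + 1 ≤ (n + 1) ^ 4 * (k + 1) * lg k :=
    calc n + 1 ≤ (n + 1) ^ 4 := Nat.le_self_pow (by norm_num) _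
      _ = (n + 1) ^ 4 * 1 * 1 := by ring
      _ ≤ (n + 1) ^ 4 * (k + 1) * lg k := by
        gcongr
        · omega
        · exact one_le_lg k
  omega

theorem Solved.spaceBits_le {G : SimpleGraph ℕ} {a L : ℕ} (h : Solved G n k s) (p : Prog)
    (hw : w ≤ a * L) : spaceBits w p s ≤ (p.numRegs + 3) * a * ((k + 1) ^ 2 * L) := by
  have htop : s.top ≤ 3 * (k + 1) ^ 2 := h.top_le.trans (by lia)
  have hregs : p.numRegs ≤ p.numRegs * (k + 1) ^ 2 :=
    Nat.le_mul_of_pos_right _ (by positivity)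
  calc spaceBits w p s ≤ (p.numRegs * (k + 1) ^ 2 + 3 * (k + 1) ^ 2) * (a * L) := by
        unfold spaceBits
        gcongr
    _ = (p.numRegs + 3) * a * ((k + 1) ^ 2 * L) := by ring

end Bounds

end ROWordRAM

/-- There is one program, with constants `c` and `C`, that on every instance `(G, k)` and for every
word size `w` between `c log n` and `a log n` in which `k` fits halts within
`C n ^ 4 k log k` steps, uses at most `C a k ^ 2 log n` bits, and either returns a feedback vertex
set with at most `3 k ^ 2` vertices, or answers correctly that `(G, k)` is a no-instance. (In the
bounds, `n`, `k` and the logarithms are shifted so as not to vanish for `n, k ≤ 1`.) -/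
theorem mainTheorem4 :
    ∃ (P : ROWordRAM.Prog) (c C : ℕ),
      ∀ (n : ℕ) (G : SimpleGraph (Fin n)) (k w a : ℕ),
        c * ROWordRAM.lg n ≤ w → w ≤ a * ROWordRAM.lg n → k < 2 ^ w →
        ∃ (s : ROWordRAM.State) (t : ℕ),
          ROWordRAM.Exec w (ROWordRAM.encode G k) P ROWordRAM.State.init s t ∧
          t ≤ C * ((n + 1) ^ 4 * (k + 1) * ROWordRAM.lg k) ∧
          ROWordRAM.spaceBits w P s ≤ C * a * ((k + 1) ^ 2 * ROWordRAM.lg n) ∧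
          ((∃ X : Finset (Fin n), ROWordRAM.Returns s X ∧ X.card ≤ 3 * k ^ 2 ∧
              ROWordRAM.IsFeedbackVertexSet G (X : Set (Fin n))) ∨
            (ROWordRAM.AnswersNo s ∧ ¬ ROWordRAM.IsYesInstance G k)) := by
  open ROWordRAM in
  refine ⟨solve, 6, solve.numRegs + 15224, fun n G k w a hw hwa hk => ?_⟩
  obtain ⟨s, t, hexec, ht, hs⟩ := solve_encode_run G hw hk
  have htime := ht.trans (Nat.mul_le_mul_right _ (Nat.le_add_left 15224 solve.numRegs))
  have hspace := (hs.spaceBits_le solve hwa).trans <|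
    Nat.mul_le_mul_right _ (Nat.mul_le_mul_right a (by omega : _ ≤ solve.numRegs + 15224))
  exact ⟨s, t, hexec, htime, hspace, hs.returns_or_answersNo⟩
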